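/- **Setting.** Let $s,r,n,n_1,n_2$ be natural numbers with $r\ge 1$ and $n_1+n_2=n+1$. For $X\in\mathbb C^{s\times n}$ with columns $x_0,\dots,x_{n-1}$ let $\mathcal H(X)\in\mathbb C^{sn_1\times n_2}$ be its vectorized Hankel lift, the block matrix whose $(a,c)$ block ($0\le a<n_1$, $0\le c<n_2$) is $x_{a+c}\in\mathbb C^s$. Let $w_j$ be the number of pairs $(a,c)$ with $0\le a<n_1$, $0\le c<n_2$ and $a+c=j$, let $\mathcal D$ multiply the $j$-th column by $\sqrt{w_j}$, and put $\mathcal G=\mathcal H\mathcal D^{-1}$, with adjoint $\mathcal G^*$ for the Frobenius inner product. Let $X_\star\in\mathbb C^{s\times n}$ be such that $M_\star=\mathcal H(X_\star)$ has rank $r$ (in blind super-resolution $X_\star=\sum_{k=1}^r d_kh_ka_{\tau_k}^T$ with $a_\tau=(e^{-2\pi i\tau j})_{0\le j<n}$), with compact singular value decomposition $M_\star=U_\star\Sigma_\star V_\star^H$, largest and smallest nonzero singular values $\sigma_1(M_\star)$ and $\sigma_r(M_\star)$, and $\kappa=\sigma_1(M_\star)/\sigma_r(M_\star)$. Assume that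 $M_\star$ is $\mu_1$-incoherent: each of the $n_1$ consecutive $s\times r$ blocks $U_\star^j$ of $U_\star$ satisfies $\|U_\star^j\|_F^2\le\mu_1r/n$, and each row of $V_\star$ has squared Euclidean norm at most $\mu_1r/n$. Let $b_0,\dots,b_{n-1}\in\mathbb C^s$ be i.i.d. random vectors with $\mathbb E[b_ib_i^H]=I_s$ and $\max_\ell|b_i[\ell]|^2\le\mu_0$ almost surely. Let $\mathcal A(X)=(b_j^HXe_j)_{0\le j<n}$ and $\mathcal A^*(y)=\sum_jy_jb_je_j^T$, and let $y=\mathcal A\mathcal D(X_\star)$ be the weighted measurements. **Algorithm (VGD-VHL).** Let $U^0\Sigma^0(V^0)^H$ be a top-$r$ singular value decomposition of $\mathcal G\mathcal A^*(y)$, and set $L^0=U^0(\Sigma^0)^{1/2}$, $R^0=V^0(\Sigma^0)^{1/2}$. With step size $\eta>0$ iterate $$L^{k+1}=L^k-\eta E^kR^k,\qquad R^{k+1}=R^k-\eta (E^k)^HL^k,$$ $$E^k=\mathcal G\mathcal A^*\big(\mathcal A\mathcal G^*(L^k(R^k)^H)-y\big)+(\mathcal I-\mathcal G\mathcal G^*)(L^k(R^k)^H),$$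 which is gradient descent for $f(L,R)=\frac12\|y-\mathcal A\mathcal G^*(LR^H)\|_2^2+\frac12\|(\mathcal I-\mathcal G\mathcal G^*)(LR^H)\|_F^2$. Put $X^k=\mathcal D^{-1}\mathcal G^*(L^k(R^k)^H)$. **Theorem.** There are universal constants $c_1,c_2,C_1,C_2>0$ such that the following holds in the setting above. If $0<\delta_0\le\frac2{25}$, $0<\eta\le\frac1{25\sigma_1(M_\star)}$ and $$n\ge C_1\delta_0^{-2}\mu_0^2\mu_1s^2r^2\kappa^3\log^2(sn),$$ then, with probability at least $1-c_1(sn)^{-c_2}$, for every choice of the top-$r$ singular value decomposition in the initialization, all $k\ge0$ satisfy $$\|X^k-X_\star\|_F^2\le\Big(1-\frac{\eta\sigma_r(M_\star)}{28}\Big)^k\sigma_r^2(M_\star).$$ On the same event the iteration complexity is $O(\kappa\log(1/\varepsilon))$ for step sizes of order $1/\sigma_1(M_\star)$: if $\eta\ge\theta/\sigma_1(M_\star)$ with $\theta>0$, then for every $\varepsilon\in(0,1)$ and every $k\ge\frac{C_2}{\theta}\kappa\log(1/\varepsilon)$ one has $\|X^k-X_\star\|_F\le\varepsilon\sigma_r(M_\star)$.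 -/

import Mathlib

open MeasureTheory ProbabilityTheory
open scoped Matrix ComplexConjugate Matrix.Norms.Frobenius

namespace BlindSR

noncomputable section

/-- `A = U diag(σ) Vᴴ` is a (thin) singular value decomposition with `p` singular triples:
orthonormal columns, nonincreasing nonnegative singular values. -/
structure IsSVD {m n : Type*} [Fintype m] [Fintype n] {p : ℕ} (A : Matrix m n ℂ)
    (U : Matrix m (Fin p) ℂ) (σ : Fin p → ℝ) (V : Matrix n (Fin p) ℂ) : Prop where
  left_orthonormal : Uᴴ * U = 1
  right_orthonormal : Vᴴ * V = 1
  antitone : Antitone σ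
  nonneg : ∀ i, 0 ≤ σ i
  eq : A = U * Matrix.diagonal (fun i => (σ i : ℂ)) * Vᴴ

/-- `U₀ diag(σ₀) V₀ᴴ` is a top-`r` SVD of `A`: the leading `r` singular triples of
an SVD of `A`. -/
def IsTopSVD {m n : Type*} [Fintype m] [Fintype n] {r : ℕ} (A : Matrix m n ℂ)
    (U₀ : Matrix m (Fin r) ℂ) (σ₀ : Fin r → ℝ) (V₀ : Matrix n (Fin r) ℂ) : Prop :=
  ∃ (p : ℕ) (hp : r ≤ p) (U : Matrix m (Fin p) ℂ) (σ : Fin p → ℝ) (V : Matrix n (Fin p) ℂ),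
    IsSVD A U σ V ∧ U₀ = U.submatrix id (Fin.castLE hp) ∧ σ₀ = σ ∘ Fin.castLE hp ∧
      V₀ = V.submatrix id (Fin.castLE hp)

section Operators

variable {s n n₁ n₂ : ℕ}

/-- The vectorized Hankel lift: the block in position `(a, c)` is the column `a + c` of `X`.
Rows of the lifted matrix are indexed by (block, position inside the block). -/
def hankel (hn : n₁ + n₂ = n + 1) (X : Matrix (Fin s) (Fin n) ℂ) :
    Matrix (Fin n₁ × Fin s) (Fin n₂) ℂ :=
  Matrix.of fun p c => X p.2 ⟨p.1 + c, by omega⟩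

/-- The adjoint of `hankel` for the Frobenius inner products: sums along block antidiagonals. -/
def hankelAdj (M : Matrix (Fin n₁ × Fin s) (Fin n₂) ℂ) : Matrix (Fin s) (Fin n) ℂ :=
  Matrix.of fun l j =>
    ∑ q : Fin n₁ × Fin n₂ with (q.1 : ℕ) + (q.2 : ℕ) = (j : ℕ), M (q.1, l) q.2

/-- `w_j`, the length of the `j`-th antidiagonal of an `n₁ × n₂` array. -/
def weight (n₁ n₂ j : ℕ) : ℕ :=
  (Finset.univ.filter fun q : Fin n₁ × Fin n₂ => (q.1 : ℕ) + (q.2 : ℕ) = j).card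

/-- `𝒟`: multiplies the `j`-th column by `√w_j`. -/
def scale (n₁ n₂ : ℕ) (X : Matrix (Fin s) (Fin n) ℂ) : Matrix (Fin s) (Fin n) ℂ :=
  Matrix.of fun l j => (Real.sqrt (weight n₁ n₂ j) : ℂ) * X l j

/-- `𝒟⁻¹` (when `n₁ + n₂ = n + 1`, all the weights `w_j`, `j < n`, are positive). -/
def scaleInv (n₁ n₂ : ℕ) (X : Matrix (Fin s) (Fin n) ℂ) : Matrix (Fin s) (Fin n) ℂ :=
  Matrix.of fun l j => (Real.sqrt (weight n₁ n₂ j) : ℂ)⁻¹ * X l j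

/-- `𝒢 = ℋ 𝒟⁻¹`. -/
def opG (hn : n₁ + n₂ = n + 1) (X : Matrix (Fin s) (Fin n) ℂ) :
    Matrix (Fin n₁ × Fin s) (Fin n₂) ℂ :=
  hankel hn (scaleInv n₁ n₂ X)

/-- `𝒢* = 𝒟⁻¹ ℋ*`. -/
def opGAdj (M : Matrix (Fin n₁ × Fin s) (Fin n₂) ℂ) : Matrix (Fin s) (Fin n) ℂ :=
  scaleInv n₁ n₂ (hankelAdj M)

/-- The measurement operator `𝒜(X)_j = ⟨b_j e_jᵀ, X⟩ = b_jᴴ X e_j`. -/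
def opA (b : Fin n → Fin s → ℂ) (X : Matrix (Fin s) (Fin n) ℂ) : Fin n → ℂ :=
  fun j => ∑ l, conj (b j l) * X l j

/-- `𝒜*(y) = ∑_j y_j b_j e_jᵀ`. -/
def opAAdj (b : Fin n → Fin s → ℂ) (y : Fin n → ℂ) : Matrix (Fin s) (Fin n) ℂ :=
  Matrix.of fun l j => y j * b j l

/-- The weighted measurements `D y = 𝒜 𝒟 (X⋆)`. -/
def measurements (n₁ n₂ : ℕ) (b : Fin n → Fin s → ℂ) (X : Matrix (Fin s) (Fin n) ℂ) :
    Fin n → ℂ :=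
  opA b (scale n₁ n₂ X)

variable {r : ℕ}

/-- `𝒢𝒜*(𝒜𝒢*(M) - y) + (ℐ - 𝒢𝒢*)(M)`, the gradient in `M` of
`½‖y - 𝒜𝒢*(M)‖² + ½‖(ℐ - 𝒢𝒢*)(M)‖_F²`. -/
def residual (hn : n₁ + n₂ = n + 1) (b : Fin n → Fin s → ℂ) (y : Fin n → ℂ)
    (M : Matrix (Fin n₁ × Fin s) (Fin n₂) ℂ) : Matrix (Fin n₁ × Fin s) (Fin n₂) ℂ :=
  opG hn (opAAdj b (opA b (opGAdj M) - y)) + (M - opG hn (opGAdj M))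

/-- The gradient with respect to `L` of the objective
`f(L, R) = ½‖y - 𝒜𝒢*(L Rᴴ)‖² + ½‖(ℐ - 𝒢𝒢*)(L Rᴴ)‖_F²`. -/
def gradL (hn : n₁ + n₂ = n + 1) (b : Fin n → Fin s → ℂ) (y : Fin n → ℂ)
    (L : Matrix (Fin n₁ × Fin s) (Fin r) ℂ) (R : Matrix (Fin n₂) (Fin r) ℂ) :
    Matrix (Fin n₁ × Fin s) (Fin r) ℂ :=
  residual hn b y (L * Rᴴ) * R

/-- The gradient of the same objective with respect to `R`. -/
def gradR (hn : n₁ + n₂ = n + 1) (b : Fin n → Fin s → ℂ) (y : Fin n → ℂ)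
    (L : Matrix (Fin n₁ × Fin s) (Fin r) ℂ) (R : Matrix (Fin n₂) (Fin r) ℂ) :
    Matrix (Fin n₂) (Fin r) ℂ :=
  (residual hn b y (L * Rᴴ))ᴴ * L

/-- The iterates `(Lᵏ, Rᵏ)` of vanilla gradient descent with step size `η`, started at
`L⁰ = U₀ Σ₀^{1/2}`, `R⁰ = V₀ Σ₀^{1/2}`. -/
def vgdIterates (hn : n₁ + n₂ = n + 1) (b : Fin n → Fin s → ℂ) (y : Fin n → ℂ) (η : ℝ)
    (U₀ : Matrix (Fin n₁ × Fin s) (Fin r) ℂ) (σ₀ : Fin r → ℝ) (V₀ : Matrix (Fin n₂) (Fin r) ℂ) :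
    ℕ → Matrix (Fin n₁ × Fin s) (Fin r) ℂ × Matrix (Fin n₂) (Fin r) ℂ
  | 0 => (U₀ * Matrix.diagonal (fun i => (Real.sqrt (σ₀ i) : ℂ)),
      V₀ * Matrix.diagonal (fun i => (Real.sqrt (σ₀ i) : ℂ)))
  | k + 1 =>
      let F := vgdIterates hn b y η U₀ σ₀ V₀ k
      (F.1 - (η : ℂ) • gradL hn b y F.1 F.2, F.2 - (η : ℂ) • gradR hn b y F.1 F.2)

/-- The estimate `Xᵏ = 𝒟⁻¹ 𝒢*(Lᵏ (Rᵏ)ᴴ)`. -/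
def vgdEstimate (hn : n₁ + n₂ = n + 1) (b : Fin n → Fin s → ℂ) (y : Fin n → ℂ) (η : ℝ)
    (U₀ : Matrix (Fin n₁ × Fin s) (Fin r) ℂ) (σ₀ : Fin r → ℝ) (V₀ : Matrix (Fin n₂) (Fin r) ℂ)
    (k : ℕ) : Matrix (Fin s) (Fin n) ℂ :=
  let F := vgdIterates hn b y η U₀ σ₀ V₀ k
  scaleInv n₁ n₂ (opGAdj (F.1 * F.2ᴴ))

/-- `μ₁`-incoherence of the singular factors `U`, `V` of the lifted matrix: every `s × r` block
of `U` and every row of `V` has squared norm at most `μ₁ r / n`. -/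
def Incoherent (n : ℕ) (μ₁ : ℝ) (U : Matrix (Fin n₁ × Fin s) (Fin r) ℂ)
    (V : Matrix (Fin n₂) (Fin r) ℂ) : Prop :=
  (∀ a : Fin n₁, ∑ l, ∑ k, ‖U (a, l) k‖ ^ 2 ≤ μ₁ * r / n) ∧
    ∀ c : Fin n₂, ∑ k, ‖V c k‖ ^ 2 ≤ μ₁ * r / n

end Operators

/-- The random subspace vectors: `b_0, …, b_{n-1}` are i.i.d., isotropic (`𝔼[b bᴴ] = I`), and
their entries satisfy `|b[l]|² ≤ μ₀` almost surely. -/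
structure IsSubspaceEnsemble {Ω : Type*} [MeasurableSpace Ω] (P : Measure Ω) {s n : ℕ}
    (b : Fin n → Ω → Fin s → ℂ) (μ₀ : ℝ) : Prop where
  measurable : ∀ i, Measurable (b i)
  indep : iIndepFun b P
  identDistrib : ∀ i j, IdentDistrib (b i) (b j) P P
  isotropic : ∀ i (l l' : Fin s),
    ∫ ω, b i ω l * conj (b i ω l') ∂P = (1 : Matrix (Fin s) (Fin s) ℂ) l l'
  bounded : ∀ i l, ∀ᵐ ω ∂P, ‖b i ω l‖ ^ 2 ≤ μ₀

end

end BlindSR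

/-! ### The Lie product formula. -/

namespace BlindSR
open NormedSpace Filter Topology


/-! Write `M` for the lift of the ground truth. Since `𝒢` is an isometry and `M` lies in its range,
the matrix gradient is `Q(L Rᴴ - M)`, where `Q = 𝒢𝒜*𝒜𝒢* + (ℐ - 𝒢𝒢*)` is positive semidefinite
(`residual_eq_sensing`). Almost surely its norm is at most `s μ₀ = h²`. All randomness of the
iteration sits in `Q` and in the starting point, so the proof splits into deterministic geometry and
two concentration events.

Geometry. Suppose `Q` is isometric up to `1/10` on the one tangent space `{U Bᴴ + C Vᴴ}` at `M`. The
error `N = L Rᴴ - M` is not tangent, but its normal component is `(1 - UUᴴ)L ((1 - VVᴴ)R)ᴴ`, a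
product of two factors of size `‖N‖/√σᵣ`. It is quadratic in `N` and stays negligible even after the
loss `h`, provided `h‖N‖` is small against `σᵣ` (`IsNearFactorization.norm_normalPart_le`). Near `M`
the seminorm `energy Q` is therefore comparable to the Frobenius norm. Incoherence enters the
geometry only through this fixed tangent space, so the iterates need not be projected onto
incoherent factors.

The squared energy of the error decreases by at least `η g²` per step, `g` being the gradient norm
(`energy_step_le`), and `g ≥ 0.2 √σᵣ · energy` (`energy_le_gradNorm`). This gives the linear rate.
The same two facts bound the length of each step by a multiple of the drop of the energy
(`step_size_mul_gradNorm_le`). The path length telescopes, the factors never move by more than a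
small multiple of `√σᵣ`, and their conditioning at the start survives forever; hence no balancing
penalty is needed (`gradientDescent_converges`).

Concentration. Incoherence makes every column of `𝒢*` of a tangent matrix small, so a matrix
Bernstein bound for `∑ Wⱼᴴ(bⱼbⱼᴴ - I)Wⱼ` gives the tangent isometry
(`exists_bad_event_tangentIsometry`). The spectral matrix minus `M` is the Hankel lift of the
columns `(bⱼbⱼᴴ - I)xⱼ`, whose operator norm is bounded by Bernstein on its Hermitian dilation
(`exists_bad_event_hankel`). Weyl bounds and a rank argument turn this into a well conditioned start
close to `M` (`spectral_initialization`).

The Bernstein inequality rests on Golden–Thompson. Peeling off independent summands naively would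
produce the sum of the norms of the variances. Subtracting a compensator `V` from each summand, with
`𝔼 exp(Z - V) ≤ 1`, and restoring all compensators at the end inside one exponential gives the norm
of the sum instead. -/

theorem norm_exp_le_exp_norm {A : Type*} [NormedRing A] [NormOneClass A] [NormedAlgebra ℝ A] (x : A) : ‖exp x‖ ≤ Real.exp ‖x‖ := by
  let _ : NormedAlgebra ℚ A := NormedAlgebra.restrictScalars ℚ ℝ A
  rw [Real.exp_eq_exp_ℝ, exp_eq_tsum (𝕂 := ℝ) (𝔸 := A), exp_eq_tsum (𝕂 := ℝ) (𝔸 := ℝ)]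
  refine (norm_tsum_le_tsum_norm (norm_expSeries_summable' (𝕂 := ℝ) x)).trans ?_
  refine Summable.tsum_le_tsum (fun n => ?_) (norm_expSeries_summable' (𝕂 := ℝ) x)
    (expSeries_summable' (𝕂 := ℝ) ‖x‖)
  rw [norm_smul, smul_eq_mul, Real.norm_of_nonneg (by positivity)]
  gcongr
  exact norm_pow_le x n

theorem norm_pow_sub_pow_le {A : Type*} [NormedRing A] [NormOneClass A] (x y : A) {c : ℝ} (hx : ‖x‖ ≤ c) (hy : ‖y‖ ≤ c) (n : ℕ) :
    ‖x ^ n - y ^ n‖ ≤ n * c ^ (n - 1) * ‖x - y‖ := by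
  have hc : 0 ≤ c := (norm_nonneg _).trans hx
  induction n with
  | zero => simp
  | succ n ih =>
    have : x ^ (n + 1) - y ^ (n + 1) = x ^ n * (x - y) + (x ^ n - y ^ n) * y := by
      simp only [pow_succ]; noncomm_ring
    rw [this]
    refine (norm_add_le _ _).trans ?_
    have h1 : ‖x ^ n * (x - y)‖ ≤ c ^ n * ‖x - y‖ :=
      (norm_mul_le _ _).trans (by gcongr; exact (norm_pow_le x n).trans (by gcongr))
    have h2 : ‖(x ^ n - y ^ n) * y‖ ≤ n * c ^ (n - 1) * ‖x - y‖ * c :=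
      (norm_mul_le _ _).trans (by gcongr)
    have h3 : n * c ^ (n - 1) * ‖x - y‖ * c = n * c ^ n * ‖x - y‖ := by
      rcases n with _ | n
      · simp
      · simp only [Nat.add_sub_cancel, pow_succ]; ring
    rw [h3] at h2
    rw [Nat.add_sub_cancel, Nat.cast_add, Nat.cast_one]
    linarith

/-- The Lie product formula. -/
theorem tendsto_exp_mul_exp_pow {A : Type*} [NormedRing A] [NormOneClass A] [NormedAlgebra ℝ A]
    [CompleteSpace A] (a b : A) :
    Tendsto (fun n : ℕ => (exp ((n : ℝ)⁻¹ • a) * exp ((n : ℝ)⁻¹ • b)) ^ n) atTop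
      (𝓝 (exp (a + b))) := by
  let _ : NormedAlgebra ℚ A := NormedAlgebra.restrictScalars ℚ ℝ A
  -- The two curves agree to first order at `0`, so at time `1/n` they differ by `o(1/n)`. Passing
  -- to `n`-th powers costs only a factor `n` times a constant.
  have hd : HasDerivAt (fun t : ℝ => exp (t • a) * exp (t • b) - exp (t • (a + b))) 0 0 := by
    have h := ((hasDerivAt_exp_smul_const (𝕂 := ℝ) a 0).mul
      (hasDerivAt_exp_smul_const (𝕂 := ℝ) b 0)).sub (hasDerivAt_exp_smul_const (𝕂 := ℝ) (a + b) 0)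
    refine HasDerivAt.congr_deriv h ?_
    simp
  have hlim : Tendsto (fun n : ℕ => (n : ℝ) * ‖exp ((n : ℝ)⁻¹ • a) * exp ((n : ℝ)⁻¹ • b) -
      exp ((n : ℝ)⁻¹ • (a + b))‖) atTop (𝓝 0) := by
    have h1 := hd.tendsto_slope_zero
    simp only [zero_add, zero_smul, exp_zero, mul_one, sub_self, sub_zero] at h1
    have h2 : Tendsto (fun n : ℕ => (n : ℝ)⁻¹) atTop (𝓝[≠] 0) := by
      refine tendsto_nhdsWithin_iff.2 ⟨tendsto_inv_atTop_nhds_zero_nat, ?_⟩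
      filter_upwards [eventually_gt_atTop 0] with n hn
      simp [hn.ne']
    have h3 := (h1.comp h2).norm
    simpa [Function.comp_def, norm_smul] using h3
  set M := Real.exp (‖a‖ + ‖b‖)
  rw [tendsto_iff_norm_sub_tendsto_zero]
  refine squeeze_zero' (Eventually.of_forall fun _ => norm_nonneg _) ?_
    (g := fun n : ℕ => M * ((n : ℝ) * ‖exp ((n : ℝ)⁻¹ • a) * exp ((n : ℝ)⁻¹ • b) -
      exp ((n : ℝ)⁻¹ • (a + b))‖)) (by simpa using hlim.const_mul M)
  filter_upwards [eventually_gt_atTop 0] with n hn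
  have hn' : (0 : ℝ) < n := by exact_mod_cast hn
  have e : exp (a + b) = exp ((n : ℝ)⁻¹ • (a + b)) ^ n := by
    rw [← exp_nsmul, ← Nat.cast_smul_eq_nsmul ℝ, smul_smul, mul_inv_cancel₀ hn'.ne', one_smul]
  have hc1 : ‖exp ((n : ℝ)⁻¹ • a) * exp ((n : ℝ)⁻¹ • b)‖ ≤ Real.exp ((n : ℝ)⁻¹ * (‖a‖ + ‖b‖)) := by
    refine (norm_mul_le _ _).trans ?_
    rw [mul_add, Real.exp_add]
    gcongr <;> refine (norm_exp_le_exp_norm _).trans ?_ <;> simp [norm_smul]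
  have hc2 : ‖exp ((n : ℝ)⁻¹ • (a + b))‖ ≤ Real.exp ((n : ℝ)⁻¹ * (‖a‖ + ‖b‖)) := by
    refine (norm_exp_le_exp_norm _).trans ?_
    rw [norm_smul, Real.norm_of_nonneg (by positivity)]
    gcongr
    exact norm_add_le _ _
  rw [e]
  refine (norm_pow_sub_pow_le _ _ hc1 hc2 n).trans ?_
  have : Real.exp ((n : ℝ)⁻¹ * (‖a‖ + ‖b‖)) ^ (n - 1) ≤ M := by
    rw [← Real.exp_nat_mul]
    apply Real.exp_le_exp.2
    rw [← mul_assoc]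
    have : ((n - 1 : ℕ) : ℝ) * (n : ℝ)⁻¹ ≤ 1 := by
      rw [← div_eq_mul_inv, div_le_one hn']
      exact_mod_cast Nat.sub_le n 1
    exact mul_le_of_le_one_left (by positivity) this
  calc _ ≤ n * M * ‖exp ((n : ℝ)⁻¹ • a) * exp ((n : ℝ)⁻¹ • b) -
      exp ((n : ℝ)⁻¹ • (a + b))‖ := by gcongr
    _ = _ := by ring

/-! ### Trace inequalities and the Golden–Thompson inequality. -/

section GoldenThompson
open Matrix
variable {m n : Type*} [Fintype m] [Fintype n]

theorem frobenius_norm_sq (A : Matrix m n ℂ) : ‖A‖ ^ 2 = ∑ i, ∑ j, ‖A i j‖ ^ 2 := by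
  rw [frobenius_norm_def, ← Real.sqrt_eq_rpow, Real.sq_sqrt (by positivity)]
  simp

theorem trace_conjTranspose_mul (A B : Matrix m n ℂ) :
    trace (Aᴴ * B) = ∑ i, ∑ j, conj (A i j) * B i j := by
  rw [Finset.sum_comm]
  simp [trace, mul_apply]

theorem re_trace_conjTranspose_mul_self (A : Matrix m n ℂ) : (trace (Aᴴ * A)).re = ‖A‖ ^ 2 := by
  rw [trace_conjTranspose_mul, frobenius_norm_sq]
  simp only [Complex.re_sum]
  congr! with i _ j _
  rw [← Complex.normSq_eq_conj_mul_self, Complex.ofReal_re, Complex.normSq_eq_norm_sq]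

theorem trace_conjTranspose_mul_self (A : Matrix m n ℂ) :
    trace (Aᴴ * A) = ((‖A‖ ^ 2 : ℝ) : ℂ) := by
  rw [trace_conjTranspose_mul, frobenius_norm_sq]
  push_cast
  congr! with i _ j _
  exact Complex.conj_mul' _

theorem norm_trace_conjTranspose_mul_le (A B : Matrix m n ℂ) : ‖trace (Aᴴ * B)‖ ≤ ‖A‖ * ‖B‖ := by
  rw [trace_conjTranspose_mul]
  have h : ‖∑ i, ∑ j, conj (A i j) * B i j‖ ≤ ∑ q : m × n, ‖A q.1 q.2‖ * ‖B q.1 q.2‖ := by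
    rw [← Finset.sum_product', Finset.univ_product_univ]
    exact (norm_sum_le _ _).trans (Finset.sum_le_sum fun q _ => by simp)
  refine h.trans (abs_le_of_sq_le_sq' ?_ (by positivity)).2
  rw [mul_pow, frobenius_norm_sq, frobenius_norm_sq, ← Finset.sum_product', ← Finset.sum_product',
    Finset.univ_product_univ]
  exact Finset.sum_mul_sq_le_sq_mul_sq _ _ _

variable [DecidableEq m]

theorem trace_mul_pow_comm [DecidableEq n] (A : Matrix m n ℂ) (B : Matrix n m ℂ) (k : ℕ)
    (hk : k ≠ 0) : trace ((A * B) ^ k) = trace ((B * A) ^ k) := by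
  obtain ⟨k, rfl⟩ := Nat.exists_eq_succ_of_ne_zero hk
  have h : ∀ k, (A * B) ^ k * A = A * (B * A) ^ k := by
    intro k
    induction k with
    | zero => simp
    | succ k ih =>
      rw [pow_succ, pow_succ, ← Matrix.mul_assoc A, ← ih]
      simp only [Matrix.mul_assoc]
  rw [Nat.succ_eq_add_one, pow_succ, pow_succ, ← Matrix.mul_assoc, h, Matrix.mul_assoc,
    Matrix.trace_mul_comm, Matrix.mul_assoc]

/-- The two families of inequalities are proved by a joint induction. For the first, apply the
previous level to `W²`; cyclicity turns the result into a product of `W Wᴴ` and `Wᴴ W`, the second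
family separates these, and Cauchy–Schwarz finishes because both have the same trace powers. For the
second, apply the first to `W = P Q`; cyclicity turns `P Q (P Q)ᴴ` into `P² Q²`, to which the
previous level applies. -/
theorem norm_trace_pow_two_pow_le (k : ℕ) :
    (∀ W : Matrix m m ℂ, ‖trace (W ^ 2 ^ (k + 1))‖ ≤ ‖trace ((W * Wᴴ) ^ 2 ^ k)‖) ∧
      ∀ P Q : Matrix m m ℂ, P.IsHermitian → Q.IsHermitian →
        ‖trace ((P * Q) ^ 2 ^ k)‖ ≤ ‖trace (P ^ 2 ^ k * Q ^ 2 ^ k)‖ := by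
  have hsq : ∀ (H : Matrix m m ℂ) (j : ℕ), H.IsHermitian → ‖H ^ 2 ^ j‖ ^ 2 =
      ‖trace (H ^ 2 ^ (j + 1))‖ := by
    intro H j hH
    have h : H ^ 2 ^ (j + 1) = (H ^ 2 ^ j)ᴴ * H ^ 2 ^ j := by
      rw [(hH.pow _).eq, ← pow_add, pow_succ, mul_two]
    rw [h, trace_conjTranspose_mul_self, Complex.norm_real, Real.norm_of_nonneg (by positivity)]
  induction k with
  | zero =>
    refine ⟨fun W => ?_, by simp⟩
    have h := norm_trace_conjTranspose_mul_le Wᴴ W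
    rw [conjTranspose_conjTranspose, frobenius_norm_conjTranspose] at h
    have h2 : ‖trace (W * Wᴴ)‖ = ‖W‖ * ‖W‖ := by
      rw [trace_mul_comm, trace_conjTranspose_mul_self, Complex.norm_real,
        Real.norm_of_nonneg (by positivity), sq]
    simpa [sq, h2] using h
  | succ k ih =>
    obtain ⟨ih1, ih2⟩ := ih
    refine ⟨fun W => ?_, fun P Q hP hQ => ?_⟩
    · have e1 : W ^ 2 ^ (k + 1 + 1) = (W ^ 2) ^ 2 ^ (k + 1) := by rw [← pow_mul, pow_succ' 2 (k + 1)]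
      have hA : (W * Wᴴ).IsHermitian := isHermitian_mul_conjTranspose_self W
      have hB : (Wᴴ * W).IsHermitian := isHermitian_conjTranspose_mul_self W
      have e2 : trace ((W ^ 2 * (W ^ 2)ᴴ) ^ 2 ^ k) = trace (((W * Wᴴ) * (Wᴴ * W)) ^ 2 ^ k) := by
        have : W ^ 2 * (W ^ 2)ᴴ = W * (W * Wᴴ * Wᴴ) := by
          simp only [sq, conjTranspose_mul, Matrix.mul_assoc]
        rw [this, trace_mul_pow_comm _ _ _ (by positivity)]
        simp only [Matrix.mul_assoc]
      rw [e1]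
      refine (ih1 _).trans ?_
      rw [e2]
      refine (ih2 _ _ hA hB).trans ?_
      have h := norm_trace_conjTranspose_mul_le ((W * Wᴴ) ^ 2 ^ k) ((Wᴴ * W) ^ 2 ^ k)
      rw [(hA.pow _).eq] at h
      refine h.trans (le_of_eq ?_)
      have e3 : ‖(Wᴴ * W) ^ 2 ^ k‖ = ‖(W * Wᴴ) ^ 2 ^ k‖ := by
        rw [← sq_eq_sq₀ (norm_nonneg _) (norm_nonneg _), hsq _ _ hA, hsq _ _ hB,
          trace_mul_pow_comm _ _ _ (by positivity)]
      rw [e3, ← sq, hsq _ _ hA]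
    · refine (ih1 _).trans ?_
      have e : trace ((P * Q * (P * Q)ᴴ) ^ 2 ^ k) = trace ((P ^ 2 * Q ^ 2) ^ 2 ^ k) := by
        have : P * Q * (P * Q)ᴴ = P * (Q ^ 2 * P) := by
          simp only [sq, conjTranspose_mul, hP.eq, hQ.eq, Matrix.mul_assoc]
        rw [this, trace_mul_pow_comm _ _ _ (by positivity), Matrix.mul_assoc, ← sq P,
          trace_mul_pow_comm _ _ _ (by positivity)]
      rw [e]
      refine (ih2 _ _ (hP.pow 2) (hQ.pow 2)).trans (le_of_eq ?_)
      rw [← pow_mul, ← pow_mul, ← pow_succ']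

theorem tendsto_matrix_exp_mul_exp_pow (A B : Matrix m m ℂ) :
    Tendsto (fun n : ℕ => (exp ((n : ℝ)⁻¹ • A) * exp ((n : ℝ)⁻¹ • B)) ^ n) atTop
      (𝓝 (exp (A + B))) := by
  rcases isEmpty_or_nonempty m with h | h
  · exact tendsto_const_nhds.congr fun n => Subsingleton.elim _ _
  -- The Lie formula is applied in a norm with `‖1‖ = 1`, which the Frobenius norm does not satisfy
  -- in general. The row-sum operator norm does when the index type is nonempty, and the limit
  -- depends only on the topology.
  · let _ : NormedRing (Matrix m m ℂ) := Matrix.linftyOpNormedRing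
    let _ : NormedAlgebra ℝ (Matrix m m ℂ) := Matrix.linftyOpNormedAlgebra
    have : NormOneClass (Matrix m m ℂ) := Matrix.linfty_opNormOneClass
    exact @tendsto_exp_mul_exp_pow _ _ _ _ (inferInstanceAs (CompleteSpace (m → m → ℂ))) A B

/-- Exhibits the trace as real and nonnegative, so that an inequality between moduli of traces
becomes one between real parts. -/
theorem trace_exp_mul_exp {A B : Matrix m m ℂ} (hA : A.IsHermitian) (hB : B.IsHermitian) :
    trace (exp A * exp B) = ((‖exp ((2 : ℝ)⁻¹ • A) * exp ((2 : ℝ)⁻¹ • B)‖ ^ 2 : ℝ) : ℂ) := by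
  have half : ∀ C : Matrix m m ℂ, exp C = exp ((2 : ℝ)⁻¹ • C) * exp ((2 : ℝ)⁻¹ • C) := by
    intro C
    rw [← Matrix.exp_add_of_commute _ _ (Commute.refl _), ← add_smul]
    norm_num
  have hA' : (exp ((2 : ℝ)⁻¹ • A)).IsHermitian := (hA.smul (IsSelfAdjoint.all _)).exp
  have hB' : (exp ((2 : ℝ)⁻¹ • B)).IsHermitian := (hB.smul (IsSelfAdjoint.all _)).exp
  rw [← trace_conjTranspose_mul_self, conjTranspose_mul, hA'.eq, hB'.eq]
  conv_lhs => rw [half A, half B]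
  rw [← Matrix.mul_assoc, trace_mul_comm]
  simp only [Matrix.mul_assoc]

/-- The Golden–Thompson inequality. -/
theorem golden_thompson {A B : Matrix m m ℂ} (hA : A.IsHermitian) (hB : B.IsHermitian) :
    (trace (exp (A + B))).re ≤ (trace (exp A * exp B)).re := by
  -- The Lie formula is used only along `n = 2^k`, where the dyadic trace inequality applied to
  -- `exp(A/2^k)` and `exp(B/2^k)` bounds every term by the same quantity.
  have h1 := ((tendsto_matrix_exp_mul_exp_pow A B).comp
    (tendsto_pow_atTop_atTop_of_one_lt (r := 2) one_lt_two))
  have h2 : ‖trace (exp (A + B))‖ ≤ ‖trace (exp A * exp B)‖ := by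
    have hc : Continuous fun M : Matrix m m ℂ => ‖trace M‖ := by fun_prop
    refine le_of_tendsto ((hc.tendsto _).comp h1) (Eventually.of_forall fun k => ?_)
    have hs : ∀ C : Matrix m m ℂ, exp (((2 ^ k : ℕ) : ℝ)⁻¹ • C) ^ 2 ^ k = exp C := by
      intro C
      rw [← Matrix.exp_nsmul, ← Nat.cast_smul_eq_nsmul ℝ, smul_smul, mul_inv_cancel₀ (by positivity),
        one_smul]
    have h := (norm_trace_pow_two_pow_le k).2 (exp (((2 ^ k : ℕ) : ℝ)⁻¹ • A))
      (exp (((2 ^ k : ℕ) : ℝ)⁻¹ • B)) (hA.smul (IsSelfAdjoint.all _)).exp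
      (hB.smul (IsSelfAdjoint.all _)).exp
    rw [hs, hs] at h
    exact h
  refine (Complex.re_le_norm _).trans (h2.trans (le_of_eq ?_))
  rw [trace_exp_mul_exp hA hB, Complex.norm_real, Real.norm_of_nonneg (by positivity),
    Complex.ofReal_re]
end GoldenThompson

end BlindSR

/-! ### Loewner order through quadratic forms, and spectral calculus for the exponential. -/

namespace BlindSR
open NormedSpace Filter Topology
open Matrix
open scoped ComplexOrder
section SpectralExp
variable {m : Type*} [Fintype m] [DecidableEq m]

/-- The real part of the quadratic form of a matrix. -/
noncomputable def quadForm {m : Type*} [Fintype m] (A : Matrix m m ℂ) (v : m → ℂ) : ℝ :=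
  (star v ⬝ᵥ A *ᵥ v).re

/-- The squared Euclidean norm of a vector. -/
noncomputable def sqNorm {m : Type*} [Fintype m] (v : m → ℂ) : ℝ := ∑ i, ‖v i‖ ^ 2

theorem sqNorm_nonneg {m : Type*} [Fintype m] (v : m → ℂ) : 0 ≤ sqNorm v := by
  unfold sqNorm; positivity

theorem star_dotProduct_self {m : Type*} [Fintype m] (v : m → ℂ) :
    star v ⬝ᵥ v = (sqNorm v : ℂ) := by
  simp [dotProduct, sqNorm, Complex.conj_mul']

theorem quadForm_smul {m : Type*} [Fintype m] (c : ℝ) (A : Matrix m m ℂ) (v : m → ℂ) :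
    quadForm (c • A) v = c * quadForm A v := by
  simp [quadForm, smul_mulVec, dotProduct_smul]

theorem quadForm_neg {m : Type*} [Fintype m] (A : Matrix m m ℂ) (v : m → ℂ) :
    quadForm (-A) v = -quadForm A v := by
  simp [quadForm, neg_mulVec, dotProduct_neg]

theorem quadForm_sub {m : Type*} [Fintype m] (A B : Matrix m m ℂ) (v : m → ℂ) :
    quadForm (A - B) v = quadForm A v - quadForm B v := by
  simp [quadForm, sub_mulVec, dotProduct_sub]

theorem quadForm_sum {m ι : Type*} [Fintype m] (S : Finset ι) (A : ι → Matrix m m ℂ) (v : m → ℂ) :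
    quadForm (∑ i ∈ S, A i) v = ∑ i ∈ S, quadForm (A i) v := by
  simp [quadForm, sum_mulVec, dotProduct_sum]

theorem quadForm_one (v : m → ℂ) : quadForm (1 : Matrix m m ℂ) v = sqNorm v := by
  simp [quadForm, star_dotProduct_self]

theorem quadForm_conjTranspose_mul {m n : Type*} [Fintype m] [Fintype n] (A : Matrix n m ℂ)
    (v : m → ℂ) : quadForm (Aᴴ * A) v = sqNorm (A *ᵥ v) := by
  rw [quadForm, ← mulVec_mulVec, dotProduct_mulVec, vecMul_conjTranspose, star_star,
    star_dotProduct_self, Complex.ofReal_re]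

theorem posSemidef_iff_quadForm {m : Type*} [Fintype m] {A : Matrix m m ℂ} (hA : A.IsHermitian) :
    A.PosSemidef ↔ ∀ v, 0 ≤ quadForm A v := by
  rw [posSemidef_iff_dotProduct_mulVec]
  refine ⟨fun h v => (Complex.nonneg_iff.1 (h.2 v)).1, fun h => ⟨hA, fun v => ?_⟩⟩
  refine Complex.nonneg_iff.2 ⟨h v, ?_⟩
  exact (hA.im_star_dotProduct_mulVec_self v).symm

/-- One unitary diagonalises both `A` and its exponential, so the operator inequalities below reduce
to scalar inequalities between eigenvalues. -/
theorem exists_eigendecomposition {A : Matrix m m ℂ} (hA : A.IsHermitian) :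
    ∃ (U : Matrix m m ℂ) (l : m → ℝ), Uᴴ * U = 1 ∧ U * Uᴴ = 1 ∧
      A = U * diagonal (fun i => (l i : ℂ)) * Uᴴ ∧
      exp A = U * diagonal (fun i => (Real.exp (l i) : ℂ)) * Uᴴ := by
  refine ⟨hA.eigenvectorUnitary, hA.eigenvalues, Unitary.coe_star_mul_self _,
    Unitary.coe_mul_star_self _, ?_, ?_⟩
  · conv_lhs => rw [hA.spectral_theorem, Unitary.conjStarAlgAut_apply]
    rfl
  · have h := Matrix.exp_units_conj (Unitary.toUnits hA.eigenvectorUnitary)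
      (diagonal (RCLike.ofReal ∘ hA.eigenvalues : m → ℂ))
    rw [Matrix.exp_diagonal] at h
    conv_lhs => rw [hA.spectral_theorem, Unitary.conjStarAlgAut_apply]
    refine Eq.trans h ?_
    have e : NormedSpace.exp (RCLike.ofReal ∘ hA.eigenvalues : m → ℂ) =
        fun i => (Real.exp (hA.eigenvalues i) : ℂ) := by
      funext i
      rw [Pi.exp_def]
      simp [← Complex.exp_eq_exp_ℂ]
    rw [e]
    rfl

theorem posSemidef_conj_diagonal {U : Matrix m m ℂ} {l : m → ℝ} (h : ∀ i, 0 ≤ l i) :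
    (U * diagonal (fun i => (l i : ℂ)) * Uᴴ).PosSemidef :=
  (PosSemidef.diagonal (fun i => by simpa using h i)).mul_mul_conjTranspose_same U

theorem eigenvalue_nonneg_of_posSemidef {U : Matrix m m ℂ} (hU : Uᴴ * U = 1) {l : m → ℝ}
    (h : (U * diagonal (fun i => (l i : ℂ)) * Uᴴ).PosSemidef) (i : m) : 0 ≤ l i := by
  have h1 := h.conjTranspose_mul_mul_same U
  have e : Uᴴ * (U * diagonal (fun i => (l i : ℂ)) * Uᴴ) * U = diagonal (fun i => (l i : ℂ)) := by
    simp only [← Matrix.mul_assoc, hU, Matrix.one_mul]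
    rw [Matrix.mul_assoc, hU, Matrix.mul_one]
  rw [e, posSemidef_diagonal_iff] at h1
  simpa using h1 i

theorem posSemidef_exp {A : Matrix m m ℂ} (hA : A.IsHermitian) : (exp A).PosSemidef := by
  obtain ⟨U, l, -, -, -, h⟩ := exists_eigendecomposition hA
  rw [h]
  exact posSemidef_conj_diagonal fun i => (Real.exp_pos _).le

theorem smul_one_sub_conj_diagonal {U : Matrix m m ℂ} (hU : U * Uᴴ = 1) (l : m → ℝ) (c : ℝ) :
    (c • 1 - U * diagonal (fun i => (l i : ℂ)) * Uᴴ : Matrix m m ℂ) =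
      U * diagonal (fun i => ((c - l i : ℝ) : ℂ)) * Uᴴ := by
  have e : (diagonal (fun i => ((c - l i : ℝ) : ℂ)) : Matrix m m ℂ) =
      c • 1 - diagonal (fun i => (l i : ℂ)) := by
    ext i j
    by_cases h : i = j <;> simp [h, diagonal]
  rw [e, Matrix.mul_sub, Matrix.sub_mul, Matrix.mul_smul, Matrix.smul_mul, Matrix.mul_one, hU]

theorem eigenvalue_le_of_quadForm_le {U : Matrix m m ℂ} (hU : Uᴴ * U = 1) (hU' : U * Uᴴ = 1)
    {l : m → ℝ} {c : ℝ}
    (h : ∀ v, quadForm (U * diagonal (fun i => (l i : ℂ)) * Uᴴ) v ≤ c * sqNorm v) (i : m) :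
    l i ≤ c := by
  have hps : (c • 1 - U * diagonal (fun i => (l i : ℂ)) * Uᴴ : Matrix m m ℂ).PosSemidef := by
    rw [posSemidef_iff_quadForm]
    · intro v
      rw [quadForm_sub, quadForm_smul, quadForm_one]
      linarith [h v]
    · rw [smul_one_sub_conj_diagonal hU']
      refine isHermitian_mul_mul_conjTranspose U (isHermitian_diagonal_of_self_adjoint _ ?_)
      funext i
      simp [Complex.conj_ofReal]
  rw [smul_one_sub_conj_diagonal hU'] at hps
  linarith [eigenvalue_nonneg_of_posSemidef hU hps i]

/-- The scalar inequality `exp x ≤ 1 + x + x²` on `[-1, 1]`, read on the eigenvalues of `Y`. -/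
theorem posSemidef_one_add_add_sq_sub_exp {Y : Matrix m m ℂ} (hY : Y.IsHermitian)
    (h : ∀ v, |quadForm Y v| ≤ sqNorm v) : (1 + Y + Y * Y - exp Y).PosSemidef := by
  obtain ⟨U, l, hU, hU', hl, he⟩ := exists_eigendecomposition hY
  have h1 : ∀ i, l i ≤ 1 := eigenvalue_le_of_quadForm_le hU hU' fun v => by
    rw [← hl, one_mul]; exact (abs_le.1 (h v)).2
  have h2 : ∀ i, -l i ≤ 1 := eigenvalue_le_of_quadForm_le hU hU' fun v => by
    have e : U * diagonal (fun i => ((-l i : ℝ) : ℂ)) * Uᴴ = -Y := by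
      rw [hl, ← Matrix.neg_mul, ← Matrix.mul_neg, diagonal_neg]
      simp
    rw [e, quadForm_neg, one_mul]; linarith [(abs_le.1 (h v)).1]
  have e : 1 + Y + Y * Y - exp Y =
      U * diagonal (fun i => ((1 + l i + l i * l i - Real.exp (l i) : ℝ) : ℂ)) * Uᴴ := by
    have hYY : Y * Y = U * diagonal (fun i => ((l i * l i : ℝ) : ℂ)) * Uᴴ := by
      conv_lhs => rw [hl]
      rw [show U * diagonal (fun i => (l i : ℂ)) * Uᴴ * (U * diagonal (fun i => (l i : ℂ)) * Uᴴ) =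
        U * diagonal (fun i => (l i : ℂ)) * (Uᴴ * U) * diagonal (fun i => (l i : ℂ)) * Uᴴ by
          simp only [Matrix.mul_assoc], hU, Matrix.mul_one, Matrix.mul_assoc U, diagonal_mul_diagonal]
      simp
    rw [he, hYY]
    conv_lhs => rw [hl, ← hU']
    have : (diagonal (fun i => ((1 + l i + l i * l i - Real.exp (l i) : ℝ) : ℂ)) : Matrix m m ℂ) =
      1 + diagonal (fun i => (l i : ℂ)) + diagonal (fun i => ((l i * l i : ℝ) : ℂ)) -
        diagonal (fun i => (Real.exp (l i) : ℂ)) := by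
      ext i j
      by_cases h : i = j <;> simp [h, diagonal]
    rw [this]
    simp only [Matrix.mul_add, Matrix.mul_sub, Matrix.add_mul, Matrix.sub_mul, Matrix.mul_one]
  rw [e]
  refine posSemidef_conj_diagonal fun i => ?_
  have := (abs_le.1 (Real.abs_exp_sub_one_sub_id_le (abs_le.2 ⟨by linarith [h2 i], h1 i⟩))).2
  nlinarith

theorem posSemidef_half_smul_sub_sq {V : Matrix m m ℂ} (hV : V.PosSemidef)
    (h : ∀ v, quadForm V v ≤ 1 / 2 * sqNorm v) : ((1 / 2 : ℝ) • V - V * V).PosSemidef := by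
  obtain ⟨U, l, hU, hU', hl, -⟩ := exists_eigendecomposition hV.isHermitian
  have h1 : ∀ i, l i ≤ 1 / 2 := eigenvalue_le_of_quadForm_le hU hU' fun v => by
    rw [← hl]; exact h v
  have h2 : ∀ i, 0 ≤ l i := eigenvalue_nonneg_of_posSemidef hU (hl ▸ hV)
  have e : (1 / 2 : ℝ) • V - V * V =
      U * diagonal (fun i => ((1 / 2 * l i - l i * l i : ℝ) : ℂ)) * Uᴴ := by
    have hYY : V * V = U * diagonal (fun i => ((l i * l i : ℝ) : ℂ)) * Uᴴ := by
      conv_lhs => rw [hl]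
      rw [show U * diagonal (fun i => (l i : ℂ)) * Uᴴ * (U * diagonal (fun i => (l i : ℂ)) * Uᴴ) =
        U * diagonal (fun i => (l i : ℂ)) * (Uᴴ * U) * diagonal (fun i => (l i : ℂ)) * Uᴴ by
          simp only [Matrix.mul_assoc], hU, Matrix.mul_one, Matrix.mul_assoc U, diagonal_mul_diagonal]
      simp
    rw [hYY]
    conv_lhs => rw [hl]
    have : (diagonal (fun i => ((1 / 2 * l i - l i * l i : ℝ) : ℂ)) : Matrix m m ℂ) =
      (1 / 2 : ℝ) • diagonal (fun i => (l i : ℂ)) - diagonal (fun i => ((l i * l i : ℝ) : ℂ)) := by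
      ext i j
      by_cases h : i = j <;> simp [h, diagonal]
    rw [this]
    simp only [Matrix.mul_sub, Matrix.sub_mul, Matrix.mul_smul, Matrix.smul_mul]
  rw [e]
  refine posSemidef_conj_diagonal fun i => ?_
  nlinarith [h1 i, h2 i]

theorem re_trace_conj_diagonal {U : Matrix m m ℂ} (hU : Uᴴ * U = 1) (l : m → ℝ) :
    (trace (U * diagonal (fun i => (l i : ℂ)) * Uᴴ)).re = ∑ i, l i := by
  rw [trace_mul_comm, ← Matrix.mul_assoc, hU, Matrix.one_mul]
  simp [trace]

theorem re_trace_mul_nonneg {A B : Matrix m m ℂ} (hA : A.PosSemidef) (hB : B.PosSemidef) :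
    0 ≤ (trace (A * B)).re := by
  obtain ⟨C, hC⟩ : ∃ C : Matrix m m ℂ, B = C * Cᴴ := by
    obtain ⟨U, l, hU, hU', hl, -⟩ := exists_eigendecomposition hB.isHermitian
    have h2 : ∀ i, 0 ≤ l i := eigenvalue_nonneg_of_posSemidef hU (hl ▸ hB)
    refine ⟨U * diagonal (fun i => (Real.sqrt (l i) : ℂ)), ?_⟩
    have e : (diagonal (fun i => (l i : ℂ)) : Matrix m m ℂ) =
        diagonal (fun i => (Real.sqrt (l i) : ℂ)) * (diagonal fun i => (Real.sqrt (l i) : ℂ))ᴴ := by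
      rw [diagonal_conjTranspose, diagonal_mul_diagonal]
      congr! with i
      simp [Complex.conj_ofReal, ← Complex.ofReal_mul, Real.mul_self_sqrt (h2 i)]
    rw [conjTranspose_mul, hl, e]
    simp only [Matrix.mul_assoc]
  rw [hC, ← Matrix.mul_assoc, trace_mul_comm, ← Matrix.mul_assoc]
  exact (Complex.nonneg_iff.1 (hA.conjTranspose_mul_mul_same C).trace_nonneg).1

theorem re_trace_exp_le {A : Matrix m m ℂ} (hA : A.IsHermitian) {c : ℝ}
    (h : ∀ v, quadForm A v ≤ c * sqNorm v) :
    (trace (exp A)).re ≤ Fintype.card m * Real.exp c := by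
  obtain ⟨U, l, hU, hU', hl, he⟩ := exists_eigendecomposition hA
  have h1 : ∀ i, l i ≤ c := eigenvalue_le_of_quadForm_le hU hU' fun v => by
    rw [← hl]; exact h v
  rw [he, re_trace_conj_diagonal hU]
  refine (Finset.sum_le_sum fun i _ => Real.exp_le_exp.2 (h1 i)).trans ?_
  simp

/-- Each `exp` of an eigenvalue is bounded by the trace, the others being positive. This is how a
bound on the trace controls the largest eigenvalue in the Laplace transform method. -/
theorem quadForm_le_of_re_trace_exp_le {A : Matrix m m ℂ} (hA : A.IsHermitian) {c : ℝ}
    (h : (trace (exp A)).re ≤ Real.exp c) (v : m → ℂ) : quadForm A v ≤ c * sqNorm v := by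
  obtain ⟨U, l, hU, hU', hl, he⟩ := exists_eigendecomposition hA
  rw [he, re_trace_conj_diagonal hU] at h
  have h1 : ∀ i, l i ≤ c := fun i => Real.exp_le_exp.1
    ((Finset.single_le_sum (f := fun i => Real.exp (l i)) (fun i _ => (Real.exp_pos _).le)
      (Finset.mem_univ i)).trans h)
  have hps : (c • 1 - A : Matrix m m ℂ).PosSemidef := by
    rw [hl, smul_one_sub_conj_diagonal hU']
    exact posSemidef_conj_diagonal fun i => by linarith [h1 i]
  have := (posSemidef_iff_quadForm hps.isHermitian).1 hps v
  rw [quadForm_sub, quadForm_smul, quadForm_one] at this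
  linarith
end SpectralExp
end BlindSR

/-! ### A matrix Bernstein inequality for functions of independent, compactly supported variables.
-/

namespace BlindSR
open NormedSpace Filter Topology
open Matrix
open scoped ComplexOrder
section MatrixBernstein
set_option linter.unusedSectionVars false
variable {m : Type*} [Fintype m] [DecidableEq m]
variable {Ω : Type*} [MeasurableSpace Ω] {P : Measure Ω} [IsProbabilityMeasure P]
variable {E : Type*} [TopologicalSpace E] [MeasurableSpace E] [OpensMeasurableSpace E]
  [SecondCountableTopology E]

/-- Variables that almost surely stay in a compact set make every continuous expression in them
bounded, so all integrability questions below are settled by continuity. -/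
theorem integrable_continuous_comp {F : Type*} [NormedAddCommGroup F] {K : Set E}
    (hK : IsCompact K) {b : Ω → E} (hb : Measurable b) (hbK : ∀ᵐ ω ∂P, b ω ∈ K) {f : E → F}
    (hf : Continuous f) : Integrable (fun ω => f (b ω)) P := by
  obtain ⟨C, hC⟩ := hK.exists_bound_of_continuousOn hf.continuousOn
  refine Integrable.of_bound (hf.stronglyMeasurable.comp_measurable hb).aestronglyMeasurable C ?_
  filter_upwards [hbK] with ω h using hC _ h

theorem matIntegrable_continuous_comp {K : Set E}
    (hK : IsCompact K) {b : Ω → E} (hb : Measurable b) (hbK : ∀ᵐ ω ∂P, b ω ∈ K)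
    {f : E → Matrix m m ℂ} (hf : Continuous f) (i j : m) :
    Integrable (fun ω => f (b ω) i j) P :=
  integrable_continuous_comp hK hb hbK (hf.matrix_elem i j)

theorem continuous_matrix_exp : Continuous (exp : Matrix m m ℂ → Matrix m m ℂ) := by
  let _ : NormedAlgebra ℚ (Matrix m m ℂ) := NormedAlgebra.restrictScalars ℚ ℝ _
  exact exp_continuous

/-- Entrywise integrability of a random matrix. -/
def MatIntegrable (f : Ω → Matrix m m ℂ) (P : Measure Ω) : Prop :=
  ∀ i j, Integrable (fun ω => f ω i j) P

/-- The entrywise expectation of a random matrix. -/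
noncomputable def matExpect (f : Ω → Matrix m m ℂ) (P : Measure Ω) : Matrix m m ℂ :=
  Matrix.of fun i j => ∫ ω, f ω i j ∂P

theorem MatIntegrable.integrable_trace {f : Ω → Matrix m m ℂ} (hf : MatIntegrable f P) :
    Integrable (fun ω => (trace (f ω)).re) P :=
  (integrable_finsetSum _ fun i _ => hf i i).re

theorem MatIntegrable.integral_trace {f : Ω → Matrix m m ℂ} (hf : MatIntegrable f P) :
    ∫ ω, (trace (f ω)).re ∂P = (trace (matExpect f P)).re := by
  have h : ∫ ω, (trace (f ω)).re ∂P = (∫ ω, trace (f ω) ∂P).re :=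
    integral_re (integrable_finsetSum _ fun i _ => hf i i)
  rw [h]
  simp only [trace, diag_apply, matExpect, of_apply]
  rw [integral_finsetSum _ fun i _ => hf i i]

theorem MatIntegrable.add {f g : Ω → Matrix m m ℂ} (hf : MatIntegrable f P)
    (hg : MatIntegrable g P) : MatIntegrable (fun ω => f ω + g ω) P :=
  fun i j => (hf i j).add (hg i j)

theorem MatIntegrable.sub {f g : Ω → Matrix m m ℂ} (hf : MatIntegrable f P)
    (hg : MatIntegrable g P) : MatIntegrable (fun ω => f ω - g ω) P :=
  fun i j => (hf i j).sub (hg i j)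

theorem matExpect_add {f g : Ω → Matrix m m ℂ} (hf : MatIntegrable f P)
    (hg : MatIntegrable g P) :
    matExpect (fun ω => f ω + g ω) P = matExpect f P + matExpect g P := by
  ext i j
  exact integral_add (hf i j) (hg i j)

theorem matExpect_sub {f g : Ω → Matrix m m ℂ} (hf : MatIntegrable f P)
    (hg : MatIntegrable g P) :
    matExpect (fun ω => f ω - g ω) P = matExpect f P - matExpect g P := by
  ext i j
  exact integral_sub (hf i j) (hg i j)

theorem matExpect_const (A : Matrix m m ℂ) : matExpect (fun _ : Ω => A) P = A := by
  ext i j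
  simp [matExpect]

theorem matExpect_smul (c : ℝ) (f : Ω → Matrix m m ℂ) :
    matExpect (fun ω => c • f ω) P = c • matExpect f P := by
  ext i j
  simp only [matExpect, of_apply, Matrix.smul_apply]
  exact integral_smul _ _

theorem matIntegrable_const (A : Matrix m m ℂ) : MatIntegrable (fun _ : Ω => A) P :=
  fun _ _ => integrable_const _

theorem MatIntegrable.mul_const {f : Ω → Matrix m m ℂ} (hf : MatIntegrable f P)
    (A : Matrix m m ℂ) : MatIntegrable (fun ω => f ω * A) P := fun i j => by
  simp only [mul_apply]
  exact integrable_finsetSum _ fun k _ => (hf i k).mul_const _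

theorem MatIntegrable.const_mul {f : Ω → Matrix m m ℂ} (hf : MatIntegrable f P)
    (A : Matrix m m ℂ) : MatIntegrable (fun ω => A * f ω) P := fun i j => by
  simp only [mul_apply]
  exact integrable_finsetSum _ fun k _ => (hf k j).const_mul _

theorem matExpect_mul_const {f : Ω → Matrix m m ℂ} (hf : MatIntegrable f P) (A : Matrix m m ℂ) :
    matExpect (fun ω => f ω * A) P = matExpect f P * A := by
  ext i j
  simp only [matExpect, of_apply, mul_apply]
  rw [integral_finsetSum _ fun k _ => (hf i k).mul_const _]
  exact Finset.sum_congr rfl fun k _ => integral_mul_const _ _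

theorem matExpect_const_mul {f : Ω → Matrix m m ℂ} (hf : MatIntegrable f P) (A : Matrix m m ℂ) :
    matExpect (fun ω => A * f ω) P = A * matExpect f P := by
  ext i j
  simp only [matExpect, of_apply, mul_apply]
  rw [integral_finsetSum _ fun k _ => (hf k j).const_mul _]
  exact Finset.sum_congr rfl fun k _ => integral_const_mul _ _

theorem quadForm_matExpect {f : Ω → Matrix m m ℂ} (hf : MatIntegrable f P) (v : m → ℂ) :
    quadForm (matExpect f P) v = ∫ ω, quadForm (f ω) v ∂P := by
  have hi : ∀ i, Integrable (fun ω => ∑ j, f ω i j * v j) P := fun i =>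
    integrable_finsetSum _ fun j _ => (hf i j).mul_const _
  have hs : Integrable (fun ω => star v ⬝ᵥ f ω *ᵥ v) P :=
    integrable_finsetSum _ fun i _ => (hi i).const_mul (star v i)
  have h : ∫ ω, quadForm (f ω) v ∂P = (∫ ω, star v ⬝ᵥ f ω *ᵥ v ∂P).re := integral_re hs
  rw [h, quadForm]
  congr 1
  simp only [dotProduct, mulVec]
  rw [integral_finsetSum _ fun i _ => (hi i).const_mul (star v i)]
  refine Finset.sum_congr rfl fun i _ => ?_
  rw [integral_const_mul, integral_finsetSum _ fun j _ => (hf i j).mul_const _]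
  simp [matExpect, integral_mul_const]

theorem isHermitian_matExpect {f : Ω → Matrix m m ℂ} (h : ∀ᵐ ω ∂P, (f ω).IsHermitian) :
    (matExpect f P).IsHermitian := by
  ext i j
  rw [conjTranspose_apply, matExpect, of_apply, of_apply, Complex.star_def, ← integral_conj]
  refine integral_congr_ae ?_
  filter_upwards [h] with ω hω
  exact hω.apply i j

theorem posSemidef_matExpect {f : Ω → Matrix m m ℂ} (hf : MatIntegrable f P)
    (h : ∀ᵐ ω ∂P, (f ω).PosSemidef) : (matExpect f P).PosSemidef := by
  rw [posSemidef_iff_quadForm (isHermitian_matExpect (h.mono fun ω hω => hω.isHermitian))]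
  intro v
  rw [quadForm_matExpect hf]
  refine integral_nonneg_of_ae ?_
  filter_upwards [h] with ω hω
  exact (posSemidef_iff_quadForm hω.isHermitian).1 hω v

theorem integral_trace_mul_of_indepFun {X Y : Ω → Matrix m m ℂ} (hX : MatIntegrable X P)
    (hY : MatIntegrable Y P) (hind : ∀ i j k l, IndepFun (fun ω => X ω i j) (fun ω => Y ω k l) P) :
    ∫ ω, (trace (X ω * Y ω)).re ∂P = (trace (matExpect X P * matExpect Y P)).re := by
  have hint : ∀ i j, Integrable (fun ω => X ω i j * Y ω j i) P := fun i j =>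
    (hind i j j i).integrable_mul (hX i j) (hY j i)
  have e : ∀ ω, trace (X ω * Y ω) = ∑ i, ∑ j, X ω i j * Y ω j i := fun ω => by
    simp [trace, mul_apply]
  have hs : Integrable (fun ω => ∑ i, ∑ j, X ω i j * Y ω j i) P :=
    integrable_finsetSum _ fun i _ => integrable_finsetSum _ fun j _ => hint i j
  have h1 : ∫ ω, (trace (X ω * Y ω)).re ∂P = (∫ ω, ∑ i, ∑ j, X ω i j * Y ω j i ∂P).re := by
    simp only [e]
    exact integral_re hs
  rw [h1]
  congr 1
  rw [integral_finsetSum _ fun i _ => integrable_finsetSum _ fun j _ => hint i j]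
  simp only [trace, diag_apply, mul_apply, matExpect, of_apply]
  refine Finset.sum_congr rfl fun i _ => ?_
  rw [integral_finsetSum _ fun j _ => hint i j]
  refine Finset.sum_congr rfl fun j _ => ?_
  exact (hind i j j i).integral_mul_eq_mul_integral (hX i j).aestronglyMeasurable
    (hY j i).aestronglyMeasurable

/-- The summands are removed one at a time. Golden–Thompson splits off the factor `exp (Ψ a)`,
independence factorises the expectation of the trace, and `𝔼 exp (Ψ a) ≤ 1` drops that factor
against a positive semidefinite one. The free matrix `D` is where the compensators are restored
later. -/
theorem integral_trace_exp_add_sum_le {ι : Type*} {b : ι → Ω → E} (hb : ∀ i, Measurable (b i))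
    (hind : iIndepFun b P) {K : Set E} (hK : IsCompact K) (hbK : ∀ i, ∀ᵐ ω ∂P, b i ω ∈ K)
    {Ψ : ι → E → Matrix m m ℂ} (hΨ : ∀ i, Continuous (Ψ i)) (hherm : ∀ i x, (Ψ i x).IsHermitian)
    (hexp : ∀ i, (1 - matExpect (fun ω => exp (Ψ i (b i ω))) P).PosSemidef) {D : Matrix m m ℂ}
    (hD : D.IsHermitian) (S : Finset ι) :
    ∫ ω, (trace (exp (D + ∑ i ∈ S, Ψ i (b i ω)))).re ∂P ≤ (trace (exp D)).re := by
  classical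
  have hmeas : ∀ S : Finset ι, Measurable fun ω => fun i : S => b i ω := fun S =>
    measurable_pi_lambda _ fun i => hb i
  have hKS : ∀ S : Finset ι, IsCompact (Set.univ.pi fun _ : S => K) := fun S =>
    isCompact_univ_pi fun _ => hK
  have hbS : ∀ S : Finset ι, ∀ᵐ ω ∂P, (fun i : S => b i ω) ∈ Set.univ.pi fun _ : S => K := by
    intro S
    have : ∀ᵐ ω ∂P, ∀ i : S, b i ω ∈ K := ae_all_iff.2 fun i => hbK i
    filter_upwards [this] with ω h i _ using h i
  have hcont : ∀ S : Finset ι, Continuous fun x : S → E => exp (D + ∑ i : S, Ψ i (x i)) := fun S =>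
    continuous_matrix_exp.comp (continuous_const.add
      (continuous_finsetSum _ fun i _ => (hΨ i).comp (continuous_apply i)))
  have hsum : ∀ (S : Finset ι) ω, ∑ i ∈ S, Ψ i (b i ω) = ∑ i : S, Ψ i (b i ω) := fun S ω =>
    (Finset.sum_coe_sort S fun i => Ψ i (b i ω)).symm
  have hint : ∀ S : Finset ι, MatIntegrable (fun ω => exp (D + ∑ i ∈ S, Ψ i (b i ω))) P := by
    intro S
    simp only [hsum]
    exact matIntegrable_continuous_comp (hKS S) (hmeas S) (hbS S) (hcont S)
  have hhermS : ∀ (S : Finset ι) ω, (D + ∑ i ∈ S, Ψ i (b i ω)).IsHermitian := fun S ω =>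
    hD.add (by
      refine Finset.sum_induction _ (fun A : Matrix m m ℂ => A.IsHermitian) (fun A B => IsHermitian.add)
        isHermitian_zero fun i _ => hherm i _)
  induction S using Finset.induction_on with
  | empty => simp
  | insert a S ha ih =>
    have hY : MatIntegrable (fun ω => exp (Ψ a (b a ω))) P :=
      matIntegrable_continuous_comp hK (hb a) (hbK a) (continuous_matrix_exp.comp (hΨ a))
    have hind' : ∀ i j k l, IndepFun (fun ω => exp (D + ∑ i ∈ S, Ψ i (b i ω)) i j)
        (fun ω => exp (Ψ a (b a ω)) k l) P := by
      intro i j k l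
      have h := hind.indepFun_finset S {a} (by simpa using ha) hb
      have h' := h.comp (φ := fun x : S → E => exp (D + ∑ i : S, Ψ i (x i)) i j)
        (ψ := fun x : ({a} : Finset ι) → E => exp (Ψ a (x ⟨a, Finset.mem_singleton_self a⟩)) k l)
        ((hcont S).matrix_elem i j).measurable
        ((continuous_matrix_exp.comp ((hΨ a).comp (continuous_apply _))).matrix_elem k l).measurable
      simp only [hsum]
      exact h'
    have hmul : MatIntegrable (fun ω => exp (D + ∑ i ∈ S, Ψ i (b i ω)) * exp (Ψ a (b a ω))) P := by
      have hc : Continuous fun x : ↥(insert a S) → E =>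
          exp (D + ∑ i : S, Ψ i (x ⟨i, Finset.mem_insert_of_mem i.2⟩)) *
            exp (Ψ a (x ⟨a, Finset.mem_insert_self a S⟩)) := by
        refine Continuous.mul ?_ ?_
        · exact continuous_matrix_exp.comp (continuous_const.add
            (continuous_finsetSum _ fun i _ => (hΨ i).comp (continuous_apply _)))
        · exact continuous_matrix_exp.comp ((hΨ a).comp (continuous_apply _))
      simp only [hsum]
      exact matIntegrable_continuous_comp (hKS _) (hmeas _) (hbS _) hc
    calc ∫ ω, (trace (exp (D + ∑ i ∈ insert a S, Ψ i (b i ω)))).re ∂P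
        ≤ ∫ ω, (trace (exp (D + ∑ i ∈ S, Ψ i (b i ω)) * exp (Ψ a (b a ω)))).re ∂P := by
          refine integral_mono (hint _).integrable_trace hmul.integrable_trace fun ω => ?_
          rw [Finset.sum_insert ha, add_comm (Ψ a _), ← add_assoc]
          exact golden_thompson (hhermS S ω) (hherm a _)
      _ = (trace (matExpect (fun ω => exp (D + ∑ i ∈ S, Ψ i (b i ω))) P *
          matExpect (fun ω => exp (Ψ a (b a ω))) P)).re :=
          integral_trace_mul_of_indepFun (hint S) hY hind'
      _ ≤ (trace (matExpect (fun ω => exp (D + ∑ i ∈ S, Ψ i (b i ω))) P)).re := by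
          have h := re_trace_mul_nonneg (posSemidef_matExpect (hint S)
            (ae_of_all _ fun ω => posSemidef_exp (hhermS S ω))) (hexp a)
          rw [Matrix.mul_sub, Matrix.mul_one, trace_sub, Complex.sub_re] at h
          linarith
      _ = ∫ ω, (trace (exp (D + ∑ i ∈ S, Ψ i (b i ω)))).re ∂P :=
          (hint S).integral_trace.symm
      _ ≤ _ := ih

/-- A centred, bounded random Hermitian matrix `Z` with `𝔼 Z² ≤ V / 2` satisfies
`𝔼 exp (Z - V) ≤ 1`. -/
theorem posSemidef_one_sub_matExpect_exp {b : Ω → E} (hb : Measurable b) {K : Set E}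
    (hK : IsCompact K) (hbK : ∀ᵐ ω ∂P, b ω ∈ K) {Z : E → Matrix m m ℂ} (hZ : Continuous Z)
    (hherm : ∀ x, (Z x).IsHermitian) (hmean : matExpect (fun ω => Z (b ω)) P = 0)
    (hbound : ∀ x ∈ K, ∀ v, |quadForm (Z x) v| ≤ 1 / 2 * sqNorm v)
    {V : Matrix m m ℂ} (hV : V.PosSemidef) (hV' : ∀ v, quadForm V v ≤ 1 / 2 * sqNorm v)
    (hvar : ∀ v, ∫ ω, sqNorm (Z (b ω) *ᵥ v) ∂P ≤ 1 / 2 * quadForm V v) :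
    (1 - matExpect (fun ω => exp (Z (b ω) - V)) P).PosSemidef := by
  have hint : ∀ f : E → Matrix m m ℂ, Continuous f → MatIntegrable (fun ω => f (b ω)) P :=
    fun f hf => matIntegrable_continuous_comp hK hb hbK hf
  have hYc : Continuous fun x => Z x - V := hZ.sub continuous_const
  have hYherm : ∀ x, (Z x - V).IsHermitian := fun x => (hherm x).sub hV.isHermitian
  have h1 : (matExpect (fun ω => 1 + (Z (b ω) - V) + (Z (b ω) - V) * (Z (b ω) - V) -
      exp (Z (b ω) - V)) P).PosSemidef := by
    refine posSemidef_matExpect (hint (fun x => 1 + (Z x - V) + (Z x - V) * (Z x - V) -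
      exp (Z x - V)) (((continuous_const.add hYc).add (hYc.mul hYc)).sub
        (continuous_matrix_exp.comp hYc))) ?_
    filter_upwards [hbK] with ω hω
    -- The form of `Z - V` lies between `-1` and `1/2` relative to the squared norm, as `|Z| ≤ 1/2`
    -- and `0 ≤ V ≤ 1/2`; this is the range where the quadratic upper bound for `exp` holds.
    refine posSemidef_one_add_add_sq_sub_exp (hYherm _) fun v => ?_
    rw [quadForm_sub]
    have h2 := abs_le.1 (hbound _ hω v)
    have h3 := (posSemidef_iff_quadForm hV.isHermitian).1 hV v
    rw [abs_le]
    constructor <;> linarith [hV' v]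
  have e : matExpect (fun ω => 1 + (Z (b ω) - V) + (Z (b ω) - V) * (Z (b ω) - V) -
      exp (Z (b ω) - V)) P = 1 - V + (matExpect (fun ω => Z (b ω) * Z (b ω)) P + V * V) -
        matExpect (fun ω => exp (Z (b ω) - V)) P := by
    have hZi := hint Z hZ
    have hYi := hint _ hYc
    have hZZ := hint (fun x => Z x * Z x) (hZ.mul hZ)
    have hYY := hint (fun x => (Z x - V) * (Z x - V)) (hYc.mul hYc)
    have hE := hint (fun x => exp (Z x - V)) (continuous_matrix_exp.comp hYc)
    rw [matExpect_sub (((matIntegrable_const 1).add hYi).add hYY) hE,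
      matExpect_add ((matIntegrable_const 1).add hYi) hYY,
      matExpect_add (matIntegrable_const 1) hYi, matExpect_const,
      matExpect_sub hZi (matIntegrable_const V), hmean, matExpect_const]
    have e2 : (fun ω => (Z (b ω) - V) * (Z (b ω) - V)) =
        fun ω => Z (b ω) * Z (b ω) - V * Z (b ω) - Z (b ω) * V + V * V := by
      funext ω; noncomm_ring
    rw [e2, matExpect_add ((hZZ.sub (hZi.const_mul V)).sub (hZi.mul_const V))
        (matIntegrable_const _), matExpect_sub (hZZ.sub (hZi.const_mul V)) (hZi.mul_const V),
      matExpect_sub hZZ (hZi.const_mul V), matExpect_const_mul hZi, matExpect_mul_const hZi, hmean,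
      matExpect_const]
    simp [sub_eq_add_neg]
  have h2 : ((1 / 2 : ℝ) • V - matExpect (fun ω => Z (b ω) * Z (b ω)) P).PosSemidef := by
    have hZZ := hint (fun x => Z x * Z x) (hZ.mul hZ)
    rw [posSemidef_iff_quadForm]
    · intro v
      rw [quadForm_sub, quadForm_smul, quadForm_matExpect hZZ]
      have : ∀ ω, quadForm (Z (b ω) * Z (b ω)) v = sqNorm (Z (b ω) *ᵥ v) := fun ω => by
        have h := quadForm_conjTranspose_mul (Z (b ω)) v
        rwa [(hherm _).eq] at h
      simp only [this]
      linarith [hvar v]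
    · refine (hV.isHermitian.smul (IsSelfAdjoint.all _)).sub (isHermitian_matExpect ?_)
      refine ae_of_all _ fun ω => ?_
      have h := isHermitian_conjTranspose_mul_self (Z (b ω))
      rwa [(hherm _).eq] at h
  have h3 := (h1.add h2).add (posSemidef_half_smul_sub_sq hV hV')
  rw [e] at h3
  convert h3 using 1
  -- The gain `-V` pays for both second-order terms: one half absorbs `𝔼 Z²`, the other half absorbs
  -- `V²`, since `V ≤ 1/2`.
  have : V = (1 / 2 : ℝ) • V + (1 / 2 : ℝ) • V := by rw [← add_smul]; norm_num
  nth_rewrite 2 [this]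
  abel

/-- A matrix Bernstein inequality. -/
theorem matrix_bernstein {ι : Type*} [Fintype ι] {b : ι → Ω → E} (hb : ∀ i, Measurable (b i))
    (hind : iIndepFun b P) {K : Set E} (hK : IsCompact K) (hbK : ∀ i, ∀ᵐ ω ∂P, b i ω ∈ K)
    {Z : ι → E → Matrix m m ℂ} (hZ : ∀ i, Continuous (Z i)) (hherm : ∀ i x, (Z i x).IsHermitian)
    (hmean : ∀ i j k, ∫ ω, Z i (b i ω) j k ∂P = 0) {R : ℝ}
    (hbound : ∀ i, ∀ x ∈ K, ∀ v, |quadForm (Z i x) v| ≤ R * sqNorm v)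
    {V : ι → Matrix m m ℂ} (hV : ∀ i, (V i).PosSemidef)
    (hV' : ∀ i v, quadForm (V i) v ≤ R ^ 2 * sqNorm v)
    (hvar : ∀ i v, ∫ ω, sqNorm (Z i (b i ω) *ᵥ v) ∂P ≤ quadForm (V i) v)
    {σ t : ℝ} (hσ : ∀ v, ∑ i, quadForm (V i) v ≤ σ * sqNorm v) (hσ0 : 0 < σ) (ht : 0 ≤ t)
    (hR : 0 ≤ R) (hRt : R * t ≤ 2 * σ) :
    ∃ T : Set Ω, MeasurableSet T ∧ P.real T ≤ Fintype.card m * Real.exp (-(t ^ 2 / (8 * σ))) ∧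
      ∀ ω, ω ∉ T → ∀ v, quadForm (∑ i, Z i (b i ω)) v ≤ t * sqNorm v := by
  -- At `t = 0` the exponential parameter `c` below would vanish, but the probability bound is then
  -- at least `1` unless the index type is empty.
  rcases ht.eq_or_lt with rfl | ht
  · rcases isEmpty_or_nonempty m with hm | hm
    · refine ⟨∅, MeasurableSet.empty, by simp, fun ω _ v => ?_⟩
      simp [quadForm, dotProduct]
    · refine ⟨Set.univ, MeasurableSet.univ, ?_, by simp⟩
      have : (1 : ℝ) ≤ Fintype.card m := by exact_mod_cast Fintype.card_pos
      simpa using this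
  -- This `c` minimises `2 c² σ - c t`, with value `-t²/(8σ)`; the hypothesis `R t ≤ 2σ` is what
  -- makes `c R ≤ 1/2`.
  set c : ℝ := t / (4 * σ) with hc
  have hc0 : 0 < c := by positivity
  have hcR : c * R ≤ 1 / 2 := by
    rw [hc, div_mul_eq_mul_div, div_le_iff₀ (by positivity)]; linarith
  set Ψ : ι → E → Matrix m m ℂ := fun i x => c • Z i x - (2 * c ^ 2) • V i with hΨ
  have hΨherm : ∀ i x, (Ψ i x).IsHermitian := fun i x =>
    ((hherm i x).smul (IsSelfAdjoint.all _)).sub ((hV i).isHermitian.smul (IsSelfAdjoint.all _))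
  have hΨc : ∀ i, Continuous (Ψ i) := fun i => ((hZ i).const_smul c).sub continuous_const
  have hexp : ∀ i, (1 - matExpect (fun ω => exp (Ψ i (b i ω))) P).PosSemidef := by
    intro i
    refine posSemidef_one_sub_matExpect_exp (Z := fun x => c • Z i x) (hb i) hK (hbK i)
      ((hZ i).const_smul c) (fun x => (hherm i x).smul (IsSelfAdjoint.all _)) ?_ ?_
      ((hV i).smul (by positivity)) ?_ ?_
    · rw [matExpect_smul]
      have : matExpect (fun ω => Z i (b i ω)) P = 0 := by ext j k; exact hmean i j k
      rw [this, smul_zero]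
    · intro x hx v
      rw [quadForm_smul, abs_mul, abs_of_pos hc0]
      calc c * |quadForm (Z i x) v| ≤ c * (R * sqNorm v) := by gcongr; exact hbound i x hx v
        _ = c * R * sqNorm v := by ring
        _ ≤ _ := by gcongr; exact sqNorm_nonneg v
    · intro v
      rw [quadForm_smul]
      calc 2 * c ^ 2 * quadForm (V i) v ≤ 2 * c ^ 2 * (R ^ 2 * sqNorm v) := by gcongr; exact hV' i v
        _ = 2 * (c * R) ^ 2 * sqNorm v := by ring
        _ ≤ 2 * (1 / 2) ^ 2 * sqNorm v := by
          have := sqNorm_nonneg v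
          gcongr
        _ = _ := by ring
    · intro v
      have e : ∀ ω, sqNorm ((c • Z i (b i ω)) *ᵥ v) = c ^ 2 * sqNorm (Z i (b i ω) *ᵥ v) := by
        intro ω
        simp [smul_mulVec, sqNorm, mul_pow, Finset.mul_sum]
      simp only [e]
      rw [integral_const_mul, quadForm_smul]
      have := hvar i v
      nlinarith [sq_nonneg c]
  -- The sum of all compensators: it cancels those inside `Ψ`, so the left side becomes `tr exp(c ∑
  -- Z)` and the right side involves only the norm of `∑ V`.
  set D : Matrix m m ℂ := ∑ i, (2 * c ^ 2) • V i with hD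
  have hDherm : D.IsHermitian := by
    refine Finset.sum_induction _ (fun A : Matrix m m ℂ => A.IsHermitian)
      (fun A B => IsHermitian.add) isHermitian_zero fun i _ => (hV i).isHermitian.smul (IsSelfAdjoint.all _)
  have hmain := integral_trace_exp_add_sum_le hb hind hK hbK hΨc hΨherm hexp hDherm Finset.univ
  have hsum : ∀ ω, D + ∑ i, Ψ i (b i ω) = c • ∑ i, Z i (b i ω) := by
    intro ω
    simp only [hΨ, hD, Finset.sum_sub_distrib, Finset.smul_sum]
    abel
  simp only [hsum] at hmain
  have hDle : (trace (exp D)).re ≤ Fintype.card m * Real.exp (2 * c ^ 2 * σ) := by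
    refine re_trace_exp_le hDherm fun v => ?_
    rw [hD, quadForm_sum]
    simp only [quadForm_smul]
    rw [← Finset.mul_sum, mul_assoc _ σ]
    exact mul_le_mul_of_nonneg_left (hσ v) (by positivity)
  have hSherm : ∀ ω, (c • ∑ i, Z i (b i ω)).IsHermitian := fun ω =>
    IsHermitian.smul (Finset.sum_induction _ (fun A : Matrix m m ℂ => A.IsHermitian)
      (fun A B => IsHermitian.add) isHermitian_zero fun i _ => hherm i _) (IsSelfAdjoint.all _)
  have hfm : Measurable fun ω => (trace (exp (c • ∑ i, Z i (b i ω)))).re := by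
    have hcont : Continuous fun x : ι → E => (trace (exp (c • ∑ i, Z i (x i)))).re :=
      Complex.continuous_re.comp (Continuous.matrix_trace (continuous_matrix_exp.comp
        ((continuous_finsetSum _ fun i _ => (hZ i).comp (continuous_apply i)).const_smul c)))
    exact hcont.measurable.comp (measurable_pi_lambda _ hb)
  have hf0 : ∀ ω, 0 ≤ (trace (exp (c • ∑ i, Z i (b i ω)))).re := fun ω =>
    (Complex.nonneg_iff.1 (posSemidef_exp (hSherm ω)).trace_nonneg).1
  have hfi : Integrable (fun ω => (trace (exp (c • ∑ i, Z i (b i ω)))).re) P := by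
    refine MatIntegrable.integrable_trace fun j k => ?_
    have hbS : ∀ᵐ ω ∂P, (fun i => b i ω) ∈ Set.univ.pi fun _ : ι => K := by
      have : ∀ᵐ ω ∂P, ∀ i, b i ω ∈ K := ae_all_iff.2 fun i => hbK i
      filter_upwards [this] with ω h i _ using h i
    exact matIntegrable_continuous_comp (f := fun x : ι → E => exp (c • ∑ i, Z i (x i)))
      (isCompact_univ_pi fun _ => hK)
      (measurable_pi_lambda _ hb) hbS (continuous_matrix_exp.comp
        ((continuous_finsetSum _ fun i _ => (hZ i).comp (continuous_apply i)).const_smul c)) j k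
  refine ⟨{ω | Real.exp (c * t) ≤ (trace (exp (c • ∑ i, Z i (b i ω)))).re},
    measurableSet_le measurable_const hfm, ?_, fun ω hω v => ?_⟩
  · have hM := mul_meas_ge_le_integral_of_nonneg (ae_of_all _ hf0) hfi (Real.exp (c * t))
    have h1 := hM.trans (hmain.trans hDle)
    have h2 : Real.exp (2 * c ^ 2 * σ) = Real.exp (-(t ^ 2 / (8 * σ))) * Real.exp (c * t) := by
      rw [← Real.exp_add]
      congr 1
      rw [hc]; field_simp; ring
    rw [h2, ← mul_assoc, mul_comm (Real.exp (c * t))] at h1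
    exact le_of_mul_le_mul_right h1 (Real.exp_pos _)
  · rw [Set.mem_ofPred_eq, not_le] at hω
    have h := quadForm_le_of_re_trace_exp_le (hSherm ω) hω.le v
    rw [quadForm_smul, mul_assoc] at h
    exact le_of_mul_le_mul_left h hc0
end MatrixBernstein
end BlindSR

/-! ### The Frobenius inner product, orthonormal factors and operator bounds. -/

namespace BlindSR
open Matrix
section FrobeniusInner
set_option linter.unusedSectionVars false
variable {m n k : Type*} [Fintype m] [Fintype n] [Fintype k]

/-- The real Frobenius inner product. -/
noncomputable def frobInner (A B : Matrix m n ℂ) : ℝ := (trace (Aᴴ * B)).re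

theorem frobInner_add_left (A B C : Matrix m n ℂ) :
    frobInner (A + B) C = frobInner A C + frobInner B C := by
  simp [frobInner, Matrix.add_mul]

theorem frobInner_add_right (A B C : Matrix m n ℂ) :
    frobInner A (B + C) = frobInner A B + frobInner A C := by
  simp [frobInner, Matrix.mul_add]

theorem frobInner_sub_right (A B C : Matrix m n ℂ) :
    frobInner A (B - C) = frobInner A B - frobInner A C := by
  simp [frobInner, Matrix.mul_sub]

theorem frobInner_neg_right (A B : Matrix m n ℂ) : frobInner A (-B) = -frobInner A B := by
  simp [frobInner]

theorem frobInner_smul_left (c : ℝ) (A B : Matrix m n ℂ) :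
    frobInner (c • A) B = c * frobInner A B := by
  simp [frobInner, conjTranspose_smul]

theorem frobInner_smul_right (c : ℝ) (A B : Matrix m n ℂ) :
    frobInner A (c • B) = c * frobInner A B := by
  simp [frobInner]

theorem frobInner_comm (A B : Matrix m n ℂ) : frobInner A B = frobInner B A := by
  have h : trace (Bᴴ * A) = star (trace (Aᴴ * B)) := by
    rw [← trace_conjTranspose, conjTranspose_mul, conjTranspose_conjTranspose]
  rw [frobInner, frobInner, h]
  simp

theorem frobInner_self (A : Matrix m n ℂ) : frobInner A A = ‖A‖ ^ 2 :=
  re_trace_conjTranspose_mul_self A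

theorem frobInner_le (A B : Matrix m n ℂ) : frobInner A B ≤ ‖A‖ * ‖B‖ :=
  (Complex.re_le_norm _).trans (norm_trace_conjTranspose_mul_le A B)

theorem frobInner_mul_right (A : Matrix m n ℂ) (B : Matrix m k ℂ) (C : Matrix k n ℂ) :
    frobInner A (B * C) = frobInner (A * Cᴴ) B := by
  rw [frobInner, frobInner, conjTranspose_mul, conjTranspose_conjTranspose, ← Matrix.mul_assoc,
    trace_mul_comm, Matrix.mul_assoc]

theorem frobInner_mul_left (A : Matrix m n ℂ) (B : Matrix m k ℂ) (C : Matrix k n ℂ) :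
    frobInner A (B * C) = frobInner (Bᴴ * A) C := by
  rw [frobInner, frobInner, conjTranspose_mul, conjTranspose_conjTranspose, ← Matrix.mul_assoc]

theorem norm_mul_of_orthonormal {r : Type*} [Fintype r] [DecidableEq r] {U : Matrix m r ℂ}
    (hU : Uᴴ * U = 1) (A : Matrix r n ℂ) : ‖U * A‖ = ‖A‖ := by
  rw [← sq_eq_sq₀ (norm_nonneg _) (norm_nonneg _), ← frobInner_self, ← frobInner_self,
    frobInner_mul_left, ← Matrix.mul_assoc, hU, Matrix.one_mul]

theorem norm_mul_conjTranspose_of_orthonormal {r : Type*} [Fintype r] [DecidableEq r]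
    {V : Matrix n r ℂ} (hV : Vᴴ * V = 1) (A : Matrix m r ℂ) : ‖A * Vᴴ‖ = ‖A‖ := by
  rw [← frobenius_norm_conjTranspose, conjTranspose_mul, conjTranspose_conjTranspose,
    norm_mul_of_orthonormal hV, frobenius_norm_conjTranspose]

theorem norm_sq_eq_add_of_orthonormal {r : Type*} [Fintype r] [DecidableEq r] [DecidableEq m]
    {U : Matrix m r ℂ} (hU : Uᴴ * U = 1) (A : Matrix m n ℂ) :
    ‖A‖ ^ 2 = ‖Uᴴ * A‖ ^ 2 + ‖(1 - U * Uᴴ) * A‖ ^ 2 := by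
  have h0 : frobInner (U * (Uᴴ * A)) ((1 - U * Uᴴ) * A) = 0 := by
    rw [frobInner_comm, frobInner_mul_left, Matrix.sub_mul, Matrix.mul_sub, Matrix.one_mul]
    simp only [← Matrix.mul_assoc]
    rw [hU]
    simp [frobInner]
  have h1 : A = U * (Uᴴ * A) + (1 - U * Uᴴ) * A := by
    rw [Matrix.sub_mul, Matrix.one_mul, ← Matrix.mul_assoc]; abel
  conv_lhs => rw [← frobInner_self, h1]
  rw [frobInner_add_left, frobInner_add_right, frobInner_add_right, h0,
    frobInner_comm ((1 - U * Uᴴ) * A) (U * (Uᴴ * A)), h0, frobInner_self, frobInner_self,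
    norm_mul_of_orthonormal hU]
  ring

theorem norm_conjTranspose_mul_le_of_orthonormal {r : Type*} [Fintype r] [DecidableEq r]
    {U : Matrix m r ℂ} (hU : Uᴴ * U = 1) (A : Matrix m n ℂ) : ‖Uᴴ * A‖ ≤ ‖A‖ := by
  classical
  refine (sq_le_sq₀ (norm_nonneg _) (norm_nonneg _)).1 ?_
  rw [norm_sq_eq_add_of_orthonormal hU A]
  linarith [sq_nonneg ‖(1 - U * Uᴴ) * A‖]

theorem norm_one_sub_mul_le_of_orthonormal {r : Type*} [Fintype r] [DecidableEq r] [DecidableEq m]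
    {U : Matrix m r ℂ} (hU : Uᴴ * U = 1) (A : Matrix m n ℂ) : ‖(1 - U * Uᴴ) * A‖ ≤ ‖A‖ := by
  refine (sq_le_sq₀ (norm_nonneg _) (norm_nonneg _)).1 ?_
  rw [norm_sq_eq_add_of_orthonormal hU A]
  linarith [sq_nonneg ‖Uᴴ * A‖]

theorem isHermitian_one_sub {r : Type*} [Fintype r] [DecidableEq m] (U : Matrix m r ℂ) :
    (1 - U * Uᴴ)ᴴ = 1 - U * Uᴴ := by simp

theorem norm_mul_le_of_orthonormal {r : Type*} [Fintype r] [DecidableEq r]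
    {V : Matrix n r ℂ} (hV : Vᴴ * V = 1) (A : Matrix m n ℂ) : ‖A * V‖ ≤ ‖A‖ := by
  have h := norm_conjTranspose_mul_le_of_orthonormal hV Aᴴ
  rwa [← conjTranspose_mul, frobenius_norm_conjTranspose, frobenius_norm_conjTranspose] at h

theorem norm_mul_one_sub_le_of_orthonormal {r : Type*} [Fintype r] [DecidableEq r] [DecidableEq n]
    {V : Matrix n r ℂ} (hV : Vᴴ * V = 1) (A : Matrix m n ℂ) : ‖A * (1 - V * Vᴴ)‖ ≤ ‖A‖ := by
  have h := norm_one_sub_mul_le_of_orthonormal hV Aᴴ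
  rwa [← isHermitian_one_sub V, ← conjTranspose_mul, frobenius_norm_conjTranspose,
    frobenius_norm_conjTranspose] at h

/-- `‖L x‖ ≥ c ‖x‖` for every vector `x`. -/
def IsBoundedBelow (L : Matrix m k ℂ) (c : ℝ) : Prop :=
  ∀ x : Matrix k (Fin 1) ℂ, c * ‖x‖ ≤ ‖L * x‖

/-- `‖L x‖ ≤ c ‖x‖` for every vector `x`: the operator norm of `L` is at most `c`. -/
def IsBoundedAbove (L : Matrix m k ℂ) (c : ℝ) : Prop :=
  ∀ x : Matrix k (Fin 1) ℂ, ‖L * x‖ ≤ c * ‖x‖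

theorem norm_sq_eq_sum_columns (A : Matrix m n ℂ) :
    ‖A‖ ^ 2 = ∑ j, ‖(Matrix.of fun i (_ : Fin 1) => A i j : Matrix m (Fin 1) ℂ)‖ ^ 2 := by
  simp only [frobenius_norm_sq, of_apply, Finset.univ_unique, Finset.sum_singleton]
  exact Finset.sum_comm

theorem mul_column (L : Matrix m k ℂ) (B : Matrix k n ℂ) (j : n) :
    (Matrix.of fun i (_ : Fin 1) => (L * B) i j : Matrix m (Fin 1) ℂ) =
      L * Matrix.of fun i (_ : Fin 1) => B i j := by
  ext i l
  simp [mul_apply]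

/-- Squared Frobenius norms add over columns, so a bound on vectors passes to matrices with the same
constant. -/
theorem IsBoundedBelow.le_norm_mul {L : Matrix m k ℂ} {c : ℝ} (h : IsBoundedBelow L c) (hc : 0 ≤ c)
    (B : Matrix k n ℂ) : c * ‖B‖ ≤ ‖L * B‖ := by
  refine (sq_le_sq₀ (by positivity) (norm_nonneg _)).1 ?_
  rw [mul_pow, norm_sq_eq_sum_columns B, norm_sq_eq_sum_columns (L * B), Finset.mul_sum]
  refine Finset.sum_le_sum fun j _ => ?_
  rw [← mul_pow, mul_column]
  exact pow_le_pow_left₀ (by positivity) (h _) 2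

theorem IsBoundedAbove.norm_mul_le {L : Matrix m k ℂ} {c : ℝ} (h : IsBoundedAbove L c) (hc : 0 ≤ c)
    (B : Matrix k n ℂ) : ‖L * B‖ ≤ c * ‖B‖ := by
  refine (sq_le_sq₀ (norm_nonneg _) (by positivity)).1 ?_
  rw [mul_pow, norm_sq_eq_sum_columns B, norm_sq_eq_sum_columns (L * B), Finset.mul_sum]
  refine Finset.sum_le_sum fun j _ => ?_
  rw [← mul_pow, mul_column]
  exact pow_le_pow_left₀ (by positivity) (h _) 2

theorem IsBoundedBelow.le_norm_mul_conjTranspose {L : Matrix m k ℂ} {c : ℝ}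
    (h : IsBoundedBelow L c) (hc : 0 ≤ c) (B : Matrix n k ℂ) : c * ‖B‖ ≤ ‖B * Lᴴ‖ := by
  have := h.le_norm_mul hc Bᴴ
  rwa [frobenius_norm_conjTranspose, ← frobenius_norm_conjTranspose (L * Bᴴ), conjTranspose_mul,
    conjTranspose_conjTranspose] at this

theorem IsBoundedAbove.norm_mul_conjTranspose_le {L : Matrix m k ℂ} {c : ℝ}
    (h : IsBoundedAbove L c) (hc : 0 ≤ c) (B : Matrix n k ℂ) : ‖B * Lᴴ‖ ≤ c * ‖B‖ := by
  have := h.norm_mul_le hc Bᴴ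
  rwa [frobenius_norm_conjTranspose, ← frobenius_norm_conjTranspose, conjTranspose_mul,
    conjTranspose_conjTranspose] at this

/-- The adjoint of an operator has the same norm bound. -/
theorem IsBoundedAbove.conjTranspose {L : Matrix m k ℂ} {c : ℝ} (h : IsBoundedAbove L c)
    (hc : 0 ≤ c) : IsBoundedAbove Lᴴ c := by
  intro x
  have h1 : ‖Lᴴ * x‖ ^ 2 ≤ ‖x‖ * (c * ‖Lᴴ * x‖) := by
    rw [← frobInner_self, frobInner_mul_left, conjTranspose_conjTranspose]
    refine (frobInner_le _ _).trans ?_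
    rw [mul_comm]
    gcongr
    exact h.norm_mul_le hc _
  rcases (norm_nonneg (Lᴴ * x)).eq_or_lt with h0 | h0
  · rw [← h0]; positivity
  · nlinarith

theorem IsBoundedAbove.norm_conjTranspose_mul_le {L : Matrix m k ℂ} {c : ℝ}
    (h : IsBoundedAbove L c) (hc : 0 ≤ c) (B : Matrix m n ℂ) : ‖Lᴴ * B‖ ≤ c * ‖B‖ :=
  (h.conjTranspose hc).norm_mul_le hc B

theorem IsBoundedBelow.of_norm_sub_le {L L' : Matrix m k ℂ} {c d : ℝ} (h : IsBoundedBelow L c)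
    (hd : ‖L' - L‖ ≤ d) : IsBoundedBelow L' (c - d) := by
  intro x
  have h1 : L * x = L' * x - (L' - L) * x := by rw [Matrix.sub_mul]; abel
  have h2 := h x
  rw [h1] at h2
  have h3 := (norm_sub_le (L' * x) ((L' - L) * x))
  have h4 : ‖(L' - L) * x‖ ≤ d * ‖x‖ := (frobenius_norm_mul _ _).trans (by gcongr)
  linarith

theorem IsBoundedAbove.of_norm_sub_le {L L' : Matrix m k ℂ} {c d : ℝ} (h : IsBoundedAbove L c)
    (hd : ‖L' - L‖ ≤ d) : IsBoundedAbove L' (c + d) := by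
  intro x
  have h1 : L' * x = L * x + (L' - L) * x := by rw [Matrix.sub_mul]; abel
  rw [h1]
  have h3 := (norm_add_le (L * x) ((L' - L) * x))
  have h4 : ‖(L' - L) * x‖ ≤ d * ‖x‖ := (frobenius_norm_mul _ _).trans (by gcongr)
  linarith [h x]

theorem IsBoundedBelow.mono {L : Matrix m k ℂ} {c d : ℝ} (h : IsBoundedBelow L c) (hd : d ≤ c) :
    IsBoundedBelow L d := fun x =>
  (mul_le_mul_of_nonneg_right hd (norm_nonneg x)).trans (h x)

theorem IsBoundedAbove.mono {L : Matrix m k ℂ} {c d : ℝ} (h : IsBoundedAbove L c) (hd : c ≤ d) :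
    IsBoundedAbove L d := fun x =>
  (h x).trans (mul_le_mul_of_nonneg_right hd (norm_nonneg x))
end FrobeniusInner
end BlindSR

/-! ### Geometry near the ground truth: energy, normal component and the gradient inequality. -/

namespace BlindSR
open Matrix
section LocalConvergence
set_option linter.unusedSectionVars false
variable {m n r : Type*} [Fintype m] [Fintype n] [Fintype r] [DecidableEq m] [DecidableEq n]
  [DecidableEq r]

/-- The component of `A` orthogonal to the tangent space `{U Bᴴ + C Vᴴ}`. -/
def normalPart (U : Matrix m r ℂ) (V : Matrix n r ℂ) (A : Matrix m n ℂ) : Matrix m n ℂ :=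
  (1 - U * Uᴴ) * A * (1 - V * Vᴴ)

theorem normalPart_normalPart {U : Matrix m r ℂ} {V : Matrix n r ℂ} (hU : Uᴴ * U = 1)
    (hV : Vᴴ * V = 1) (A : Matrix m n ℂ) :
    normalPart U V (normalPart U V A) = normalPart U V A := by
  have h1 : (1 - U * Uᴴ) * (1 - U * Uᴴ) = 1 - U * Uᴴ := by
    rw [Matrix.sub_mul, Matrix.one_mul, Matrix.mul_sub, Matrix.mul_one, Matrix.mul_assoc U,
      ← Matrix.mul_assoc Uᴴ, hU, Matrix.one_mul]; abel
  have h2 : (1 - V * Vᴴ) * (1 - V * Vᴴ) = 1 - V * Vᴴ := by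
    rw [Matrix.sub_mul, Matrix.one_mul, Matrix.mul_sub, Matrix.mul_one, Matrix.mul_assoc V,
      ← Matrix.mul_assoc Vᴴ, hV, Matrix.one_mul]; abel
  rw [normalPart, normalPart]
  rw [show (1 - U * Uᴴ) * ((1 - U * Uᴴ) * A * (1 - V * Vᴴ)) * (1 - V * Vᴴ) =
    ((1 - U * Uᴴ) * (1 - U * Uᴴ)) * A * ((1 - V * Vᴴ) * (1 - V * Vᴴ)) by
      simp only [Matrix.mul_assoc], h1, h2]

theorem frobInner_normalPart (U : Matrix m r ℂ) (V : Matrix n r ℂ) (A B : Matrix m n ℂ) :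
    frobInner A (normalPart U V B) = frobInner (normalPart U V A) B := by
  rw [normalPart, frobInner_mul_right, frobInner_mul_left, isHermitian_one_sub,
    isHermitian_one_sub, normalPart, Matrix.mul_assoc]

theorem norm_sub_normalPart_le_of_orthonormal {U : Matrix m r ℂ} {V : Matrix n r ℂ} (hU : Uᴴ * U = 1)
    (hV : Vᴴ * V = 1) (A : Matrix m n ℂ) :
    ‖A - normalPart U V A‖ ≤ ‖A‖ := by
  refine (sq_le_sq₀ (norm_nonneg _) (norm_nonneg _)).1 ?_
  have h0 : frobInner (A - normalPart U V A) (normalPart U V A) = 0 := by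
    rw [frobInner_comm, frobInner_sub_right, frobInner_normalPart U V (normalPart U V A) A,
      normalPart_normalPart hU hV, sub_self]
  have h1 : A = (A - normalPart U V A) + normalPart U V A := by abel
  conv_rhs => rw [← frobInner_self, h1]
  rw [frobInner_add_left, frobInner_add_right, frobInner_add_right, h0,
    frobInner_comm (normalPart U V A), h0, frobInner_self, frobInner_self]
  linarith [sq_nonneg ‖normalPart U V A‖]

/-- A positive semidefinite sensing operator `Q` of norm at most `h ^ 2` which is nearly isometric
on the tangent space spanned by the orthonormal factors `U` and `V`. -/
structure IsTangentIsometry (U : Matrix m r ℂ) (V : Matrix n r ℂ)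
    (Q : Matrix m n ℂ →ₗ[ℝ] Matrix m n ℂ) (h : ℝ) : Prop where
  left_orthonormal : Uᴴ * U = 1
  right_orthonormal : Vᴴ * V = 1
  one_le : 1 ≤ h
  symm : ∀ A B, frobInner A (Q B) = frobInner (Q A) B
  nonneg : ∀ A, 0 ≤ frobInner A (Q A)
  le : ∀ A, frobInner A (Q A) ≤ h ^ 2 * ‖A‖ ^ 2
  tangent : ∀ A, |frobInner (A - normalPart U V A) (Q (A - normalPart U V A)) -
    ‖A - normalPart U V A‖ ^ 2| ≤ 1 / 10 * ‖A - normalPart U V A‖ ^ 2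

/-- The seminorm induced by the sensing operator. -/
noncomputable def energy (Q : Matrix m n ℂ →ₗ[ℝ] Matrix m n ℂ) (A : Matrix m n ℂ) : ℝ :=
  Real.sqrt (frobInner A (Q A))

theorem energy_nonneg (Q : Matrix m n ℂ →ₗ[ℝ] Matrix m n ℂ) (A : Matrix m n ℂ) :
    0 ≤ energy Q A := Real.sqrt_nonneg _

namespace IsTangentIsometry
variable {U : Matrix m r ℂ} {V : Matrix n r ℂ} {Q : Matrix m n ℂ →ₗ[ℝ] Matrix m n ℂ} {h : ℝ}

theorem energy_sq (G : IsTangentIsometry U V Q h) (A : Matrix m n ℂ) :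
    energy Q A ^ 2 = frobInner A (Q A) := Real.sq_sqrt (G.nonneg A)

/-- The sensing operator as a bilinear form. -/
noncomputable def bilin (Q : Matrix m n ℂ →ₗ[ℝ] Matrix m n ℂ) :
    LinearMap.BilinForm ℝ (Matrix m n ℂ) :=
  LinearMap.mk₂ ℝ (fun A B => frobInner A (Q B)) (fun A B C => frobInner_add_left A B _)
    (fun c A B => frobInner_smul_left c A _)
    (fun A B C => by rw [map_add, frobInner_add_right])
    (fun c A B => by rw [map_smul, frobInner_smul_right]; rfl)

theorem frobInner_le_energy (G : IsTangentIsometry U V Q h) (A B : Matrix m n ℂ) :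
    frobInner A (Q B) ≤ energy Q A * energy Q B := by
  have h1 := (bilin Q).apply_mul_apply_le_of_forall_zero_le (fun A => G.nonneg A) A B
  have h2 : frobInner A (Q B) ^ 2 ≤ (energy Q A * energy Q B) ^ 2 := by
    rw [mul_pow, G.energy_sq, G.energy_sq, sq]
    have e : frobInner B (Q A) = frobInner A (Q B) := by rw [G.symm, frobInner_comm]
    have h3 : frobInner A (Q B) * frobInner B (Q A) ≤ frobInner A (Q A) * frobInner B (Q B) := h1
    rwa [e] at h3
  exact (abs_le_of_sq_le_sq' h2 (mul_nonneg (energy_nonneg _ _) (energy_nonneg _ _))).2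

theorem energy_add_sq (G : IsTangentIsometry U V Q h) (A B : Matrix m n ℂ) :
    energy Q (A + B) ^ 2 = energy Q A ^ 2 + 2 * frobInner (Q A) B + energy Q B ^ 2 := by
  rw [G.energy_sq, G.energy_sq, G.energy_sq, map_add, frobInner_add_right, frobInner_add_left,
    frobInner_add_left, G.symm A B, G.symm B A, frobInner_comm (Q B) A, G.symm A B]
  ring

theorem energy_add_le (G : IsTangentIsometry U V Q h) (A B : Matrix m n ℂ) :
    energy Q (A + B) ≤ energy Q A + energy Q B := by
  refine (sq_le_sq₀ (energy_nonneg _ _)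
    (add_nonneg (energy_nonneg _ _) (energy_nonneg _ _))).1 ?_
  rw [G.energy_add_sq, ← G.symm]
  nlinarith [G.frobInner_le_energy A B]

theorem energy_neg (Q : Matrix m n ℂ →ₗ[ℝ] Matrix m n ℂ) (A : Matrix m n ℂ) :
    energy Q (-A) = energy Q A := by
  rw [energy, energy, map_neg, frobInner_neg_right, frobInner_comm, frobInner_neg_right, neg_neg,
    frobInner_comm]

theorem energy_le (G : IsTangentIsometry U V Q h) (A : Matrix m n ℂ) : energy Q A ≤ h * ‖A‖ := by
  have := G.one_le
  refine (sq_le_sq₀ (energy_nonneg _ _) (by positivity)).1 ?_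
  rw [G.energy_sq, mul_pow]
  exact G.le A

/-- Cauchy–Schwarz for the semidefinite form, applied to `⟨Q A, Q A⟩`, costs one factor `h` instead
of `h²`. -/
theorem norm_apply_le (G : IsTangentIsometry U V Q h) (A : Matrix m n ℂ) :
    ‖Q A‖ ≤ h * energy Q A := by
  have h1 : ‖Q A‖ ^ 2 ≤ (h * ‖Q A‖) * energy Q A := by
    rw [← frobInner_self]
    exact (G.frobInner_le_energy _ _).trans
      (mul_le_mul_of_nonneg_right (G.energy_le _) (energy_nonneg _ _))
  rcases (norm_nonneg (Q A)).eq_or_lt with h0 | h0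
  · rw [← h0]; exact mul_nonneg (by linarith [G.one_le]) (energy_nonneg _ _)
  · nlinarith

theorem norm_normalPart_le (G : IsTangentIsometry U V Q h) (A : Matrix m n ℂ) :
    ‖normalPart U V A‖ ≤ ‖A‖ :=
  (norm_mul_one_sub_le_of_orthonormal G.right_orthonormal _).trans
    (norm_one_sub_mul_le_of_orthonormal G.left_orthonormal _)

theorem norm_sub_normalPart_le (G : IsTangentIsometry U V Q h) (A : Matrix m n ℂ) :
    ‖A - normalPart U V A‖ ≤ ‖A‖ :=
  norm_sub_normalPart_le_of_orthonormal G.left_orthonormal G.right_orthonormal A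

theorem energy_tangent_le (G : IsTangentIsometry U V Q h) (A : Matrix m n ℂ) :
    energy Q (A - normalPart U V A) ≤ 1.05 * ‖A - normalPart U V A‖ := by
  refine (sq_le_sq₀ (energy_nonneg _ _) (by positivity)).1 ?_
  rw [G.energy_sq, mul_pow]
  nlinarith [(abs_le.1 (G.tangent A)).2, sq_nonneg ‖A - normalPart U V A‖]

theorem le_energy_tangent (G : IsTangentIsometry U V Q h) (A : Matrix m n ℂ) :
    0.94 * ‖A - normalPart U V A‖ ≤ energy Q (A - normalPart U V A) := by
  refine (sq_le_sq₀ (by positivity) (energy_nonneg _ _)).1 ?_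
  rw [G.energy_sq, mul_pow]
  nlinarith [(abs_le.1 (G.tangent A)).1, sq_nonneg ‖A - normalPart U V A‖]

/-- The tangent part is measured nearly isometrically and only the normal part pays the factor `h`.
Together with the matching lower bound this makes energy and norm comparable whenever the normal
part is small. -/
theorem energy_le_add (G : IsTangentIsometry U V Q h) (A : Matrix m n ℂ) :
    energy Q A ≤ 1.05 * ‖A‖ + h * ‖normalPart U V A‖ := by
  have h1 := G.energy_add_le (A - normalPart U V A) (normalPart U V A)
  rw [sub_add_cancel] at h1
  have h2 := G.energy_tangent_le A
  have h3 := G.energy_le (normalPart U V A)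
  have h4 := G.norm_sub_normalPart_le A
  linarith

theorem le_energy_add (G : IsTangentIsometry U V Q h) (A : Matrix m n ℂ) :
    0.94 * ‖A‖ ≤ energy Q A + 2 * h * ‖normalPart U V A‖ := by
  have h1 := G.energy_add_le A (-normalPart U V A)
  rw [energy_neg, ← sub_eq_add_neg] at h1
  have h2 := G.le_energy_tangent A
  have h3 := G.energy_le (normalPart U V A)
  have h4 := norm_add_le (A - normalPart U V A) (normalPart U V A)
  rw [sub_add_cancel] at h4
  have h5 : 1 * ‖normalPart U V A‖ ≤ h * ‖normalPart U V A‖ := by gcongr; exact G.one_le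
  linarith [norm_nonneg (normalPart U V A)]

end IsTangentIsometry

/-- The factors `L`, `R` are well conditioned with respect to the singular values `a ^ 2 ≤ s ^ 2`
and `L * Rᴴ` is close to `M`, whose column and row spaces are spanned by `U` and `V`. -/
structure IsNearFactorization (U : Matrix m r ℂ) (V : Matrix n r ℂ) (M : Matrix m n ℂ)
    (h a s : ℝ) (L : Matrix m r ℂ) (R : Matrix n r ℂ) : Prop where
  pos : 0 < a
  le : a ≤ s
  left_range : (1 - U * Uᴴ) * M = 0
  right_range : M * (1 - V * Vᴴ) = 0
  left_below : IsBoundedBelow L (0.9 * a)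
  right_below : IsBoundedBelow R (0.9 * a)
  left_above : IsBoundedAbove L (1.1 * s)
  right_above : IsBoundedAbove R (1.1 * s)
  close : h * ‖L * Rᴴ - M‖ ≤ 1 / 100 * a ^ 2

namespace IsNearFactorization
variable {U : Matrix m r ℂ} {V : Matrix n r ℂ} {Q : Matrix m n ℂ →ₗ[ℝ] Matrix m n ℂ} {h a s : ℝ}
  {M : Matrix m n ℂ} {L : Matrix m r ℂ} {R : Matrix n r ℂ}

/-- The projection `1 - UUᴴ` kills `M`, so it sends `L Rᴴ` and the error to the same matrix; `R` can
then be cancelled because it is bounded below. -/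
theorem norm_left_le (G : IsTangentIsometry U V Q h) (F : IsNearFactorization U V M h a s L R) :
    0.9 * a * ‖(1 - U * Uᴴ) * L‖ ≤ ‖L * Rᴴ - M‖ := by
  have ha := F.pos
  refine (F.right_below.le_norm_mul_conjTranspose (by positivity) _).trans ?_
  have e : (1 - U * Uᴴ) * L * Rᴴ = (1 - U * Uᴴ) * (L * Rᴴ - M) := by
    rw [Matrix.mul_sub _ (L * Rᴴ), F.left_range, sub_zero, Matrix.mul_assoc]
  rw [e]
  exact norm_one_sub_mul_le_of_orthonormal G.left_orthonormal _

theorem norm_right_le (G : IsTangentIsometry U V Q h) (F : IsNearFactorization U V M h a s L R) :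
    0.9 * a * ‖(1 - V * Vᴴ) * R‖ ≤ ‖L * Rᴴ - M‖ := by
  have ha := F.pos
  have h1 := F.left_below.le_norm_mul (by positivity) ((1 - V * Vᴴ) * R)ᴴ
  rw [frobenius_norm_conjTranspose] at h1
  refine h1.trans ?_
  have e : L * ((1 - V * Vᴴ) * R)ᴴ = (L * Rᴴ - M) * (1 - V * Vᴴ) := by
    rw [Matrix.sub_mul (L * Rᴴ), F.right_range, sub_zero, conjTranspose_mul, isHermitian_one_sub,
      Matrix.mul_assoc]
  rw [e]
  exact norm_mul_one_sub_le_of_orthonormal G.right_orthonormal _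

/-- The normal part of the error is the product of the two out-of-space components of the factors,
each of size `‖L Rᴴ - M‖ / a`. It is thus quadratic in the error, and `h` times one of the two error
factors is absorbed by the closeness assumption. -/
theorem norm_normalPart_le (G : IsTangentIsometry U V Q h)
    (F : IsNearFactorization U V M h a s L R) :
    h * ‖normalPart U V (L * Rᴴ - M)‖ ≤ 0.0125 * ‖L * Rᴴ - M‖ := by
  have ha := F.pos
  have hh := G.one_le
  have e : normalPart U V (L * Rᴴ - M) = ((1 - U * Uᴴ) * L) * ((1 - V * Vᴴ) * R)ᴴ := by
    rw [normalPart, Matrix.mul_sub _ (L * Rᴴ), F.left_range, sub_zero, conjTranspose_mul, isHermitian_one_sub]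
    simp only [Matrix.mul_assoc]
  have h1 := F.norm_left_le G
  have h2 := F.norm_right_le G
  have h3 : ‖normalPart U V (L * Rᴴ - M)‖ ≤ ‖(1 - U * Uᴴ) * L‖ * ‖(1 - V * Vᴴ) * R‖ := by
    rw [e]
    refine (frobenius_norm_mul _ _).trans (le_of_eq ?_)
    rw [frobenius_norm_conjTranspose]
  set N := ‖L * Rᴴ - M‖
  have h4 : (0.9 * a) ^ 2 * (‖(1 - U * Uᴴ) * L‖ * ‖(1 - V * Vᴴ) * R‖) ≤ N * N := by
    calc _ = (0.9 * a * ‖(1 - U * Uᴴ) * L‖) * (0.9 * a * ‖(1 - V * Vᴴ) * R‖) := by ring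
      _ ≤ N * N := by gcongr
  have h5 : (0.9 * a) ^ 2 * (h * ‖normalPart U V (L * Rᴴ - M)‖) ≤ 1 / 100 * a ^ 2 * N := by
    calc _ = h * ((0.9 * a) ^ 2 * ‖normalPart U V (L * Rᴴ - M)‖) := by ring
      _ ≤ h * (N * N) := mul_le_mul_of_nonneg_left
        ((mul_le_mul_of_nonneg_left h3 (by positivity)).trans h4) (by positivity)
      _ = h * N * N := by ring
      _ ≤ _ := mul_le_mul_of_nonneg_right F.close (norm_nonneg _)
  have h6 : 0 < a ^ 2 := by positivity
  refine le_of_mul_le_mul_left (h5.trans ?_) (show 0 < (0.9 * a) ^ 2 by positivity)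
  have : 0 ≤ a ^ 2 * N := by positivity
  nlinarith

theorem energy_le (G : IsTangentIsometry U V Q h) (F : IsNearFactorization U V M h a s L R) :
    energy Q (L * Rᴴ - M) ≤ 1.1 * ‖L * Rᴴ - M‖ := by
  have h1 := G.energy_le_add (L * Rᴴ - M)
  have h2 := F.norm_normalPart_le G
  linarith [norm_nonneg (L * Rᴴ - M)]

theorem le_energy (G : IsTangentIsometry U V Q h) (F : IsNearFactorization U V M h a s L R) :
    0.9 * ‖L * Rᴴ - M‖ ≤ energy Q (L * Rᴴ - M) := by
  have h1 := G.le_energy_add (L * Rᴴ - M)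
  have h2 := F.norm_normalPart_le G
  linarith [norm_nonneg (L * Rᴴ - M)]

/-- The norm of the gradient at `(L, R)`. -/
noncomputable def gradNorm (Q : Matrix m n ℂ →ₗ[ℝ] Matrix m n ℂ) (M : Matrix m n ℂ)
    (L : Matrix m r ℂ) (R : Matrix n r ℂ) : ℝ :=
  Real.sqrt (‖Q (L * Rᴴ - M) * R‖ ^ 2 + ‖Lᴴ * Q (L * Rᴴ - M)‖ ^ 2)

theorem gradNorm_sq (Q : Matrix m n ℂ →ₗ[ℝ] Matrix m n ℂ) (M : Matrix m n ℂ)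
    (L : Matrix m r ℂ) (R : Matrix n r ℂ) : gradNorm Q M L R ^ 2 =
      ‖Q (L * Rᴴ - M) * R‖ ^ 2 + ‖Lᴴ * Q (L * Rᴴ - M)‖ ^ 2 := Real.sq_sqrt (by positivity)

theorem norm_apply_mul_le_gradNorm (Q : Matrix m n ℂ →ₗ[ℝ] Matrix m n ℂ) (M : Matrix m n ℂ)
    (L : Matrix m r ℂ) (R : Matrix n r ℂ) : ‖Q (L * Rᴴ - M) * R‖ ≤ gradNorm Q M L R :=
  Real.le_sqrt_of_sq_le (by linarith [sq_nonneg ‖Lᴴ * Q (L * Rᴴ - M)‖])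

theorem norm_mul_apply_le_gradNorm (Q : Matrix m n ℂ →ₗ[ℝ] Matrix m n ℂ) (M : Matrix m n ℂ)
    (L : Matrix m r ℂ) (R : Matrix n r ℂ) : ‖Lᴴ * Q (L * Rᴴ - M)‖ ≤ gradNorm Q M L R :=
  Real.le_sqrt_of_sq_le (by linarith [sq_nonneg ‖Q (L * Rᴴ - M) * R‖])

/-- `R` is bounded below and almost contained in the range of `V`, so right multiplication by `Rᴴ V`
is bounded below, hence injective, hence surjective on square matrices. The matrix `X` lets the core
of the error be written as a first-order variation of `L`. -/
theorem exists_core (G : IsTangentIsometry U V Q h) (F : IsNearFactorization U V M h a s L R)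
    (C : Matrix r r ℂ) : ∃ X : Matrix r r ℂ, X * (Rᴴ * V) = C ∧ 0.8 * a * ‖X‖ ≤ ‖C‖ := by
  have ha := F.pos
  have hw := F.norm_right_le G
  have hc := F.close
  have hh := G.one_le
  have hN : ‖L * Rᴴ - M‖ ≤ 1 / 100 * a ^ 2 := by
    refine le_trans ?_ hc
    exact le_mul_of_one_le_left (norm_nonneg _) hh
  have hw' : ‖(1 - V * Vᴴ) * R‖ ≤ 0.02 * a := by
    have h1 : 0.9 * a * ‖(1 - V * Vᴴ) * R‖ ≤ 0.9 * a * (0.02 * a) := by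
      refine (hw.trans hN).trans ?_; nlinarith [sq_nonneg a]
    exact le_of_mul_le_mul_left h1 (by positivity)
  have hlow : ∀ X : Matrix r r ℂ, 0.8 * a * ‖X‖ ≤ ‖X * (Rᴴ * V)‖ := by
    intro X
    have h1 := F.right_below.le_norm_mul_conjTranspose (by positivity) X
    have e : X * Rᴴ = X * (Rᴴ * V) * Vᴴ + X * ((1 - V * Vᴴ) * R)ᴴ := by
      rw [conjTranspose_mul, isHermitian_one_sub, Matrix.mul_sub, Matrix.mul_one, Matrix.mul_sub]
      simp only [Matrix.mul_assoc]; abel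
    have h2 : ‖X * ((1 - V * Vᴴ) * R)ᴴ‖ ≤ ‖X‖ * (0.02 * a) := by
      refine (frobenius_norm_mul _ _).trans ?_
      rw [frobenius_norm_conjTranspose]; gcongr
    have h3 := norm_add_le (X * (Rᴴ * V) * Vᴴ) (X * ((1 - V * Vᴴ) * R)ᴴ)
    rw [← e, norm_mul_conjTranspose_of_orthonormal G.right_orthonormal] at h3
    have h4 : 0 ≤ a * ‖X‖ := by positivity
    nlinarith
  let f : Matrix r r ℂ →ₗ[ℂ] Matrix r r ℂ :=
    { toFun := fun X => X * (Rᴴ * V)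
      map_add' := fun X Y => Matrix.add_mul X Y _
      map_smul' := fun c X => Matrix.smul_mul c X _ }
  have hinj : Function.Injective f := by
    rw [injective_iff_map_eq_zero]
    intro X hX
    have h1 := hlow X
    have h2 : X * (Rᴴ * V) = 0 := hX
    rw [h2, norm_zero] at h1
    have h3 : ‖X‖ ≤ 0 := by
      by_contra h4
      push Not at h4
      have : 0 < 0.8 * a * ‖X‖ := by positivity
      linarith
    simpa using h3
  obtain ⟨X, hX⟩ := LinearMap.injective_iff_surjective.1 hinj C
  have hX' : X * (Rᴴ * V) = C := hX
  exact ⟨X, hX', hX' ▸ hlow X⟩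

/-- A Polyak–Łojasiewicz inequality near the ground truth. -/
theorem energy_le_gradNorm (G : IsTangentIsometry U V Q h)
    (F : IsNearFactorization U V M h a s L R) :
    0.2 * a * energy Q (L * Rᴴ - M) ≤ gradNorm Q M L R := by
  have ha := F.pos
  have hh := G.one_le
  have hw1 := F.norm_left_le G
  have hw2 := F.norm_right_le G
  have hx := norm_apply_mul_le_gradNorm Q M L R
  have hy := norm_mul_apply_le_gradNorm Q M L R
  obtain ⟨X, hX, hXn⟩ := F.exists_core G (Uᴴ * (L * Rᴴ - M) * V)
  have hq := F.le_energy G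
  have hE := G.norm_apply_le (L * Rᴴ - M)
  have hclose := F.close
  have hC : ‖Uᴴ * (L * Rᴴ - M) * V‖ ≤ ‖L * Rᴴ - M‖ :=
    (norm_mul_le_of_orthonormal G.right_orthonormal _).trans
      (norm_conjTranspose_mul_le_of_orthonormal G.left_orthonormal _)
  set W := (1 - U * Uᴴ) * L with hW
  set Y := (1 - V * Vᴴ) * R with hY
  set g := gradNorm Q M L R
  set q := energy Q (L * Rᴴ - M) with hqdef
  -- The error is a first-order variation of the product, with `L` varied by `W + U X` and `R`
  -- varied by `Y`, minus a term quadratic in these variations. Paired with `Q N`, the first-order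
  -- terms see exactly the two gradient blocks.
  have hNe : L * Rᴴ - M = (W + U * X) * Rᴴ + L * Yᴴ - (W * Yᴴ + U * X * Yᴴ) := by
    have e1 : W * Rᴴ = (1 - U * Uᴴ) * (L * Rᴴ - M) := by
      rw [Matrix.mul_sub _ (L * Rᴴ), F.left_range, sub_zero, hW, Matrix.mul_assoc]
    have e2 : L * Yᴴ = (L * Rᴴ - M) * (1 - V * Vᴴ) := by
      rw [Matrix.sub_mul (L * Rᴴ), F.right_range, sub_zero, hY, conjTranspose_mul, isHermitian_one_sub,
        Matrix.mul_assoc]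
    have e3 : W * Yᴴ = (1 - U * Uᴴ) * (L * Rᴴ - M) * (1 - V * Vᴴ) := by
      rw [Matrix.mul_sub _ (L * Rᴴ), F.left_range, sub_zero, hW, hY, conjTranspose_mul, isHermitian_one_sub]
      simp only [Matrix.mul_assoc]
    have e4 : U * X * Rᴴ - U * X * Yᴴ = U * (Uᴴ * (L * Rᴴ - M) * V) * Vᴴ := by
      rw [← hX, hY, conjTranspose_mul, isHermitian_one_sub, Matrix.mul_sub, Matrix.mul_one,
        Matrix.mul_sub]
      simp only [Matrix.mul_assoc]
      abel
    have e5 : (W + U * X) * Rᴴ + L * Yᴴ - (W * Yᴴ + U * X * Yᴴ) =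
        W * Rᴴ + L * Yᴴ - W * Yᴴ + (U * X * Rᴴ - U * X * Yᴴ) := by
      rw [Matrix.add_mul]; abel
    rw [e5, e1, e2, e3, e4]
    simp only [Matrix.mul_sub, Matrix.sub_mul, Matrix.one_mul, Matrix.mul_one, Matrix.mul_assoc]
    abel
  have hmain : q ^ 2 ≤ g * (‖W‖ + ‖X‖) + g * ‖Y‖ + h * q * (‖W‖ * ‖Y‖ + ‖X‖ * ‖Y‖) := by
    rw [hqdef, G.energy_sq, G.symm]
    conv_lhs => rw [hNe, frobInner_sub_right, frobInner_add_right, ← hNe]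
    have h1 : frobInner (Q (L * Rᴴ - M)) ((W + U * X) * Rᴴ) ≤ g * (‖W‖ + ‖X‖) := by
      rw [frobInner_mul_right, conjTranspose_conjTranspose]
      refine (frobInner_le _ _).trans (mul_le_mul hx ?_ (norm_nonneg _) ((norm_nonneg _).trans hx))
      refine (norm_add_le _ _).trans ?_
      rw [norm_mul_of_orthonormal G.left_orthonormal]
    have h2 : frobInner (Q (L * Rᴴ - M)) (L * Yᴴ) ≤ g * ‖Y‖ := by
      rw [frobInner_mul_left]
      refine (frobInner_le _ _).trans ?_
      rw [frobenius_norm_conjTranspose]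
      gcongr
    have h3 : -frobInner (Q (L * Rᴴ - M)) (W * Yᴴ + U * X * Yᴴ) ≤
        h * q * (‖W‖ * ‖Y‖ + ‖X‖ * ‖Y‖) := by
      rw [← frobInner_neg_right]
      refine (frobInner_le _ _).trans ?_
      rw [norm_neg]
      refine mul_le_mul hE ?_ (norm_nonneg _) ((norm_nonneg _).trans hE)
      refine (norm_add_le _ _).trans (add_le_add ?_ ?_)
      · refine (frobenius_norm_mul _ _).trans ?_
        rw [frobenius_norm_conjTranspose]
      · refine (frobenius_norm_mul _ _).trans ?_
        rw [frobenius_norm_conjTranspose, norm_mul_of_orthonormal G.left_orthonormal]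
    linarith
  have hg0 : 0 ≤ g := (norm_nonneg _).trans hx
  have hq0 : 0 ≤ q := energy_nonneg _ _
  have hN0 : 0 ≤ ‖L * Rᴴ - M‖ := norm_nonneg _
  set N := ‖L * Rᴴ - M‖
  have hW' : a * ‖W‖ ≤ 1.12 * N := by linarith
  have hY' : a * ‖Y‖ ≤ 1.12 * N := by linarith
  have hX' : a * ‖X‖ ≤ 1.25 * N := by linarith
  -- The quadratic term can only be paired with `Q N` through its norm, which costs `h`; closeness
  -- makes it a small multiple of the error.
  have hWY : a ^ 2 * (h * (‖W‖ * ‖Y‖ + ‖X‖ * ‖Y‖)) ≤ a ^ 2 * (0.0266 * N) := by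
    calc a ^ 2 * (h * (‖W‖ * ‖Y‖ + ‖X‖ * ‖Y‖))
        = h * ((a * ‖W‖) * (a * ‖Y‖) + (a * ‖X‖) * (a * ‖Y‖)) := by ring
      _ ≤ h * ((1.12 * N) * (1.12 * N) + (1.25 * N) * (1.12 * N)) := by gcongr
      _ = 2.6544 * N * (h * N) := by ring
      _ ≤ 2.6544 * N * (1 / 100 * a ^ 2) := by gcongr
      _ ≤ a ^ 2 * (0.0266 * N) := by nlinarith [mul_nonneg (sq_nonneg a) hN0]
  have hWY' : h * (‖W‖ * ‖Y‖ + ‖X‖ * ‖Y‖) ≤ 0.0266 * N :=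
    le_of_mul_le_mul_left hWY (by positivity)
  have h1 : a * q ^ 2 ≤ g * (3.49 * N) + a * (q * (0.0266 * N)) := by
    calc a * q ^ 2 ≤ a * (g * (‖W‖ + ‖X‖) + g * ‖Y‖ + h * q * (‖W‖ * ‖Y‖ + ‖X‖ * ‖Y‖)) := by gcongr
      _ = g * (a * ‖W‖ + a * ‖X‖ + a * ‖Y‖) + a * (q * (h * (‖W‖ * ‖Y‖ + ‖X‖ * ‖Y‖))) := by ring
      _ ≤ g * (3.49 * N) + a * (q * (0.0266 * N)) := by gcongr; linarith
  have h2 : N ≤ q * (10 / 9) := by linarith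
  have h3 : a * q ^ 2 ≤ g * (3.49 * (q * (10 / 9))) + a * (q * (0.0266 * (q * (10 / 9)))) := by
    refine h1.trans ?_
    gcongr
  rcases hq0.eq_or_lt with h0 | h0
  · rw [← h0]; simpa using hg0
  · have h4 : q * (a * q) ≤ q * (3.88 * g + a * (0.03 * q)) := by
      nlinarith [mul_nonneg hg0 hq0, mul_nonneg ha.le (sq_nonneg q)]
    have h5 := le_of_mul_le_mul_left h4 h0
    nlinarith [mul_nonneg ha.le hq0]
end IsNearFactorization
end LocalConvergence
end BlindSR

/-! ### One step of gradient descent, and linear convergence. -/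

namespace BlindSR
open Matrix
section GradientDescent
set_option linter.unusedSectionVars false
variable {m n r : Type*} [Fintype m] [Fintype n] [Fintype r] [DecidableEq m] [DecidableEq n]
  [DecidableEq r]
variable {U : Matrix m r ℂ} {V : Matrix n r ℂ} {Q : Matrix m n ℂ →ₗ[ℝ] Matrix m n ℂ} {h a s : ℝ}
  {M : Matrix m n ℂ} {L : Matrix m r ℂ} {R : Matrix n r ℂ}

theorem normalPart_add (A B : Matrix m n ℂ) :
    normalPart U V (A + B) = normalPart U V A + normalPart U V B := by
  simp only [normalPart, Matrix.mul_add, Matrix.add_mul]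

theorem normalPart_smul (c : ℝ) (A : Matrix m n ℂ) :
    normalPart U V (c • A) = c • normalPart U V A := by
  simp only [normalPart, Matrix.mul_smul, Matrix.smul_mul]

namespace IsNearFactorization

/-- Variations of the form `A Rᴴ` are nearly tangent, because `R` lies almost in the range of `V`;
even `h` times their normal part remains small. This is what keeps the factor `h` out of the step
size. -/
theorem norm_normalPart_mul_right_le (G : IsTangentIsometry U V Q h)
    (F : IsNearFactorization U V M h a s L R) (A : Matrix m r ℂ) :
    h * ‖normalPart U V (A * Rᴴ)‖ ≤ 0.0112 * a * ‖A‖ := by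
  have ha := F.pos
  have hh := G.one_le
  have e : normalPart U V (A * Rᴴ) = (1 - U * Uᴴ) * (A * ((1 - V * Vᴴ) * R)ᴴ) := by
    rw [normalPart, conjTranspose_mul, isHermitian_one_sub]
    simp only [Matrix.mul_assoc]
  have h1 : ‖normalPart U V (A * Rᴴ)‖ ≤ ‖A‖ * ‖(1 - V * Vᴴ) * R‖ := by
    rw [e]
    refine (norm_one_sub_mul_le_of_orthonormal G.left_orthonormal _).trans ?_
    refine (frobenius_norm_mul _ _).trans ?_
    rw [frobenius_norm_conjTranspose]
  have h2 : 0.9 * a * (h * ‖(1 - V * Vᴴ) * R‖) ≤ 1 / 100 * a ^ 2 := by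
    calc _ = h * (0.9 * a * ‖(1 - V * Vᴴ) * R‖) := by ring
      _ ≤ h * ‖L * Rᴴ - M‖ := mul_le_mul_of_nonneg_left (F.norm_right_le G) (by positivity)
      _ ≤ _ := F.close
  have h3 : h * ‖(1 - V * Vᴴ) * R‖ ≤ 0.0112 * a := by
    refine le_of_mul_le_mul_left (h2.trans ?_) (show 0 < 0.9 * a by positivity)
    nlinarith [sq_nonneg a]
  calc h * ‖normalPart U V (A * Rᴴ)‖ ≤ h * (‖A‖ * ‖(1 - V * Vᴴ) * R‖) :=
        mul_le_mul_of_nonneg_left h1 (by positivity)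
    _ = (h * ‖(1 - V * Vᴴ) * R‖) * ‖A‖ := by ring
    _ ≤ _ := mul_le_mul_of_nonneg_right h3 (norm_nonneg _)

theorem norm_normalPart_mul_left_le (G : IsTangentIsometry U V Q h)
    (F : IsNearFactorization U V M h a s L R) (A : Matrix r n ℂ) :
    h * ‖normalPart U V (L * A)‖ ≤ 0.0112 * a * ‖A‖ := by
  have ha := F.pos
  have hh := G.one_le
  have e : normalPart U V (L * A) = ((1 - U * Uᴴ) * L) * A * (1 - V * Vᴴ) := by
    rw [normalPart]
    simp only [Matrix.mul_assoc]
  have h1 : ‖normalPart U V (L * A)‖ ≤ ‖(1 - U * Uᴴ) * L‖ * ‖A‖ := by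
    rw [e]
    exact (norm_mul_one_sub_le_of_orthonormal G.right_orthonormal _).trans (frobenius_norm_mul _ _)
  have h2 : 0.9 * a * (h * ‖(1 - U * Uᴴ) * L‖) ≤ 1 / 100 * a ^ 2 := by
    calc _ = h * (0.9 * a * ‖(1 - U * Uᴴ) * L‖) := by ring
      _ ≤ h * ‖L * Rᴴ - M‖ := mul_le_mul_of_nonneg_left (F.norm_left_le G) (by positivity)
      _ ≤ _ := F.close
  have h3 : h * ‖(1 - U * Uᴴ) * L‖ ≤ 0.0112 * a := by
    refine le_of_mul_le_mul_left (h2.trans ?_) (show 0 < 0.9 * a by positivity)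
    nlinarith [sq_nonneg a]
  calc h * ‖normalPart U V (L * A)‖ ≤ h * (‖(1 - U * Uᴴ) * L‖ * ‖A‖) :=
        mul_le_mul_of_nonneg_left h1 (by positivity)
    _ = (h * ‖(1 - U * Uᴴ) * L‖) * ‖A‖ := by ring
    _ ≤ _ := mul_le_mul_of_nonneg_right h3 (norm_nonneg _)

/-- By symmetry of `Q`, `‖E R‖²` is the form of `Q` at the error and at `E R Rᴴ`. The latter is
nearly tangent, so its energy carries no factor `h`, unlike the direct bound on `‖E‖`. -/
theorem norm_apply_mul_le (G : IsTangentIsometry U V Q h)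
    (F : IsNearFactorization U V M h a s L R) :
    ‖Q (L * Rᴴ - M) * R‖ ≤ 1.2 * s * energy Q (L * Rᴴ - M) := by
  have ha := F.pos
  have has := F.le
  have hs : 0 < s := ha.trans_le has
  set E := Q (L * Rᴴ - M) with hE
  set q := energy Q (L * Rᴴ - M)
  have hq0 : 0 ≤ q := energy_nonneg _ _
  have h1 : ‖E * R‖ ^ 2 ≤ q * energy Q (E * R * Rᴴ) := by
    rw [← frobInner_self, ← conjTranspose_conjTranspose R, ← frobInner_mul_right,
      conjTranspose_conjTranspose, hE, ← G.symm]
    exact G.frobInner_le_energy _ _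
  have h2 := G.energy_le_add (E * R * Rᴴ)
  have h3 := F.right_above.norm_mul_conjTranspose_le (by positivity) (E * R)
  have h4 := F.norm_normalPart_mul_right_le G (E * R)
  have h5 : energy Q (E * R * Rᴴ) ≤ 1.2 * s * ‖E * R‖ := by
    have := mul_le_mul_of_nonneg_right has (norm_nonneg (E * R))
    linarith [mul_nonneg hs.le (norm_nonneg (E * R))]
  rcases (norm_nonneg (E * R)).eq_or_lt with h0 | h0
  · rw [← h0]; positivity
  · refine le_of_mul_le_mul_right ?_ h0
    calc ‖E * R‖ * ‖E * R‖ = ‖E * R‖ ^ 2 := by ring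
      _ ≤ q * (1.2 * s * ‖E * R‖) := h1.trans (mul_le_mul_of_nonneg_left h5 hq0)
      _ = _ := by ring

theorem norm_mul_apply_le (G : IsTangentIsometry U V Q h)
    (F : IsNearFactorization U V M h a s L R) :
    ‖Lᴴ * Q (L * Rᴴ - M)‖ ≤ 1.2 * s * energy Q (L * Rᴴ - M) := by
  have ha := F.pos
  have has := F.le
  have hs : 0 < s := ha.trans_le has
  set E := Q (L * Rᴴ - M) with hE
  set q := energy Q (L * Rᴴ - M)
  have hq0 : 0 ≤ q := energy_nonneg _ _
  have h1 : ‖Lᴴ * E‖ ^ 2 ≤ q * energy Q (L * (Lᴴ * E)) := by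
    rw [← frobInner_self, ← frobInner_mul_left, hE, ← G.symm]
    exact G.frobInner_le_energy _ _
  have h2 := G.energy_le_add (L * (Lᴴ * E))
  have h3 := F.left_above.norm_mul_le (by positivity) (Lᴴ * E)
  have h4 := F.norm_normalPart_mul_left_le G (Lᴴ * E)
  have h5 : energy Q (L * (Lᴴ * E)) ≤ 1.2 * s * ‖Lᴴ * E‖ := by
    have := mul_le_mul_of_nonneg_right has (norm_nonneg (Lᴴ * E))
    linarith [mul_nonneg hs.le (norm_nonneg (Lᴴ * E))]
  rcases (norm_nonneg (Lᴴ * E)).eq_or_lt with h0 | h0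
  · rw [← h0]; positivity
  · refine le_of_mul_le_mul_right ?_ h0
    calc ‖Lᴴ * E‖ * ‖Lᴴ * E‖ = ‖Lᴴ * E‖ ^ 2 := by ring
      _ ≤ q * (1.2 * s * ‖Lᴴ * E‖) := h1.trans (mul_le_mul_of_nonneg_left h5 hq0)
      _ = _ := by ring

theorem gradNorm_le (G : IsTangentIsometry U V Q h)
    (F : IsNearFactorization U V M h a s L R) :
    gradNorm Q M L R ≤ 1.9 * s * ‖L * Rᴴ - M‖ := by
  have hs : 0 < s := F.pos.trans_le F.le
  have h1 := F.norm_apply_mul_le G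
  have h2 := F.norm_mul_apply_le G
  have h3 := F.energy_le G
  set N := ‖L * Rᴴ - M‖
  have hN0 : 0 ≤ N := norm_nonneg _
  have h4 : 1.2 * s * energy Q (L * Rᴴ - M) ≤ 1.32 * s * N := by
    nlinarith
  have hg0 : 0 ≤ gradNorm Q M L R := Real.sqrt_nonneg _
  refine (sq_le_sq₀ hg0 (by positivity)).1 ?_
  rw [gradNorm_sq]
  calc _ ≤ (1.32 * s * N) ^ 2 + (1.32 * s * N) ^ 2 :=
        add_le_add (pow_le_pow_left₀ (norm_nonneg _) (h1.trans h4) 2)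
          (pow_le_pow_left₀ (norm_nonneg _) (h2.trans h4) 2)
    _ ≤ _ := by nlinarith [sq_nonneg (s * N)]

/-- The increment of `L * Rᴴ` in one step of gradient descent. -/
noncomputable def increment (Q : Matrix m n ℂ →ₗ[ℝ] Matrix m n ℂ) (M : Matrix m n ℂ)
    (L : Matrix m r ℂ) (R : Matrix n r ℂ) (η : ℝ) : Matrix m n ℂ :=
  (-η) • (Q (L * Rᴴ - M) * R * Rᴴ) + (-η) • (L * (Lᴴ * Q (L * Rᴴ - M))) +
    η ^ 2 • (Q (L * Rᴴ - M) * R * (Lᴴ * Q (L * Rᴴ - M)))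

theorem step_eq_add_increment (Q : Matrix m n ℂ →ₗ[ℝ] Matrix m n ℂ) (M : Matrix m n ℂ)
    (L : Matrix m r ℂ) (R : Matrix n r ℂ) (η : ℝ) :
    (L - η • (Q (L * Rᴴ - M) * R)) * (R - η • ((Q (L * Rᴴ - M))ᴴ * L))ᴴ - M =
      (L * Rᴴ - M) + increment Q M L R η := by
  have e : (R - η • ((Q (L * Rᴴ - M))ᴴ * L))ᴴ = Rᴴ - η • (Lᴴ * Q (L * Rᴴ - M)) := by
    rw [conjTranspose_sub, conjTranspose_smul, conjTranspose_mul, conjTranspose_conjTranspose]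
    simp
  rw [e, increment]
  simp only [Matrix.sub_mul, Matrix.mul_sub, Matrix.smul_mul, Matrix.mul_smul, smul_sub, smul_smul,
    neg_smul, sq]
  abel

variable {η : ℝ}

theorem gradNorm_mul_half_le (Q : Matrix m n ℂ →ₗ[ℝ] Matrix m n ℂ) (M : Matrix m n ℂ)
    (L : Matrix m r ℂ) (R : Matrix n r ℂ) :
    ‖Q (L * Rᴴ - M) * R‖ * ‖Lᴴ * Q (L * Rᴴ - M)‖ ≤ gradNorm Q M L R ^ 2 / 2 := by
  rw [gradNorm_sq]
  nlinarith [sq_nonneg (‖Q (L * Rᴴ - M) * R‖ - ‖Lᴴ * Q (L * Rᴴ - M)‖)]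

theorem norm_add_norm_le (Q : Matrix m n ℂ →ₗ[ℝ] Matrix m n ℂ) (M : Matrix m n ℂ)
    (L : Matrix m r ℂ) (R : Matrix n r ℂ) :
    ‖Q (L * Rᴴ - M) * R‖ + ‖Lᴴ * Q (L * Rᴴ - M)‖ ≤ 1.42 * gradNorm Q M L R := by
  have h := gradNorm_sq Q M L R
  have h0 : 0 ≤ gradNorm Q M L R := Real.sqrt_nonneg _
  refine (sq_le_sq₀ (by positivity) (by positivity)).1 ?_
  nlinarith [sq_nonneg (‖Q (L * Rᴴ - M) * R‖ - ‖Lᴴ * Q (L * Rᴴ - M)‖)]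

/-- Makes the term of the increment that is quadratic in `η` negligible, even when multiplied by
`h`. -/
theorem scaled_gradNorm_le (G : IsTangentIsometry U V Q h)
    (F : IsNearFactorization U V M h a s L R) (hη : 0 ≤ η) (hηs : η * s ^ 2 ≤ 1 / 25) :
    h * (η * gradNorm Q M L R) ≤ 0.001 * s := by
  have ha := F.pos
  have hs : 0 < s := ha.trans_le F.le
  have hh := G.one_le
  have has : a ^ 2 ≤ s ^ 2 := pow_le_pow_left₀ ha.le F.le 2
  calc h * (η * gradNorm Q M L R) ≤ h * (η * (1.9 * s * ‖L * Rᴴ - M‖)) := by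
        gcongr; exact F.gradNorm_le G
    _ = 1.9 * s * η * (h * ‖L * Rᴴ - M‖) := by ring
    _ ≤ 1.9 * s * η * (1 / 100 * s ^ 2) := by
        refine mul_le_mul_of_nonneg_left (F.close.trans ?_) (by positivity)
        linarith
    _ = 0.019 * s * (η * s ^ 2) := by ring
    _ ≤ 0.019 * s * (1 / 25) := by gcongr
    _ ≤ _ := by linarith

theorem norm_increment_le (G : IsTangentIsometry U V Q h)
    (F : IsNearFactorization U V M h a s L R) (hη : 0 ≤ η) (hηs : η * s ^ 2 ≤ 1 / 25) :
    ‖increment Q M L R η‖ ≤ 1.57 * (η * s * gradNorm Q M L R) := by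
  have ha := F.pos
  have hs : 0 < s := ha.trans_le F.le
  have hh := G.one_le
  have h1 := F.right_above.norm_mul_conjTranspose_le (by positivity) (Q (L * Rᴴ - M) * R)
  have h2 := F.left_above.norm_mul_le (by positivity) (Lᴴ * Q (L * Rᴴ - M))
  have h3 := (frobenius_norm_mul (Q (L * Rᴴ - M) * R) (Lᴴ * Q (L * Rᴴ - M))).trans
    (gradNorm_mul_half_le Q M L R)
  have h4 := norm_add_norm_le Q M L R
  have h5 := F.scaled_gradNorm_le G hη hηs
  have hg0 : 0 ≤ gradNorm Q M L R := Real.sqrt_nonneg _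
  have h6 : η * gradNorm Q M L R ≤ 0.001 * s :=
    (le_mul_of_one_le_left (by positivity) hh).trans h5
  rw [increment]
  refine (norm_add_le _ _).trans ((add_le_add_left (norm_add_le _ _) _).trans ?_)
  rw [norm_smul, norm_smul, norm_smul, norm_neg, Real.norm_of_nonneg hη,
    Real.norm_of_nonneg (by positivity)]
  set g := gradNorm Q M L R
  calc _ ≤ η * (1.1 * s * ‖Q (L * Rᴴ - M) * R‖) + η * (1.1 * s * ‖Lᴴ * Q (L * Rᴴ - M)‖) +
          η ^ 2 * (g ^ 2 / 2) := by gcongr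
    _ = η * (1.1 * s) * (‖Q (L * Rᴴ - M) * R‖ + ‖Lᴴ * Q (L * Rᴴ - M)‖) +
          (η * g) * (η * g) / 2 := by ring
    _ ≤ η * (1.1 * s) * (1.42 * g) + (0.001 * s) * (η * g) / 2 := by gcongr
    _ ≤ _ := by nlinarith [mul_nonneg (mul_nonneg hη hs.le) hg0]

/-- The first-order part of the increment is nearly tangent and the `η²` part is tiny, so the energy
of the increment is bounded like its norm, without the factor `h`. -/
theorem energy_increment_le (G : IsTangentIsometry U V Q h)
    (F : IsNearFactorization U V M h a s L R) (hη : 0 ≤ η) (hηs : η * s ^ 2 ≤ 1 / 25) :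
    energy Q (increment Q M L R η) ≤ 1.7 * (η * s * gradNorm Q M L R) := by
  have ha := F.pos
  have has := F.le
  have hs : 0 < s := ha.trans_le F.le
  have hh := G.one_le
  have h0 := F.norm_increment_le G hη hηs
  have h1 := F.norm_normalPart_mul_right_le G (Q (L * Rᴴ - M) * R)
  have h2 := F.norm_normalPart_mul_left_le G (Lᴴ * Q (L * Rᴴ - M))
  have h3 := (G.norm_normalPart_le (Q (L * Rᴴ - M) * R * (Lᴴ * Q (L * Rᴴ - M)))).trans
    ((frobenius_norm_mul (Q (L * Rᴴ - M) * R) (Lᴴ * Q (L * Rᴴ - M))).trans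
    (gradNorm_mul_half_le Q M L R))
  have h4 := norm_add_norm_le Q M L R
  have h5 := F.scaled_gradNorm_le G hη hηs
  have hg0 : 0 ≤ gradNorm Q M L R := Real.sqrt_nonneg _
  have h7 : h * ‖normalPart U V (increment Q M L R η)‖ ≤ 0.02 * (η * s * gradNorm Q M L R) := by
    rw [increment, normalPart_add, normalPart_add, normalPart_smul, normalPart_smul,
      normalPart_smul]
    refine (mul_le_mul_of_nonneg_left ((norm_add_le _ _).trans
      (add_le_add_left (norm_add_le _ _) _)) (by positivity)).trans ?_
    rw [norm_smul, norm_smul, norm_smul, norm_neg, Real.norm_of_nonneg hη,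
      Real.norm_of_nonneg (by positivity)]
    set g := gradNorm Q M L R
    calc _ = η * (h * ‖normalPart U V (Q (L * Rᴴ - M) * R * Rᴴ)‖) +
          η * (h * ‖normalPart U V (L * (Lᴴ * Q (L * Rᴴ - M)))‖) +
          h * η ^ 2 * ‖normalPart U V (Q (L * Rᴴ - M) * R * (Lᴴ * Q (L * Rᴴ - M)))‖ := by ring
      _ ≤ η * (0.0112 * a * ‖Q (L * Rᴴ - M) * R‖) + η * (0.0112 * a * ‖Lᴴ * Q (L * Rᴴ - M)‖) +
          h * η ^ 2 * (g ^ 2 / 2) := by gcongr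
      _ = η * (0.0112 * a) * (‖Q (L * Rᴴ - M) * R‖ + ‖Lᴴ * Q (L * Rᴴ - M)‖) +
          (h * (η * g)) * (η * g) / 2 := by ring
      _ ≤ η * (0.0112 * s) * (1.42 * g) + (0.001 * s) * (η * g) / 2 := by gcongr
      _ ≤ _ := by nlinarith [mul_nonneg (mul_nonneg hη hs.le) hg0]
  have h8 := G.energy_le_add (increment Q M L R η)
  have : 0 ≤ η * s * gradNorm Q M L R := by positivity
  linarith

/-- One step of gradient descent decreases the energy of the error. -/
theorem energy_step_le (G : IsTangentIsometry U V Q h)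
    (F : IsNearFactorization U V M h a s L R) (hη : 0 ≤ η) (hηs : η * s ^ 2 ≤ 1 / 25) :
    energy Q ((L * Rᴴ - M) + increment Q M L R η) ^ 2 ≤
      energy Q (L * Rᴴ - M) ^ 2 - η * gradNorm Q M L R ^ 2 := by
  have ha := F.pos
  have has := F.le
  have hs : 0 < s := ha.trans_le F.le
  have hh := G.one_le
  have h1 := F.energy_increment_le G hη hηs
  have h2 : ‖Q (L * Rᴴ - M)‖ ≤ 0.011 * s ^ 2 := by
    calc ‖Q (L * Rᴴ - M)‖ ≤ h * energy Q (L * Rᴴ - M) := G.norm_apply_le _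
      _ ≤ h * (1.1 * ‖L * Rᴴ - M‖) := mul_le_mul_of_nonneg_left (F.energy_le G) (by positivity)
      _ = 1.1 * (h * ‖L * Rᴴ - M‖) := by ring
      _ ≤ 1.1 * (1 / 100 * a ^ 2) := mul_le_mul_of_nonneg_left F.close (by norm_num)
      _ ≤ _ := by nlinarith
  have hg0 : 0 ≤ gradNorm Q M L R := Real.sqrt_nonneg _
  -- Against the first-order part of the increment, the pairing is exactly `-η` times the squared
  -- gradient norm; only the `η²` term needs an estimate.
  have h3 : frobInner (Q (L * Rᴴ - M)) (increment Q M L R η) ≤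
      -η * gradNorm Q M L R ^ 2 + η ^ 2 * (0.011 * s ^ 2 * (gradNorm Q M L R ^ 2 / 2)) := by
    rw [increment, frobInner_add_right, frobInner_add_right, frobInner_smul_right,
      frobInner_smul_right, frobInner_smul_right, frobInner_mul_right, conjTranspose_conjTranspose,
      frobInner_self, frobInner_mul_left (Q (L * Rᴴ - M)) L, frobInner_self]
    have h4 := frobInner_le (Q (L * Rᴴ - M)) (Q (L * Rᴴ - M) * R * (Lᴴ * Q (L * Rᴴ - M)))
    have h5 : frobInner (Q (L * Rᴴ - M)) (Q (L * Rᴴ - M) * R * (Lᴴ * Q (L * Rᴴ - M))) ≤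
        0.011 * s ^ 2 * (gradNorm Q M L R ^ 2 / 2) := h4.trans
      (mul_le_mul h2 ((frobenius_norm_mul _ _).trans (gradNorm_mul_half_le Q M L R))
        (norm_nonneg _) (by positivity))
    have h6 := mul_le_mul_of_nonneg_left h5 (sq_nonneg η)
    have h7 := gradNorm_sq Q M L R
    nlinarith
  rw [G.energy_add_sq]
  set g := gradNorm Q M L R
  have h8 : energy Q (increment Q M L R η) ^ 2 ≤ (1.7 * (η * s * g)) ^ 2 :=
    pow_le_pow_left₀ (energy_nonneg _ _) h1 2
  have h9 : η ^ 2 * s ^ 2 * g ^ 2 ≤ 1 / 25 * (η * g ^ 2) := by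
    calc _ = η * s ^ 2 * (η * g ^ 2) := by ring
      _ ≤ _ := by gcongr
  have h10 : 0 ≤ η * g ^ 2 := by positivity
  -- Of the decrease `2 η g²`, the quadratic terms consume at most `(0.011 + 1.7²)/25 · η g²`, so
  -- more than `η g²` remains.
  nlinarith

theorem norm_step_le (G : IsTangentIsometry U V Q h)
    (F : IsNearFactorization U V M h a s L R) (hη : 0 ≤ η) (hηs : η * s ^ 2 ≤ 1 / 25) :
    ‖(L * Rᴴ - M) + increment Q M L R η‖ ≤ 1.2 * ‖L * Rᴴ - M‖ := by
  have hs : 0 < s := F.pos.trans_le F.le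
  have h1 := F.norm_increment_le G hη hηs
  have h2 := F.gradNorm_le G
  have h3 : η * s * gradNorm Q M L R ≤ 1.9 / 25 * ‖L * Rᴴ - M‖ := by
    calc η * s * gradNorm Q M L R ≤ η * s * (1.9 * s * ‖L * Rᴴ - M‖) :=
          mul_le_mul_of_nonneg_left h2 (by positivity)
      _ = η * s ^ 2 * (1.9 * ‖L * Rᴴ - M‖) := by ring
      _ ≤ 1 / 25 * (1.9 * ‖L * Rᴴ - M‖) := mul_le_mul_of_nonneg_right hηs (by positivity)
      _ = _ := by ring
  linarith [norm_add_le (L * Rᴴ - M) (increment Q M L R η), norm_nonneg (L * Rᴴ - M)]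

/-- The Łojasiewicz length argument: with `q` the old and `q'` the new energy, `η g² ≤ q² - q'² ≤
2q(q - q')`, and `g ≥ 0.2 a q` allows division by `q`. The right side telescopes, so the total
length of the trajectory is controlled by the initial energy. -/
theorem step_size_mul_gradNorm_le (G : IsTangentIsometry U V Q h)
    (F : IsNearFactorization U V M h a s L R) (hη : 0 < η) (hηs : η * s ^ 2 ≤ 1 / 25) :
    η * gradNorm Q M L R ≤ 10 / a *
      (energy Q (L * Rᴴ - M) - energy Q ((L * Rᴴ - M) + increment Q M L R η)) := by
  have ha := F.pos
  have h1 := F.energy_step_le G hη.le hηs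
  have h2 := F.energy_le_gradNorm G
  have hq0 := energy_nonneg Q (L * Rᴴ - M)
  have hq0' := energy_nonneg Q ((L * Rᴴ - M) + increment Q M L R η)
  have hg0 : 0 ≤ gradNorm Q M L R := Real.sqrt_nonneg _
  set q := energy Q (L * Rᴴ - M)
  set q' := energy Q ((L * Rᴴ - M) + increment Q M L R η)
  set g := gradNorm Q M L R
  have hle : q' ≤ q := (sq_le_sq₀ hq0' hq0).1 (by
    have : 0 ≤ η * g ^ 2 := by positivity
    linarith)
  rw [div_mul_eq_mul_div, le_div_iff₀ ha]
  rcases hq0.eq_or_lt with h0 | h0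
  · have hq' : q' = 0 := le_antisymm (h0 ▸ hle) hq0'
    rw [← h0, hq'] at h1 ⊢
    have h3 : g = 0 := by
      have h4 : η * g ^ 2 ≤ 0 := by nlinarith
      have h5 : g ^ 2 ≤ 0 := by
        by_contra h6
        push Not at h6
        have := mul_pos hη h6
        linarith
      nlinarith
    rw [h3]; simp
  · refine le_of_mul_le_mul_left ?_ (show 0 < 0.2 * q by positivity)
    have h3 : 0.2 * q * (η * g * a) ≤ η * g ^ 2 := by
      calc 0.2 * q * (η * g * a) = η * g * (0.2 * a * q) := by ring
        _ ≤ η * g * g := by gcongr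
        _ = _ := by ring
    nlinarith [mul_nonneg (sub_nonneg.2 hle) (sub_nonneg.2 hle)]

end IsNearFactorization

set_option maxHeartbeats 1000000 in
open IsNearFactorization in
/-- Linear convergence of vanilla gradient descent from a balanced initialization close to the
ground truth. -/
theorem gradientDescent_converges (G : IsTangentIsometry U V Q h) (ha : 0 < a) (has : a ≤ s)
    (hMU : (1 - U * Uᴴ) * M = 0) (hMV : M * (1 - V * Vᴴ) = 0) {η : ℝ} (hη : 0 < η)
    (hηs : η * s ^ 2 ≤ 1 / 25) {Z : ℕ → Matrix m r ℂ × Matrix n r ℂ}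
    (hZ : ∀ k, Z (k + 1) =
      ((Z k).1 - η • (Q ((Z k).1 * (Z k).2ᴴ - M) * (Z k).2),
        (Z k).2 - η • ((Q ((Z k).1 * (Z k).2ᴴ - M))ᴴ * (Z k).1)))
    (hLb : IsBoundedBelow (Z 0).1 (0.95 * a)) (hRb : IsBoundedBelow (Z 0).2 (0.95 * a))
    (hLa : IsBoundedAbove (Z 0).1 (1.05 * s)) (hRa : IsBoundedAbove (Z 0).2 (1.05 * s))
    (hclose : h * ‖(Z 0).1 * (Z 0).2ᴴ - M‖ ≤ 1 / 1000 * a ^ 2) (k : ℕ) :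
    ‖(Z k).1 * (Z k).2ᴴ - M‖ ^ 2 ≤ (1 - η * a ^ 2 / 28) ^ k * (a ^ 2) ^ 2 := by
  have hs : 0 < s := ha.trans_le has
  have hh := G.one_le
  have hF0 : IsNearFactorization U V M h a s (Z 0).1 (Z 0).2 :=
    ⟨ha, has, hMU, hMV, hLb.mono (by linarith), hRb.mono (by linarith), hLa.mono (by linarith),
      hRa.mono (by linarith), hclose.trans (by nlinarith [sq_nonneg a])⟩
  set q : ℕ → ℝ := fun k => energy Q ((Z k).1 * (Z k).2ᴴ - M) with hq
  have hqnn : ∀ k, 0 ≤ q k := fun k => energy_nonneg _ _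
  have hhq0 : h * q 0 ≤ 0.0011 * a ^ 2 := by
    have := mul_le_mul_of_nonneg_left (hF0.energy_le G) (show 0 ≤ h by linarith)
    linarith
  have hq0 : q 0 ≤ 0.0011 * a ^ 2 := (le_mul_of_one_le_left (hqnn 0) hh).trans hhq0
  have hρ : 0 ≤ 1 - η * a ^ 2 / 28 := by
    have : η * a ^ 2 ≤ η * s ^ 2 := by gcongr
    linarith
  have hdrift : 10 / a * q 0 ≤ 0.011 * a := by
    rw [div_mul_eq_mul_div, div_le_iff₀ ha]; nlinarith
  -- The invariant carries the distance travelled, bounded by the energy already spent. Closeness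
  -- alone would not prevent `L` and `R` from drifting into an ill-conditioned pair with the same
  -- product.
  have key : ∀ k, IsNearFactorization U V M h a s (Z k).1 (Z k).2 ∧
      q k ^ 2 ≤ (1 - η * a ^ 2 / 28) ^ k * q 0 ^ 2 ∧ q k ≤ q 0 ∧
      ‖(Z k).1 - (Z 0).1‖ ≤ 10 / a * (q 0 - q k) ∧ ‖(Z k).2 - (Z 0).2‖ ≤ 10 / a * (q 0 - q k) := by
    intro k
    induction k with
    | zero => exact ⟨hF0, by simp, le_rfl, by simp, by simp⟩
    | succ k ih =>
      obtain ⟨F, h1, h2, h3, h4⟩ := ih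
      have e1 : (Z (k + 1)).1 * (Z (k + 1)).2ᴴ - M = ((Z k).1 * (Z k).2ᴴ - M) +
          increment Q M (Z k).1 (Z k).2 η := by
        rw [hZ k]; exact step_eq_add_increment Q M _ _ η
      have hstep := F.energy_step_le G hη.le hηs
      have hpl := F.energy_le_gradNorm G
      have hmove := F.step_size_mul_gradNorm_le G hη hηs
      have hnorm := F.norm_step_le G hη.le hηs
      have hlow := F.le_energy G
      rw [← e1] at hstep hmove hnorm
      change q (k + 1) ^ 2 ≤ q k ^ 2 - _ at hstep
      change _ * q k ≤ _ at hpl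
      change _ ≤ _ * (q k - q (k + 1)) at hmove
      change _ ≤ q k at hlow
      have hx := norm_apply_mul_le_gradNorm Q M (Z k).1 (Z k).2
      have hy := norm_mul_apply_le_gradNorm Q M (Z k).1 (Z k).2
      have hg0 : 0 ≤ gradNorm Q M (Z k).1 (Z k).2 := Real.sqrt_nonneg _
      set g := gradNorm Q M (Z k).1 (Z k).2
      have hdec : q (k + 1) ≤ q k := (sq_le_sq₀ (hqnn _) (hqnn _)).1 (by
        have : 0 ≤ η * g ^ 2 := by positivity
        linarith)
      -- The gradient inequality yields the contraction `1 - 0.04 η a²`, and `0.04 ≥ 1/28`.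
      have hrate : q (k + 1) ^ 2 ≤ (1 - η * a ^ 2 / 28) * q k ^ 2 := by
        have h5 : (0.2 * a * q k) ^ 2 ≤ g ^ 2 :=
          pow_le_pow_left₀ (mul_nonneg (by positivity) (hqnn k)) hpl 2
        have h6 := mul_le_mul_of_nonneg_left h5 hη.le
        have h7 : 0 ≤ η * a ^ 2 * q k ^ 2 := by positivity
        have e3 : η * (0.2 * a * q k) ^ 2 = 0.04 * (η * a ^ 2 * q k ^ 2) := by ring
        have e4 : (1 - η * a ^ 2 / 28) * q k ^ 2 = q k ^ 2 - η * a ^ 2 * q k ^ 2 / 28 := by ring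
        rw [e3] at h6
        rw [e4]
        linarith
      have hL : ‖(Z (k + 1)).1 - (Z 0).1‖ ≤ 10 / a * (q 0 - q (k + 1)) := by
        have e : (Z (k + 1)).1 - (Z 0).1 = ((Z k).1 - (Z 0).1) +
            -(η • (Q ((Z k).1 * (Z k).2ᴴ - M) * (Z k).2)) := by
          rw [hZ k]; exact (sub_right_comm _ _ _).trans (sub_eq_add_neg _ _)
        rw [e]
        refine (norm_add_le _ _).trans ?_
        rw [norm_neg, norm_smul, Real.norm_of_nonneg hη.le]
        have := mul_le_mul_of_nonneg_left hx hη.le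
        linarith
      have hR : ‖(Z (k + 1)).2 - (Z 0).2‖ ≤ 10 / a * (q 0 - q (k + 1)) := by
        have e : (Z (k + 1)).2 - (Z 0).2 = ((Z k).2 - (Z 0).2) +
            -(η • ((Q ((Z k).1 * (Z k).2ᴴ - M))ᴴ * (Z k).1)) := by
          rw [hZ k]; exact (sub_right_comm _ _ _).trans (sub_eq_add_neg _ _)
        have e2 : ‖(Q ((Z k).1 * (Z k).2ᴴ - M))ᴴ * (Z k).1‖ =
            ‖(Z k).1ᴴ * Q ((Z k).1 * (Z k).2ᴴ - M)‖ := by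
          rw [← frobenius_norm_conjTranspose, conjTranspose_mul, conjTranspose_conjTranspose]
        rw [e]
        refine (norm_add_le _ _).trans ?_
        rw [norm_neg, norm_smul, Real.norm_of_nonneg hη.le, e2]
        have := mul_le_mul_of_nonneg_left hy hη.le
        linarith
      have hd : 10 / a * (q 0 - q (k + 1)) ≤ 0.011 * a := by
        refine le_trans ?_ hdrift
        have := hqnn (k + 1)
        gcongr
        linarith
      -- The drift of at most `0.011 a` fits in the gap between the initial conditioning constants
      -- `0.95`, `1.05` and the required `0.9`, `1.1`.
      refine ⟨⟨ha, has, hMU, hMV, (hLb.of_norm_sub_le (hL.trans hd)).mono (by linarith),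
        (hRb.of_norm_sub_le (hR.trans hd)).mono (by linarith),
        (hLa.of_norm_sub_le (hL.trans hd)).mono (by linarith),
        (hRa.of_norm_sub_le (hR.trans hd)).mono (by linarith), ?_⟩, ?_, hdec.trans h2, hL, hR⟩
      -- Energy and norm may not be compared at step `k + 1` before closeness is known there. The
      -- new norm is at most `1.2` times the old one, which is compared with `q k ≤ q 0`, so the
      -- loss does not accumulate over steps.
      · rw [e1]
        rw [e1] at hnorm
        have h5 : h * ‖(Z k).1 * (Z k).2ᴴ - M‖ ≤ h * (10 / 9 * q 0) := by
          gcongr; linarith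
        have h6 := mul_le_mul_of_nonneg_left hnorm (show 0 ≤ h by linarith)
        linarith [sq_nonneg a]
      · rw [pow_succ]
        calc q (k + 1) ^ 2 ≤ (1 - η * a ^ 2 / 28) * q k ^ 2 := hrate
          _ ≤ (1 - η * a ^ 2 / 28) * ((1 - η * a ^ 2 / 28) ^ k * q 0 ^ 2) := by gcongr
          _ = _ := by ring
  obtain ⟨F, h1, -, -, -⟩ := key k
  have h2 : 0.9 * ‖(Z k).1 * (Z k).2ᴴ - M‖ ≤ q k := F.le_energy G
  have h3 : (0.9 * ‖(Z k).1 * (Z k).2ᴴ - M‖) ^ 2 ≤ q k ^ 2 :=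
    pow_le_pow_left₀ (by positivity) h2 2
  have h4 : q 0 ^ 2 ≤ (0.0011 * a ^ 2) ^ 2 := pow_le_pow_left₀ (hqnn 0) hq0 2
  have h5 : (1 - η * a ^ 2 / 28) ^ k * q 0 ^ 2 ≤
      (1 - η * a ^ 2 / 28) ^ k * (0.0011 * a ^ 2) ^ 2 :=
    mul_le_mul_of_nonneg_left h4 (pow_nonneg hρ k)
  have h6 : 0 ≤ (1 - η * a ^ 2 / 28) ^ k * (a ^ 2) ^ 2 :=
    mul_nonneg (pow_nonneg hρ k) (sq_nonneg _)
  have e3 : (0.9 * ‖(Z k).1 * (Z k).2ᴴ - M‖) ^ 2 = 0.81 * ‖(Z k).1 * (Z k).2ᴴ - M‖ ^ 2 := by ring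
  have e4 : (1 - η * a ^ 2 / 28) ^ k * (0.0011 * a ^ 2) ^ 2 =
      0.00000121 * ((1 - η * a ^ 2 / 28) ^ k * (a ^ 2) ^ 2) := by ring
  rw [e3] at h3
  rw [e4] at h5
  linarith

end GradientDescent
end BlindSR

/-! ### Spectral initialization: Weyl bounds and truncated singular value decompositions. -/

namespace BlindSR
open Matrix
section SpectralInitialization
set_option linter.unusedSectionVars false
variable {m n : Type*} [Fintype m] [Fintype n] {p r : ℕ}

theorem norm_diagonal_mul_sq {k : Type*} [Fintype k] [DecidableEq k] (τ : k → ℝ)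
    (x : Matrix k (Fin 1) ℂ) :
    ‖diagonal (fun i => (τ i : ℂ)) * x‖ ^ 2 = ∑ i, τ i ^ 2 * ‖x i 0‖ ^ 2 := by
  simp [frobenius_norm_sq, mul_pow]

theorem norm_vector_sq {k : Type*} [Fintype k] (x : Matrix k (Fin 1) ℂ) :
    ‖x‖ ^ 2 = ∑ i, ‖x i 0‖ ^ 2 := by
  simp [frobenius_norm_sq]

theorem isBoundedAbove_mul_diagonal_mul {U : Matrix m (Fin p) ℂ} {V : Matrix n (Fin p) ℂ}
    (hU : Uᴴ * U = 1) (hV : Vᴴ * V = 1) {τ : Fin p → ℝ} {c : ℝ} (hτ : ∀ i, |τ i| ≤ c) (hc : 0 ≤ c) :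
    IsBoundedAbove (U * diagonal (fun i => (τ i : ℂ)) * Vᴴ) c := by
  intro x
  rw [Matrix.mul_assoc, Matrix.mul_assoc, norm_mul_of_orthonormal hU]
  refine le_trans ?_ (mul_le_mul_of_nonneg_left (norm_conjTranspose_mul_le_of_orthonormal hV x) hc)
  refine (sq_le_sq₀ (norm_nonneg _) (by positivity)).1 ?_
  rw [norm_diagonal_mul_sq, mul_pow, norm_vector_sq, Finset.mul_sum]
  refine Finset.sum_le_sum fun i _ => ?_
  have : τ i ^ 2 ≤ c ^ 2 := sq_le_sq' (by linarith [(abs_le.1 (hτ i)).1]) (abs_le.1 (hτ i)).2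
  gcongr

theorem isBoundedAbove_mul_diagonal {U : Matrix m (Fin p) ℂ} (hU : Uᴴ * U = 1) {τ : Fin p → ℝ}
    {c : ℝ} (hτ : ∀ i, |τ i| ≤ c) (hc : 0 ≤ c) :
    IsBoundedAbove (U * diagonal (fun i => (τ i : ℂ))) c := by
  have h := isBoundedAbove_mul_diagonal_mul hU (V := (1 : Matrix (Fin p) (Fin p) ℂ)) (by simp) hτ hc
  simpa using h

theorem isBoundedBelow_mul_diagonal {U : Matrix m (Fin p) ℂ} (hU : Uᴴ * U = 1) {τ : Fin p → ℝ}
    {c : ℝ} (hτ : ∀ i, c ≤ τ i) (hc : 0 ≤ c) :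
    IsBoundedBelow (U * diagonal (fun i => (τ i : ℂ))) c := by
  intro x
  rw [Matrix.mul_assoc, norm_mul_of_orthonormal hU]
  refine (sq_le_sq₀ (by positivity) (norm_nonneg _)).1 ?_
  rw [norm_diagonal_mul_sq, mul_pow, norm_vector_sq, Finset.mul_sum]
  refine Finset.sum_le_sum fun i _ => ?_
  have : c ^ 2 ≤ τ i ^ 2 := pow_le_pow_left₀ hc (hτ i) 2
  gcongr

/-- An underdetermined homogeneous linear system has a nonzero solution. -/
theorem exists_ne_zero_mul_eq_zero {k l : ℕ} (h : k < l) (A : Matrix (Fin k) (Fin l) ℂ) :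
    ∃ y : Matrix (Fin l) (Fin 1) ℂ, y ≠ 0 ∧ A * y = 0 := by
  have hker : LinearMap.ker A.mulVecLin ≠ ⊥ := LinearMap.ker_ne_bot_of_finrank_lt (by simpa using h)
  obtain ⟨v, hv, hv0⟩ := (Submodule.ne_bot_iff _).1 hker
  refine ⟨replicateCol (Fin 1) v, ?_, ?_⟩
  · intro h0
    exact hv0 (funext fun i => congrFun (congrFun h0 i) 0)
  · rw [LinearMap.mem_ker, mulVecLin_apply] at hv
    rw [← replicateCol_mulVec, hv]
    rfl

theorem conjTranspose_mul_submatrix_castLE {U : Matrix m (Fin p) ℂ} (hU : Uᴴ * U = 1) (hr : r ≤ p) :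
    (U.submatrix id (Fin.castLE hr))ᴴ * U.submatrix id (Fin.castLE hr) = 1 := by
  have h : (U.submatrix id (Fin.castLE hr))ᴴ * U.submatrix id (Fin.castLE hr) =
      (Uᴴ * U).submatrix (Fin.castLE hr) (Fin.castLE hr) := by
    ext i j
    simp [mul_apply]
  rw [h, hU, submatrix_one _ (Fin.castLE_injective hr)]

theorem truncated_svd_eq (U : Matrix m (Fin p) ℂ) (σ : Fin p → ℝ) (V : Matrix n (Fin p) ℂ)
    (hr : r ≤ p) :
    U.submatrix id (Fin.castLE hr) * diagonal (fun i => (((σ ∘ Fin.castLE hr) i : ℝ) : ℂ)) *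
      (V.submatrix id (Fin.castLE hr))ᴴ =
    U * diagonal (fun i : Fin p => ((if (i : ℕ) < r then σ i else 0 : ℝ) : ℂ)) * Vᴴ := by
  ext i j
  rw [mul_apply, mul_apply]
  refine Finset.sum_of_injOn (Fin.castLE hr) (Fin.castLE_injective hr).injOn (by simp) ?_ ?_
  · intro k _ hk
    have : ¬ (k : ℕ) < r := fun hlt => hk ⟨⟨k, hlt⟩, by simp, by ext; simp⟩
    simp [mul_diagonal, this]
  · intro k _
    simp [mul_diagonal]

variable {M Mhat : Matrix m n ℂ} {U : Matrix m (Fin r) ℂ} {σ : Fin r → ℝ} {V : Matrix n (Fin r) ℂ}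
  {U' : Matrix m (Fin p) ℂ} {σ' : Fin p → ℝ} {V' : Matrix n (Fin p) ℂ} {ν : ℝ}

theorem IsSVD.mul_right_vectors (h : IsSVD M U σ V) :
    M * V = U * diagonal (fun i => (σ i : ℂ)) := by
  rw [h.eq, Matrix.mul_assoc, h.right_orthonormal, Matrix.mul_one]

/-- Upper Weyl bound. -/
theorem singularValue_le (h : IsSVD M U σ V) (h' : IsSVD Mhat U' σ' V')
    (hν : IsBoundedAbove (Mhat - M) ν) {c : ℝ} (hc0 : 0 ≤ c) (hc : ∀ i, σ i ≤ c) (i : Fin p) :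
    σ' i ≤ c + ν := by
  set e : Matrix (Fin p) (Fin 1) ℂ := Matrix.of fun j _ => if j = i then 1 else 0 with he
  have hen : ‖e‖ = 1 := by
    rw [← sq_eq_sq₀ (norm_nonneg _) zero_le_one, norm_vector_sq]
    simp [he, apply_ite]
  have hxn : ‖V' * e‖ = 1 := by rw [norm_mul_of_orthonormal h'.right_orthonormal, hen]
  have h1 : ‖Mhat * (V' * e)‖ = σ' i := by
    rw [← Matrix.mul_assoc, h'.mul_right_vectors, Matrix.mul_assoc,
      norm_mul_of_orthonormal h'.left_orthonormal,
      ← sq_eq_sq₀ (norm_nonneg _) (h'.nonneg i), norm_diagonal_mul_sq]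
    simp [he, apply_ite]
  have h2 := hν (V' * e)
  have h3 : ‖M * (V' * e)‖ ≤ c * ‖V' * e‖ := by
    rw [h.eq]
    exact isBoundedAbove_mul_diagonal_mul h.left_orthonormal h.right_orthonormal
      (fun i => by rw [abs_of_nonneg (h.nonneg i)]; exact hc i) hc0 _
  have h4 : Mhat * (V' * e) = M * (V' * e) + (Mhat - M) * (V' * e) := by
    rw [Matrix.sub_mul]; abel
  rw [hxn] at h2 h3
  rw [← h1, h4]
  linarith [norm_add_le (M * (V' * e)) ((Mhat - M) * (V' * e))]

/-- Lower Weyl bound for the leading `r` singular values. -/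
theorem le_singularValue (h : IsSVD M U σ V) (h' : IsSVD Mhat U' σ' V')
    (hν : IsBoundedAbove (Mhat - M) ν) {c : ℝ} (hc0 : 0 ≤ c) (hc : ∀ i, c ≤ σ i) (i : Fin p)
    (hi : (i : ℕ) < r) : c - ν ≤ σ' i := by
  -- Courant–Fischer: among the `r` right singular directions of `M` there is one orthogonal to the
  -- first `i < r` right singular vectors of `Mhat`. On it `Mhat` stretches by at most `σ' i`, while
  -- `M` stretches by at least `c`.
  obtain ⟨y, hy0, hy⟩ := exists_ne_zero_mul_eq_zero hi
    ((V'.submatrix id (Fin.castLE i.2.le))ᴴ * V)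
  have hz : ∀ j : Fin p, (j : ℕ) < i → (V'ᴴ * (V * y)) j 0 = 0 := by
    intro j hj
    have h1 := congrFun (congrFun hy ⟨j, hj⟩) 0
    rw [Matrix.mul_assoc, mul_apply] at h1
    rw [mul_apply]
    simpa using h1
  have hypos : 0 < ‖y‖ := norm_pos_iff.2 hy0
  have hxn : ‖V * y‖ = ‖y‖ := norm_mul_of_orthonormal h.right_orthonormal y
  have h1 : c * ‖y‖ ≤ ‖M * (V * y)‖ := by
    rw [← Matrix.mul_assoc, h.mul_right_vectors]
    exact isBoundedBelow_mul_diagonal h.left_orthonormal hc hc0 y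
  have h2 : ‖Mhat * (V * y)‖ ≤ σ' i * ‖y‖ := by
    rw [← hxn]
    refine le_trans ?_ (mul_le_mul_of_nonneg_left
      (norm_conjTranspose_mul_le_of_orthonormal h'.right_orthonormal (V * y)) (h'.nonneg i))
    rw [h'.eq, Matrix.mul_assoc, Matrix.mul_assoc, norm_mul_of_orthonormal h'.left_orthonormal]
    refine (sq_le_sq₀ (norm_nonneg _) (mul_nonneg (h'.nonneg i) (norm_nonneg _))).1 ?_
    rw [norm_diagonal_mul_sq, mul_pow, norm_vector_sq, Finset.mul_sum]
    refine Finset.sum_le_sum fun j _ => ?_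
    rcases lt_or_ge (j : ℕ) i with hj | hj
    · rw [hz j hj]; simp
    · have : σ' j ≤ σ' i := h'.antitone (Fin.le_def.2 hj)
      have h0 := h'.nonneg j
      gcongr
  have h3 := hν (V * y)
  have h4 : M * (V * y) = Mhat * (V * y) - (Mhat - M) * (V * y) := by
    rw [Matrix.sub_mul]; abel
  rw [hxn] at h3
  rw [h4] at h1
  have h5 := norm_sub_le (Mhat * (V * y)) ((Mhat - M) * (V * y))
  have h6 : (c - ν) * ‖y‖ ≤ σ' i * ‖y‖ := by linarith
  exact le_of_mul_le_mul_right h6 hypos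

/-- The trailing singular values of a perturbation of a matrix of rank `r` are small. -/
theorem trailing_singularValue_le (h : IsSVD M U σ V) (h' : IsSVD Mhat U' σ' V')
    (hν : IsBoundedAbove (Mhat - M) ν) (i : Fin p) (hi : r ≤ (i : ℕ)) : σ' i ≤ ν := by
  have hip : (i : ℕ) + 1 ≤ p := i.2
  set W := V'.submatrix id (Fin.castLE hip) with hW
  have hWo : Wᴴ * W = 1 := conjTranspose_mul_submatrix_castLE h'.right_orthonormal hip
  -- The first `i + 1 > r` right singular vectors of `Mhat` span a vector killed by `M`. There
  -- `Mhat` equals the perturbation, yet stretches by at least `σ' i`.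
  obtain ⟨y, hy0, hy⟩ := exists_ne_zero_mul_eq_zero (Nat.lt_succ_of_le hi) (Vᴴ * W)
  have hypos : 0 < ‖y‖ := norm_pos_iff.2 hy0
  have hxn : ‖W * y‖ = ‖y‖ := norm_mul_of_orthonormal hWo y
  have h1 : M * (W * y) = 0 := by
    rw [h.eq, Matrix.mul_assoc _ Vᴴ, ← Matrix.mul_assoc Vᴴ, hy, Matrix.mul_zero]
  have h2 : σ' i * ‖y‖ ≤ ‖Mhat * (W * y)‖ := by
    have e : Mhat * W = U'.submatrix id (Fin.castLE hip) *
        diagonal (fun j => ((σ' (Fin.castLE hip j) : ℝ) : ℂ)) := by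
      have : Mhat * W = (Mhat * V').submatrix id (Fin.castLE hip) := by
        ext a b; simp [mul_apply, hW]
      rw [this, h'.mul_right_vectors]
      ext a b
      simp [mul_diagonal]
    rw [← Matrix.mul_assoc, e]
    exact isBoundedBelow_mul_diagonal (conjTranspose_mul_submatrix_castLE h'.left_orthonormal hip)
      (fun j => h'.antitone (Fin.le_def.2 (Nat.le_of_lt_succ j.2))) (h'.nonneg i) y
  have h3 := hν (W * y)
  rw [Matrix.sub_mul, h1, sub_zero, hxn] at h3
  exact le_of_mul_le_mul_right (h2.trans h3) hypos

theorem norm_of_orthonormal {U : Matrix m (Fin r) ℂ} (hU : Uᴴ * U = 1) : ‖U‖ = Real.sqrt r := by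
  rw [← Real.sqrt_sq (norm_nonneg U), ← re_trace_conjTranspose_mul_self, hU]
  simp

/-- Truncation removes only singular values at most `ν`, so the difference has operator norm at most
`2ν`. It splits into two pieces of rank at most `r`, each of Frobenius norm at most `√r` times that.
-/
theorem norm_truncation_sub_le (h : IsSVD M U σ V) (h' : IsSVD Mhat U' σ' V') (hr : r ≤ p)
    (hν0 : 0 ≤ ν) (hν : IsBoundedAbove (Mhat - M) ν) :
    ‖U'.submatrix id (Fin.castLE hr) * diagonal (fun i => (((σ' ∘ Fin.castLE hr) i : ℝ) : ℂ)) *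
      (V'.submatrix id (Fin.castLE hr))ᴴ - M‖ ≤ 4 * Real.sqrt r * ν := by
  classical
  set W := U'.submatrix id (Fin.castLE hr) with hW
  have hWo : Wᴴ * W = 1 := conjTranspose_mul_submatrix_castLE h'.left_orthonormal hr
  set M0 := W * diagonal (fun i => (((σ' ∘ Fin.castLE hr) i : ℝ) : ℂ)) *
      (V'.submatrix id (Fin.castLE hr))ᴴ with hM0
  have hN : IsBoundedAbove (M0 - M) (2 * ν) := by
    have e : Mhat - M0 = U' * diagonal (fun i : Fin p =>
        ((if (i : ℕ) < r then 0 else σ' i : ℝ) : ℂ)) * V'ᴴ := by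
      rw [hM0, hW, truncated_svd_eq, h'.eq, ← Matrix.sub_mul, ← Matrix.mul_sub]
      congr 2
      ext i j
      by_cases hij : i = j
      · subst hij
        by_cases hir : (i : ℕ) < r <;> simp [hir]
      · simp [hij]
    have h1 : IsBoundedAbove (Mhat - M0) ν := by
      rw [e]
      refine isBoundedAbove_mul_diagonal_mul h'.left_orthonormal h'.right_orthonormal
        (fun i => ?_) hν0
      by_cases hir : (i : ℕ) < r
      · simpa [hir] using hν0
      · simp only [hir, if_false]
        rw [abs_of_nonneg (h'.nonneg i)]
        exact trailing_singularValue_le h h' hν i (not_lt.1 hir)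
    intro x
    have h2 : (M0 - M) * x = (Mhat - M) * x - (Mhat - M0) * x := by
      simp only [Matrix.sub_mul]; abel
    rw [h2]
    linarith [norm_sub_le ((Mhat - M) * x) ((Mhat - M0) * x), h1 x, hν x]
  -- Outside the column space of `M0` the difference is `-M`, whose row space is spanned by `V`;
  -- inserting `V Vᴴ` there changes nothing and exposes a factor with `r` columns.
  have hsplit : M0 - M = W * (Wᴴ * (M0 - M)) + (1 - W * Wᴴ) * ((M0 - M) * V * Vᴴ) := by
    have h1 : (1 - W * Wᴴ) * M0 = 0 := by
      rw [hM0, ← Matrix.mul_assoc, ← Matrix.mul_assoc, Matrix.sub_mul 1, Matrix.one_mul,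
        Matrix.mul_assoc W, hWo, Matrix.mul_one, sub_self, Matrix.zero_mul, Matrix.zero_mul]
    have h2 : M * V * Vᴴ = M := by
      rw [h.mul_right_vectors, ← h.eq]
    have h3 : (1 - W * Wᴴ) * ((M0 - M) * V * Vᴴ) = (1 - W * Wᴴ) * (M0 - M) := by
      rw [Matrix.sub_mul M0, Matrix.sub_mul (M0 * V), h2, Matrix.mul_sub, Matrix.mul_sub, h1,
        Matrix.mul_assoc M0, ← Matrix.mul_assoc, h1, Matrix.zero_mul]
    rw [h3, Matrix.sub_mul 1, Matrix.one_mul, Matrix.mul_assoc W]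
    abel
  rw [hsplit]
  refine (norm_add_le _ _).trans ?_
  have h1 : ‖W * (Wᴴ * (M0 - M))‖ ≤ 2 * ν * Real.sqrt r := by
    rw [norm_mul_of_orthonormal hWo, ← frobenius_norm_conjTranspose, conjTranspose_mul,
      conjTranspose_conjTranspose, ← norm_of_orthonormal hWo]
    exact hN.norm_conjTranspose_mul_le (by positivity) W
  have h2 : ‖(1 - W * Wᴴ) * ((M0 - M) * V * Vᴴ)‖ ≤ 2 * ν * Real.sqrt r := by
    refine (norm_one_sub_mul_le_of_orthonormal hWo _).trans ?_
    rw [norm_mul_conjTranspose_of_orthonormal h.right_orthonormal,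
      ← norm_of_orthonormal h.right_orthonormal]
    exact hN.norm_mul_le (by positivity) V
  linarith

/-- The factors built from a top-`r` singular value decomposition of a small perturbation of `M`
are well conditioned, and their product is close to `M`. -/
theorem spectral_initialization {U₀ : Matrix m (Fin r) ℂ} {σ₀ : Fin r → ℝ} {V₀ : Matrix n (Fin r) ℂ}
    (h : IsSVD M U σ V) (h' : IsTopSVD Mhat U₀ σ₀ V₀) (hν0 : 0 ≤ ν)
    (hν : IsBoundedAbove (Mhat - M) ν) {σ₁ σᵣ : ℝ} (hσᵣ : 0 < σᵣ) (hle : ∀ i, σ i ≤ σ₁)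
    (hge : ∀ i, σᵣ ≤ σ i) (hσ : σᵣ ≤ σ₁) (hνσ : ν ≤ 0.09 * σᵣ) :
    let L := U₀ * diagonal (fun i => (Real.sqrt (σ₀ i) : ℂ))
    let R := V₀ * diagonal (fun i => (Real.sqrt (σ₀ i) : ℂ))
    IsBoundedBelow L (0.95 * Real.sqrt σᵣ) ∧ IsBoundedBelow R (0.95 * Real.sqrt σᵣ) ∧
      IsBoundedAbove L (1.05 * Real.sqrt σ₁) ∧ IsBoundedAbove R (1.05 * Real.sqrt σ₁) ∧
      ‖L * Rᴴ - M‖ ≤ 4 * Real.sqrt r * ν := by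
  obtain ⟨p, hp, U', σ', V', hsvd, rfl, rfl, rfl⟩ := h'
  have hσ1 : 0 < σ₁ := hσᵣ.trans_le hσ
  -- The slack `ν ≤ 0.09 σᵣ` matches the constants: `0.95² ≤ 1 - 0.09` and `1 + 0.09 ≤ 1.05²`.
  have hlow : ∀ i, 0.95 * Real.sqrt σᵣ ≤ Real.sqrt ((σ' ∘ Fin.castLE hp) i) := by
    intro i
    refine Real.le_sqrt_of_sq_le ?_
    rw [mul_pow, Real.sq_sqrt hσᵣ.le]
    have := le_singularValue h hsvd hν hσᵣ.le hge (Fin.castLE hp i) i.2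
    simp only [Function.comp_apply]
    linarith
  have hup : ∀ i, |Real.sqrt ((σ' ∘ Fin.castLE hp) i)| ≤ 1.05 * Real.sqrt σ₁ := by
    intro i
    rw [abs_of_nonneg (Real.sqrt_nonneg _), Real.sqrt_le_left (by positivity), mul_pow,
      Real.sq_sqrt hσ1.le]
    have := singularValue_le h hsvd hν hσ1.le hle (Fin.castLE hp i)
    simp only [Function.comp_apply]
    linarith
  have hUo := conjTranspose_mul_submatrix_castLE hsvd.left_orthonormal hp
  have hVo := conjTranspose_mul_submatrix_castLE hsvd.right_orthonormal hp
  refine ⟨isBoundedBelow_mul_diagonal hUo hlow (by positivity),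
    isBoundedBelow_mul_diagonal hVo hlow (by positivity),
    isBoundedAbove_mul_diagonal hUo hup (by positivity),
    isBoundedAbove_mul_diagonal hVo hup (by positivity), ?_⟩
  have e : U'.submatrix id (Fin.castLE hp) *
        diagonal (fun i => (Real.sqrt ((σ' ∘ Fin.castLE hp) i) : ℂ)) *
      (V'.submatrix id (Fin.castLE hp) *
        diagonal (fun i => (Real.sqrt ((σ' ∘ Fin.castLE hp) i) : ℂ)))ᴴ =
      U'.submatrix id (Fin.castLE hp) * diagonal (fun i => (((σ' ∘ Fin.castLE hp) i : ℝ) : ℂ)) *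
      (V'.submatrix id (Fin.castLE hp))ᴴ := by
    rw [conjTranspose_mul, diagonal_conjTranspose, ← Matrix.mul_assoc,
      Matrix.mul_assoc (U'.submatrix id (Fin.castLE hp)), diagonal_mul_diagonal]
    congr! with i
    have h0 := hsvd.nonneg (Fin.castLE hp i)
    simp [Complex.conj_ofReal, ← Complex.ofReal_mul, Real.mul_self_sqrt h0]
  rw [e]
  exact norm_truncation_sub_le h hsvd hp hν0 hν
end SpectralInitialization
end BlindSR

/-! ### The weighted Hankel lift, its adjoint and the sensing operator. -/

namespace BlindSR
open Matrix

theorem frobInner_eq_sum {m n : Type*} [Fintype m] [Fintype n] (A B : Matrix m n ℂ) :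
    frobInner A B = (∑ i, ∑ j, conj (A i j) * B i j).re := by
  rw [frobInner, trace, Finset.sum_comm]
  simp [mul_apply, conjTranspose_apply]

section LiftOperators
variable {s n n₁ n₂ : ℕ}

theorem sum_antidiagonal {α : Type*} [AddCommMonoid α] (hn : n₁ + n₂ = n + 1)
    (g : Fin n → Fin n₁ × Fin n₂ → α) :
    ∑ j : Fin n, ∑ q : Fin n₁ × Fin n₂ with (q.1 : ℕ) + (q.2 : ℕ) = (j : ℕ), g j q =
      ∑ q : Fin n₁ × Fin n₂, g ⟨q.1 + q.2, by omega⟩ q := by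
  simp only [Finset.sum_filter]
  rw [Finset.sum_comm]
  refine Finset.sum_congr rfl fun q _ => ?_
  rw [Finset.sum_eq_single ⟨q.1 + q.2, by omega⟩]
  · simp
  · intro j _ hj
    rw [if_neg]
    rintro h
    exact hj (Fin.ext h.symm)
  · simp

theorem weight_pos (hn : n₁ + n₂ = n + 1) (h₁ : 0 < n₁) (h₂ : 0 < n₂) (j : Fin n) :
    0 < weight n₁ n₂ j := by
  refine Finset.card_pos.2 ⟨(⟨min (j : ℕ) (n₁ - 1), by omega⟩, ⟨(j : ℕ) - min (j : ℕ) (n₁ - 1), by omega⟩), ?_⟩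
  simp

theorem opG_apply (hn : n₁ + n₂ = n + 1) (X : Matrix (Fin s) (Fin n) ℂ) (a : Fin n₁) (l : Fin s)
    (c : Fin n₂) : opG hn X (a, l) c =
      (Real.sqrt (weight n₁ n₂ (a + c)) : ℂ)⁻¹ * X l ⟨a + c, by omega⟩ := rfl

theorem opGAdj_apply (M : Matrix (Fin n₁ × Fin s) (Fin n₂) ℂ) (l : Fin s) (j : Fin n) :
    opGAdj M l j = (Real.sqrt (weight n₁ n₂ j) : ℂ)⁻¹ *
      ∑ q : Fin n₁ × Fin n₂ with (q.1 : ℕ) + (q.2 : ℕ) = (j : ℕ), M (q.1, l) q.2 := rfl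

theorem opG_add (hn : n₁ + n₂ = n + 1) (X Y : Matrix (Fin s) (Fin n) ℂ) :
    opG hn (X + Y) = opG hn X + opG hn Y := by
  ext ⟨a, l⟩ c
  simp [opG_apply, mul_add]

theorem opG_smul (hn : n₁ + n₂ = n + 1) (z : ℂ) (X : Matrix (Fin s) (Fin n) ℂ) :
    opG hn (z • X) = z • opG hn X := by
  ext ⟨a, l⟩ c
  simp [opG_apply, mul_left_comm]

theorem opGAdj_add (M N : Matrix (Fin n₁ × Fin s) (Fin n₂) ℂ) :
    (opGAdj (M + N) : Matrix (Fin s) (Fin n) ℂ) = opGAdj M + opGAdj N := by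
  ext l j
  simp [opGAdj_apply, mul_add, Finset.sum_add_distrib]

theorem opGAdj_smul (z : ℂ) (M : Matrix (Fin n₁ × Fin s) (Fin n₂) ℂ) :
    (opGAdj (z • M) : Matrix (Fin s) (Fin n) ℂ) = z • opGAdj M := by
  ext l j
  simp only [opGAdj_apply, Matrix.smul_apply, smul_eq_mul, ← Finset.mul_sum]
  ring

theorem opGAdj_sub (M N : Matrix (Fin n₁ × Fin s) (Fin n₂) ℂ) :
    (opGAdj (M - N) : Matrix (Fin s) (Fin n) ℂ) = opGAdj M - opGAdj N := by
  ext l j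
  simp [opGAdj_apply, mul_sub, Finset.sum_sub_distrib]

theorem opA_add (b : Fin n → Fin s → ℂ) (X Y : Matrix (Fin s) (Fin n) ℂ) :
    opA b (X + Y) = opA b X + opA b Y := by
  ext j
  simp [opA, mul_add, Finset.sum_add_distrib]

theorem opA_sub (b : Fin n → Fin s → ℂ) (X Y : Matrix (Fin s) (Fin n) ℂ) :
    opA b (X - Y) = opA b X - opA b Y := by
  ext j
  simp [opA, mul_sub, Finset.sum_sub_distrib]

theorem opA_smul (b : Fin n → Fin s → ℂ) (z : ℂ) (X : Matrix (Fin s) (Fin n) ℂ) :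
    opA b (z • X) = z • opA b X := by
  ext j
  simp [opA, Finset.mul_sum, mul_left_comm]

theorem opAAdj_add (b : Fin n → Fin s → ℂ) (y z : Fin n → ℂ) :
    opAAdj b (y + z) = opAAdj b y + opAAdj b z := by
  ext l j
  simp [opAAdj, add_mul]

theorem opAAdj_smul (b : Fin n → Fin s → ℂ) (c : ℂ) (y : Fin n → ℂ) :
    opAAdj b (c • y) = c • opAAdj b y := by
  ext l j
  simp [opAAdj, mul_assoc]

theorem frobInner_opG (hn : n₁ + n₂ = n + 1) (X : Matrix (Fin s) (Fin n) ℂ)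
    (M : Matrix (Fin n₁ × Fin s) (Fin n₂) ℂ) :
    frobInner (opG hn X) M = frobInner X (opGAdj M) := by
  rw [frobInner_eq_sum, frobInner_eq_sum]
  congr 1
  rw [Fintype.sum_prod_type, Finset.sum_comm]
  refine Finset.sum_congr rfl fun l _ => ?_
  simp only [opGAdj_apply, Finset.mul_sum]
  rw [sum_antidiagonal hn (fun j q => conj (X l j) *
    ((Real.sqrt (weight n₁ n₂ j) : ℂ)⁻¹ * M (q.1, l) q.2)), Fintype.sum_prod_type]
  refine Finset.sum_congr rfl fun a _ => Finset.sum_congr rfl fun c _ => ?_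
  rw [opG_apply, map_mul, map_inv₀, Complex.conj_ofReal]
  ring

theorem ofReal_sqrt_weight_ne_zero (hn : n₁ + n₂ = n + 1) (h₁ : 0 < n₁) (h₂ : 0 < n₂) (j : Fin n) :
    (Real.sqrt (weight n₁ n₂ j) : ℂ) ≠ 0 := by
  have := weight_pos hn h₁ h₂ j
  exact Complex.ofReal_ne_zero.2 (Real.sqrt_pos.2 (by exact_mod_cast this)).ne'

/-- Column `j` is copied to `w_j` places with weight `1/√w_j`, and summing back with the same weight
restores it. Thus `𝒢` is an isometry. -/
theorem opGAdj_opG (hn : n₁ + n₂ = n + 1) (h₁ : 0 < n₁) (h₂ : 0 < n₂)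
    (X : Matrix (Fin s) (Fin n) ℂ) : opGAdj (opG hn X) = X := by
  ext l j
  have h0 := ofReal_sqrt_weight_ne_zero hn h₁ h₂ j
  have e : ∑ q : Fin n₁ × Fin n₂ with (q.1 : ℕ) + (q.2 : ℕ) = (j : ℕ), opG hn X (q.1, l) q.2 =
      ∑ q : Fin n₁ × Fin n₂ with (q.1 : ℕ) + (q.2 : ℕ) = (j : ℕ),
        (Real.sqrt (weight n₁ n₂ j) : ℂ)⁻¹ * X l j := by
    refine Finset.sum_congr rfl fun q hq => ?_
    have hq' := (Finset.mem_filter.1 hq).2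
    rw [opG_apply]
    simp only [hq']
  rw [opGAdj_apply, e, Finset.sum_const]
  change _ * (weight n₁ n₂ j • _) = _
  have h2 : (Real.sqrt (weight n₁ n₂ j) : ℂ) * Real.sqrt (weight n₁ n₂ j) = weight n₁ n₂ j := by
    rw [← Complex.ofReal_mul, Real.mul_self_sqrt (by positivity)]
    simp
  rw [nsmul_eq_mul, ← h2]
  field_simp

theorem opG_scale (hn : n₁ + n₂ = n + 1) (h₁ : 0 < n₁) (h₂ : 0 < n₂)
    (X : Matrix (Fin s) (Fin n) ℂ) : opG hn (scale n₁ n₂ X) = hankel hn X := by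
  ext ⟨a, l⟩ c
  have h0 := ofReal_sqrt_weight_ne_zero hn h₁ h₂ ⟨a + c, by omega⟩
  simp only [opG_apply, scale, of_apply, hankel]
  exact inv_mul_cancel_left₀ h0 _

theorem scale_eq_opGAdj (hn : n₁ + n₂ = n + 1) (h₁ : 0 < n₁) (h₂ : 0 < n₂)
    (X : Matrix (Fin s) (Fin n) ℂ) : scale n₁ n₂ X = opGAdj (hankel hn X) := by
  rw [← opG_scale hn h₁ h₂, opGAdj_opG hn h₁ h₂]

theorem scaleInv_scale (hn : n₁ + n₂ = n + 1) (h₁ : 0 < n₁) (h₂ : 0 < n₂)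
    (X : Matrix (Fin s) (Fin n) ℂ) : scaleInv n₁ n₂ (scale n₁ n₂ X) = X := by
  ext l j
  exact inv_mul_cancel_left₀ (ofReal_sqrt_weight_ne_zero hn h₁ h₂ j) _

theorem norm_opG (hn : n₁ + n₂ = n + 1) (h₁ : 0 < n₁) (h₂ : 0 < n₂)
    (X : Matrix (Fin s) (Fin n) ℂ) : ‖opG hn X‖ = ‖X‖ := by
  rw [← sq_eq_sq₀ (norm_nonneg _) (norm_nonneg _), ← frobInner_self, ← frobInner_self,
    frobInner_opG, opGAdj_opG hn h₁ h₂]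

theorem norm_opGAdj_le (hn : n₁ + n₂ = n + 1) (h₁ : 0 < n₁) (h₂ : 0 < n₂)
    (M : Matrix (Fin n₁ × Fin s) (Fin n₂) ℂ) : ‖(opGAdj M : Matrix (Fin s) (Fin n) ℂ)‖ ≤ ‖M‖ := by
  have h : ‖(opGAdj M : Matrix (Fin s) (Fin n) ℂ)‖ ^ 2 ≤
      ‖(opGAdj M : Matrix (Fin s) (Fin n) ℂ)‖ * ‖M‖ := by
    rw [← frobInner_self, ← frobInner_opG hn]
    refine (frobInner_le _ _).trans ?_
    rw [norm_opG hn h₁ h₂]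
  rcases (norm_nonneg (opGAdj M : Matrix (Fin s) (Fin n) ℂ)).eq_or_lt with h0 | h0
  · rw [← h0]; positivity
  · nlinarith

theorem norm_scaleInv_le (hn : n₁ + n₂ = n + 1) (h₁ : 0 < n₁) (h₂ : 0 < n₂)
    (X : Matrix (Fin s) (Fin n) ℂ) : ‖scaleInv n₁ n₂ X‖ ≤ ‖X‖ := by
  refine (sq_le_sq₀ (norm_nonneg _) (norm_nonneg _)).1 ?_
  rw [frobenius_norm_sq, frobenius_norm_sq]
  refine Finset.sum_le_sum fun l _ => Finset.sum_le_sum fun j _ => ?_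
  have hw : (1 : ℝ) ≤ weight n₁ n₂ j := by exact_mod_cast weight_pos hn h₁ h₂ j
  have : ‖(Real.sqrt (weight n₁ n₂ j) : ℂ)⁻¹‖ ≤ 1 := by
    rw [norm_inv, Complex.norm_real, Real.norm_of_nonneg (Real.sqrt_nonneg _)]
    exact inv_le_one_of_one_le₀ (Real.one_le_sqrt.2 hw)
  simp only [scaleInv, of_apply, norm_mul]
  refine pow_le_pow_left₀ (by positivity) ?_ 2
  exact mul_le_of_le_one_left (norm_nonneg _) this

/-- `𝒟⁻¹𝒢*` is a contraction that maps the lift of `X` to `X`, so errors of the lifted iterates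
dominate errors of the estimates. -/
theorem norm_scaleInv_opGAdj_sub_le (hn : n₁ + n₂ = n + 1) (h₁ : 0 < n₁) (h₂ : 0 < n₂)
    (M : Matrix (Fin n₁ × Fin s) (Fin n₂) ℂ) (X : Matrix (Fin s) (Fin n) ℂ) :
    ‖scaleInv n₁ n₂ (opGAdj M) - X‖ ≤ ‖M - hankel hn X‖ := by
  have e : scaleInv n₁ n₂ (opGAdj M) - X = scaleInv n₁ n₂ (opGAdj (M - hankel hn X)) := by
    conv_lhs => rw [← scaleInv_scale hn h₁ h₂ X, scale_eq_opGAdj hn h₁ h₂]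
    rw [opGAdj_sub]
    ext l j
    simp [scaleInv, mul_sub]
  rw [e]
  exact (norm_scaleInv_le hn h₁ h₂ _).trans (norm_opGAdj_le hn h₁ h₂ _)

theorem frobInner_opAAdj_opA (b : Fin n → Fin s → ℂ) (X Y : Matrix (Fin s) (Fin n) ℂ) :
    frobInner X (opAAdj b (opA b Y)) = (∑ j, conj (opA b X j) * opA b Y j).re := by
  rw [frobInner_eq_sum, Finset.sum_comm]
  congr 1
  refine Finset.sum_congr rfl fun j _ => ?_
  conv_rhs => rw [opA]
  rw [map_sum, Finset.sum_mul]
  refine Finset.sum_congr rfl fun l _ => ?_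
  simp only [opAAdj, of_apply, map_mul, Complex.conj_conj]
  ring

/-- The Hessian `𝒢𝒜*𝒜𝒢* + (ℐ - 𝒢𝒢*)` of the objective as a function of the lifted matrix. -/
noncomputable def sensing (hn : n₁ + n₂ = n + 1) (b : Fin n → Fin s → ℂ) :
    Matrix (Fin n₁ × Fin s) (Fin n₂) ℂ →ₗ[ℝ] Matrix (Fin n₁ × Fin s) (Fin n₂) ℂ where
  toFun M := opG hn (opAAdj b (opA b (opGAdj M))) + (M - opG hn (opGAdj M))
  map_add' M N := by
    simp only [opGAdj_add, opG_add, opA_add, opAAdj_add]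
    abel
  map_smul' c M := by
    have e : c • M = (c : ℂ) • M := (Complex.coe_smul c M).symm
    rw [e]
    simp only [opGAdj_smul, opG_smul, opA_smul, opAAdj_smul]
    rw [RingHom.id_apply, ← Complex.coe_smul, smul_add, smul_sub]

/-- The measurements are `𝒜𝒢*` of the lift, and the lift is fixed by `𝒢𝒢*`; both parts of the
residual therefore depend linearly on the lifted error alone. -/
theorem residual_eq_sensing (hn : n₁ + n₂ = n + 1) (h₁ : 0 < n₁) (h₂ : 0 < n₂)
    (b : Fin n → Fin s → ℂ) (X : Matrix (Fin s) (Fin n) ℂ)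
    (M : Matrix (Fin n₁ × Fin s) (Fin n₂) ℂ) :
    residual hn b (measurements n₁ n₂ b X) M = sensing hn b (M - hankel hn X) := by
  change _ = opG hn (opAAdj b (opA b (opGAdj (M - hankel hn X)))) +
    (M - hankel hn X - opG hn (opGAdj (M - hankel hn X)))
  have e2 : opG hn (opGAdj M - scale n₁ n₂ X) = opG hn (opGAdj M) - hankel hn X := by
    rw [eq_sub_iff_add_eq, ← opG_scale hn h₁ h₂, ← opG_add, sub_add_cancel]
  rw [opGAdj_sub, ← scale_eq_opGAdj hn h₁ h₂, opA_sub, residual, measurements, e2]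
  congr 1
  abel

theorem frobInner_sensing (hn : n₁ + n₂ = n + 1) (b : Fin n → Fin s → ℂ)
    (A B : Matrix (Fin n₁ × Fin s) (Fin n₂) ℂ) :
    frobInner A (sensing hn b B) =
      (∑ j : Fin n, conj (opA b (opGAdj A) j) * opA b (opGAdj B) j).re + (frobInner A B -
        frobInner (opGAdj A : Matrix (Fin s) (Fin n) ℂ) (opGAdj B)) := by
  change frobInner A (opG hn (opAAdj b (opA b (opGAdj B))) + (B - opG hn (opGAdj B))) = _
  rw [frobInner_add_right, frobInner_sub_right, frobInner_comm A (opG hn _), frobInner_opG,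
    frobInner_comm A (opG hn _), frobInner_opG, frobInner_comm _ (opGAdj A), frobInner_opAAdj_opA,
    frobInner_comm _ (opGAdj A)]

theorem frobInner_sensing_self (hn : n₁ + n₂ = n + 1) (b : Fin n → Fin s → ℂ)
    (A : Matrix (Fin n₁ × Fin s) (Fin n₂) ℂ) :
    frobInner A (sensing hn b A) = ∑ j : Fin n, ‖opA b (opGAdj A) j‖ ^ 2 +
      (‖A‖ ^ 2 - ‖(opGAdj A : Matrix (Fin s) (Fin n) ℂ)‖ ^ 2) := by
  rw [frobInner_sensing, frobInner_self, frobInner_self, Complex.re_sum]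
  congr 2
  funext j
  rw [Complex.conj_mul', ← Complex.ofReal_pow, Complex.ofReal_re]

theorem sensing_symm (hn : n₁ + n₂ = n + 1) (b : Fin n → Fin s → ℂ)
    (A B : Matrix (Fin n₁ × Fin s) (Fin n₂) ℂ) :
    frobInner A (sensing hn b B) = frobInner (sensing hn b A) B := by
  rw [frobInner_comm (sensing hn b A), frobInner_sensing, frobInner_sensing, frobInner_comm B A,
    frobInner_comm (opGAdj B)]
  congr 1
  rw [Complex.re_sum, Complex.re_sum]
  refine Finset.sum_congr rfl fun j _ => ?_
  rw [← Complex.conj_re, map_mul, Complex.conj_conj, mul_comm]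

theorem norm_dotProduct_sq_le {k : Type*} [Fintype k] (x u : k → ℂ) :
    ‖∑ l, conj (x l) * u l‖ ^ 2 ≤ sqNorm x * sqNorm u := by
  have h1 : ‖∑ l, conj (x l) * u l‖ ≤ ∑ l, ‖x l‖ * ‖u l‖ := by
    refine (norm_sum_le _ _).trans (Finset.sum_le_sum fun l _ => ?_)
    rw [norm_mul, RCLike.norm_conj]
  exact (pow_le_pow_left₀ (norm_nonneg _) h1 2).trans (Finset.sum_mul_sq_le_sq_mul_sq _ _ _)

theorem frobenius_norm_sq_eq_sum_sqNorm {m k : Type*} [Fintype m] [Fintype k] (A : Matrix m k ℂ) :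
    ‖A‖ ^ 2 = ∑ j, sqNorm fun i => A i j := by
  rw [frobenius_norm_sq, Finset.sum_comm]
  rfl

theorem sum_norm_opA_sq_le {b : Fin n → Fin s → ℂ} {β : ℝ} (hb : ∀ j, sqNorm (b j) ≤ β)
    (X : Matrix (Fin s) (Fin n) ℂ) : ∑ j, ‖opA b X j‖ ^ 2 ≤ β * ‖X‖ ^ 2 := by
  rw [frobenius_norm_sq_eq_sum_sqNorm, Finset.mul_sum]
  refine Finset.sum_le_sum fun j _ => (norm_dotProduct_sq_le _ _).trans ?_
  exact mul_le_mul_of_nonneg_right (hb j) (sqNorm_nonneg _)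

/-- The form of `Q` at `A` is `‖𝒜𝒢*A‖² + ‖A‖² - ‖𝒢*A‖²`. Its deviation from `‖A‖²` is only that of
the random measurements of `𝒢*A`, which is what the hypothesis `hT` controls. Positivity uses that
`𝒢*` is a contraction, and the upper bound also uses `β ≥ 1`. -/
theorem isTangentIsometry_sensing {r : ℕ} (hn : n₁ + n₂ = n + 1) (h₁ : 0 < n₁) (h₂ : 0 < n₂)
    {b : Fin n → Fin s → ℂ} {β : ℝ} (hβ : 1 ≤ β) (hb : ∀ j, sqNorm (b j) ≤ β)
    {U : Matrix (Fin n₁ × Fin s) (Fin r) ℂ} {V : Matrix (Fin n₂) (Fin r) ℂ}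
    (hU : Uᴴ * U = 1) (hV : Vᴴ * V = 1)
    (hT : ∀ A : Matrix (Fin n₁ × Fin s) (Fin n₂) ℂ,
      |∑ j : Fin n, (‖opA b (opGAdj (A - normalPart U V A)) j‖ ^ 2 -
        sqNorm fun l => (opGAdj (A - normalPart U V A) : Matrix (Fin s) (Fin n) ℂ) l j)| ≤
      1 / 10 * ‖A‖ ^ 2) :
    IsTangentIsometry U V (sensing hn b) (Real.sqrt β) where
  left_orthonormal := hU
  right_orthonormal := hV
  one_le := Real.one_le_sqrt.2 hβ
  symm := sensing_symm hn b
  nonneg A := by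
    rw [frobInner_sensing_self]
    have := pow_le_pow_left₀ (norm_nonneg _) (norm_opGAdj_le hn h₁ h₂ A) 2
    have : 0 ≤ ∑ j : Fin n, ‖opA b (opGAdj A) j‖ ^ 2 := by positivity
    linarith
  le A := by
    rw [frobInner_sensing_self, Real.sq_sqrt (by linarith)]
    have h := pow_le_pow_left₀ (norm_nonneg _) (norm_opGAdj_le hn h₁ h₂ A) 2
    have := sum_norm_opA_sq_le hb (opGAdj A)
    nlinarith
  tangent A := by
    have h := hT (A - normalPart U V A)
    have e : normalPart U V (A - normalPart U V A) = 0 := by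
      have h1 : normalPart U V (A - normalPart U V A) =
          normalPart U V A - normalPart U V (normalPart U V A) := by
        conv_lhs => rw [normalPart, Matrix.mul_sub (1 - U * Uᴴ), Matrix.sub_mul ((1 - U * Uᴴ) * A)]
        rfl
      rw [h1, normalPart_normalPart hU hV, sub_self]
    rw [e, sub_zero, Finset.sum_sub_distrib, ← frobenius_norm_sq_eq_sum_sqNorm] at h
    rw [frobInner_sensing_self]
    convert h using 2
    ring

end LiftOperators
end BlindSR

/-! ### Moments of the rank-one fluctuations. -/

namespace BlindSR
open Matrix
open scoped ComplexOrder

section Fluctuation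
variable {s : ℕ}

/-- The deviation `x xᴴ - I` of a rank-one matrix from the identity. -/
def fluctuation (x : Fin s → ℂ) : Matrix (Fin s) (Fin s) ℂ := vecMulVec x (star x) - 1

theorem fluctuation_isHermitian (x : Fin s → ℂ) : (fluctuation x).IsHermitian := by
  rw [IsHermitian, fluctuation, conjTranspose_sub, conjTranspose_vecMulVec, star_star,
    conjTranspose_one]

theorem continuous_fluctuation : Continuous (fluctuation : (Fin s → ℂ) → _) := by
  refine Continuous.sub (continuous_matrix fun i j => ?_) continuous_const
  simp only [vecMulVec_apply, Pi.star_apply]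
  fun_prop

theorem fluctuation_mulVec (x u : Fin s → ℂ) :
    fluctuation x *ᵥ u = (star x ⬝ᵥ u) • x - u := by
  rw [fluctuation, sub_mulVec, one_mulVec, vecMulVec_mulVec]
  simp [op_smul_eq_smul]

theorem norm_sq_eq_re (z : ℂ) : ‖z‖ ^ 2 = (conj z * z).re := by
  rw [Complex.conj_mul', ← Complex.ofReal_pow, Complex.ofReal_re]

theorem quadForm_fluctuation (x u : Fin s → ℂ) :
    quadForm (fluctuation x) u = ‖star x ⬝ᵥ u‖ ^ 2 - sqNorm u := by
  have h : star u ⬝ᵥ x = conj (star x ⬝ᵥ u) := by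
    simp [dotProduct, mul_comm]
  rw [quadForm, fluctuation_mulVec, dotProduct_sub, dotProduct_smul, star_dotProduct_self, h,
    smul_eq_mul, Complex.sub_re, Complex.ofReal_re, norm_sq_eq_re, mul_comm]

theorem sqNorm_eq_re {m : Type*} [Fintype m] (v : m → ℂ) : sqNorm v = (star v ⬝ᵥ v).re := by
  rw [star_dotProduct_self, Complex.ofReal_re]

/-- The identity `(x xᴴ - 1)² = (‖x‖² - 2) x xᴴ + 1`. Being linear in `x xᴴ` apart from the bounded
factor `‖x‖² - 2`, it lets isotropy evaluate the second moment. -/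
theorem sqNorm_fluctuation_mulVec (x u : Fin s → ℂ) :
    sqNorm (fluctuation x *ᵥ u) = (sqNorm x - 2) * ‖star x ⬝ᵥ u‖ ^ 2 + sqNorm u := by
  have h : star u ⬝ᵥ x = conj (star x ⬝ᵥ u) := by
    simp [dotProduct, mul_comm]
  rw [sqNorm_eq_re, fluctuation_mulVec, star_sub, star_smul, sub_dotProduct, dotProduct_sub,
    dotProduct_sub, smul_dotProduct, dotProduct_smul, smul_dotProduct, dotProduct_smul, h,
    star_dotProduct_self, star_dotProduct_self]
  have h2 : ∀ z : ℂ, star z * z = ((‖z‖ ^ 2 : ℝ) : ℂ) := fun z => by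
    rw [Complex.star_def, Complex.conj_mul', Complex.ofReal_pow]
  simp only [smul_eq_mul]
  rw [show (starRingEnd ℂ) (star x ⬝ᵥ u) = star (star x ⬝ᵥ u) from rfl, ← mul_assoc, h2,
    mul_comm (star x ⬝ᵥ u), h2, ← Complex.ofReal_mul]
  simp only [Complex.sub_re, Complex.ofReal_re]
  ring

theorem norm_star_dotProduct_sq_le {k : Type*} [Fintype k] (x u : k → ℂ) :
    ‖star x ⬝ᵥ u‖ ^ 2 ≤ sqNorm x * sqNorm u := norm_dotProduct_sq_le x u

theorem abs_quadForm_fluctuation_le {β : ℝ} (hβ : 1 ≤ β) {x : Fin s → ℂ} (hx : sqNorm x ≤ β)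
    (u : Fin s → ℂ) : |quadForm (fluctuation x) u| ≤ β * sqNorm u := by
  rw [quadForm_fluctuation, abs_le]
  have h1 := norm_star_dotProduct_sq_le x u
  have h2 := sqNorm_nonneg u
  have h3 := sqNorm_nonneg x
  constructor <;> nlinarith [sq_nonneg ‖star x ⬝ᵥ u‖]

theorem sqNorm_fluctuation_mulVec_le {β : ℝ} (hβ : 1 ≤ β) {x : Fin s → ℂ} (hx : sqNorm x ≤ β)
    (u : Fin s → ℂ) : sqNorm (fluctuation x *ᵥ u) ≤ β ^ 2 * sqNorm u := by
  rw [sqNorm_fluctuation_mulVec]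
  have h1 := norm_star_dotProduct_sq_le x u
  have h2 := sqNorm_nonneg u
  have h3 := sq_nonneg ‖star x ⬝ᵥ u‖
  rcases le_total (sqNorm x) 2 with h | h
  · have h4 : sqNorm u ≤ β ^ 2 * sqNorm u := le_mul_of_one_le_left h2 (one_le_pow₀ hβ)
    linarith [mul_nonneg (sub_nonneg.2 h) h3]
  · have : (sqNorm x - 2) * ‖star x ⬝ᵥ u‖ ^ 2 ≤ (sqNorm x - 2) * (sqNorm x * sqNorm u) := by
      gcongr
    nlinarith [mul_nonneg h2 (sub_nonneg.2 hx)]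

/-- The vectors whose entries are bounded by `√μ`. -/
def boundedVectors (s : ℕ) (μ : ℝ) : Set (Fin s → ℂ) := {x | ∀ l, ‖x l‖ ^ 2 ≤ μ}

theorem isCompact_boundedVectors (s : ℕ) (μ : ℝ) : IsCompact (boundedVectors s μ) := by
  have h : boundedVectors s μ ⊆ Metric.closedBall 0 (Real.sqrt μ) := fun x hx => by
    rw [mem_closedBall_zero_iff, pi_norm_le_iff_of_nonneg (Real.sqrt_nonneg _)]
    exact fun l => Real.le_sqrt_of_sq_le (hx l)
  refine (isCompact_closedBall 0 _).of_isClosed_subset ?_ h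
  have e : boundedVectors s μ = ⋂ l, {x | ‖x l‖ ^ 2 ≤ μ} := by
    ext x; simp [boundedVectors]
  rw [e]
  exact isClosed_iInter fun l => isClosed_le (by fun_prop) continuous_const

theorem sqNorm_le_of_mem_boundedVectors {μ : ℝ} {x : Fin s → ℂ} (hx : x ∈ boundedVectors s μ) :
    sqNorm x ≤ s * μ := by
  refine (Finset.sum_le_sum fun l _ => hx l).trans ?_
  simp

end Fluctuation

namespace IsSubspaceEnsemble
set_option linter.unusedSectionVars false
variable {Ω : Type*} [MeasurableSpace Ω] {P : Measure Ω} [IsProbabilityMeasure P] {s n : ℕ}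
  {b : Fin n → Ω → Fin s → ℂ} {μ₀ : ℝ}

theorem ae_mem (hb : IsSubspaceEnsemble P b μ₀) (j : Fin n) :
    ∀ᵐ ω ∂P, b j ω ∈ boundedVectors s μ₀ :=
  ae_all_iff.2 fun l => hb.bounded j l

theorem integrable_comp {F : Type*} [NormedAddCommGroup F] (hb : IsSubspaceEnsemble P b μ₀)
    (j : Fin n) {f : (Fin s → ℂ) → F} (hf : Continuous f) : Integrable (fun ω => f (b j ω)) P :=
  integrable_continuous_comp (isCompact_boundedVectors s μ₀) (hb.measurable j) (hb.ae_mem j) hf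

theorem integrable_fluctuation (hb : IsSubspaceEnsemble P b μ₀) (j : Fin n) (k l : Fin s) :
    Integrable (fun ω => fluctuation (b j ω) k l) P :=
  hb.integrable_comp j (continuous_fluctuation.matrix_elem k l)

theorem integral_fluctuation (hb : IsSubspaceEnsemble P b μ₀) (j : Fin n) (k l : Fin s) :
    ∫ ω, fluctuation (b j ω) k l ∂P = 0 := by
  have h : Integrable (fun ω => b j ω k * conj (b j ω l)) P :=
    hb.integrable_comp j (f := fun x => x k * conj (x l)) (by fun_prop)
  simp only [fluctuation, Matrix.sub_apply, vecMulVec_apply, Pi.star_apply, RCLike.star_def]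
  rw [integral_sub h (integrable_const _), hb.isotropic]
  simp

theorem integral_quadForm_fluctuation (hb : IsSubspaceEnsemble P b μ₀) (j : Fin n)
    (u : Fin s → ℂ) : ∫ ω, quadForm (fluctuation (b j ω)) u ∂P = 0 := by
  have hi : ∀ k l, Integrable (fun ω => star (u k) * (fluctuation (b j ω) k l * u l)) P :=
    fun k l => ((hb.integrable_fluctuation j k l).mul_const _).const_mul _
  have e : ∀ ω, quadForm (fluctuation (b j ω)) u =
      (∑ k, ∑ l, star (u k) * (fluctuation (b j ω) k l * u l)).re := fun ω => by
    simp [quadForm, dotProduct, mulVec, Finset.mul_sum]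
  simp only [e]
  have h := integral_re (𝕜 := ℂ) (integrable_finsetSum Finset.univ fun k _ =>
    integrable_finsetSum Finset.univ fun l _ => hi k l)
  simp only [RCLike.re_eq_complex_re] at h
  rw [h, integral_finsetSum _ fun k _ => integrable_finsetSum _ fun l _ => hi k l]
  simp_rw [integral_finsetSum Finset.univ fun l _ => hi _ l, integral_const_mul, integral_mul_const,
    hb.integral_fluctuation]
  simp

theorem integrable_norm_dotProduct_sq (hb : IsSubspaceEnsemble P b μ₀) (j : Fin n)
    (u : Fin s → ℂ) : Integrable (fun ω => ‖star (b j ω) ⬝ᵥ u‖ ^ 2) P :=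
  hb.integrable_comp j (f := fun x => ‖star x ⬝ᵥ u‖ ^ 2) (by
    simp only [dotProduct, Pi.star_apply]; fun_prop)

theorem integral_norm_dotProduct_sq (hb : IsSubspaceEnsemble P b μ₀) (j : Fin n)
    (u : Fin s → ℂ) : ∫ ω, ‖star (b j ω) ⬝ᵥ u‖ ^ 2 ∂P = sqNorm u := by
  have h := hb.integral_quadForm_fluctuation j u
  simp only [quadForm_fluctuation] at h
  rw [integral_sub (hb.integrable_norm_dotProduct_sq j u) (integrable_const _), sub_eq_zero] at h
  simpa using h

theorem continuous_sqNorm {m : Type*} [Fintype m] : Continuous (sqNorm : (m → ℂ) → ℝ) := by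
  unfold sqNorm; fun_prop

theorem integrable_sqNorm_fluctuation_mulVec (hb : IsSubspaceEnsemble P b μ₀) (j : Fin n)
    (u : Fin s → ℂ) : Integrable (fun ω => sqNorm (fluctuation (b j ω) *ᵥ u)) P :=
  hb.integrable_comp j (f := fun x => sqNorm (fluctuation x *ᵥ u))
    (continuous_sqNorm.comp (continuous_fluctuation.matrix_mulVec continuous_const))

/-- The variance is of order `β = s μ₀`, whereas the pointwise bound is `β²`: only one factor `‖b‖²`
is bounded by `β`, the other is averaged by isotropy. -/
theorem integral_sqNorm_fluctuation_mulVec_le (hb : IsSubspaceEnsemble P b μ₀) (j : Fin n)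
    (u : Fin s → ℂ) :
    ∫ ω, sqNorm (fluctuation (b j ω) *ᵥ u) ∂P ≤ s * μ₀ * sqNorm u := by
  have hi := hb.integrable_norm_dotProduct_sq j u
  have h : ∫ ω, sqNorm (fluctuation (b j ω) *ᵥ u) ∂P ≤
      ∫ ω, ((s * μ₀ - 2) * ‖star (b j ω) ⬝ᵥ u‖ ^ 2 + sqNorm u) ∂P := by
    refine integral_mono_ae (hb.integrable_sqNorm_fluctuation_mulVec j u)
      ((hi.const_mul _).add (integrable_const _)) ?_
    filter_upwards [hb.ae_mem j] with ω hω
    simp only [sqNorm_fluctuation_mulVec]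
    gcongr
    exact sqNorm_le_of_mem_boundedVectors hω
  rw [integral_add (hi.const_mul _) (integrable_const _), integral_const_mul,
    hb.integral_norm_dotProduct_sq] at h
  simp only [integral_const, probReal_univ, one_smul] at h
  nlinarith [sqNorm_nonneg u]

theorem integral_mulVec_fluctuation (hb : IsSubspaceEnsemble P b μ₀) (j : Fin n)
    (u : Fin s → ℂ) (l : Fin s) : ∫ ω, (fluctuation (b j ω) *ᵥ u) l ∂P = 0 := by
  simp only [mulVec, dotProduct]
  rw [integral_finsetSum _ fun k _ => (hb.integrable_fluctuation j l k).mul_const _]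
  simp [integral_mul_const, hb.integral_fluctuation]

theorem integral_mul_fluctuation_mul (hb : IsSubspaceEnsemble P b μ₀) (j : Fin n)
    {p q : Type*} [Fintype p] [Fintype q] (A : Matrix p (Fin s) ℂ) (B : Matrix (Fin s) q ℂ)
    (i : p) (k : q) : ∫ ω, (A * fluctuation (b j ω) * B) i k ∂P = 0 := by
  simp only [mul_apply, Finset.sum_mul]
  have hi : ∀ l l', Integrable (fun ω => A i l' * fluctuation (b j ω) l' l * B l k) P :=
    fun l l' => ((hb.integrable_fluctuation j l' l).const_mul _).mul_const _
  rw [integral_finsetSum _ fun l _ => integrable_finsetSum _ fun l' _ => hi l l']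
  simp_rw [integral_finsetSum Finset.univ fun l' _ => hi _ l', integral_mul_const,
    integral_const_mul, hb.integral_fluctuation]
  simp

/-- Isotropy says that `|b[l]|²` has mean `1`, and a mean cannot exceed an almost sure bound. -/
theorem one_le_of_pos (hb : IsSubspaceEnsemble P b μ₀) (hs : 0 < s) (hn : 0 < n) : 1 ≤ μ₀ := by
  have hi := hb.integrable_comp ⟨0, hn⟩ (f := fun x => ‖x ⟨0, hs⟩‖ ^ 2) (by fun_prop)
  have h1 : ∫ ω, ‖b ⟨0, hn⟩ ω ⟨0, hs⟩‖ ^ 2 ∂P = 1 := by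
    have h := hb.isotropic ⟨0, hn⟩ ⟨0, hs⟩ ⟨0, hs⟩
    simp only [Complex.mul_conj', one_apply_eq, ← Complex.ofReal_pow] at h
    rw [integral_complex_ofReal] at h
    exact_mod_cast h
  have h2 : ∫ ω, ‖b ⟨0, hn⟩ ω ⟨0, hs⟩‖ ^ 2 ∂P ≤ ∫ _, μ₀ ∂P :=
    integral_mono_ae hi (integrable_const _) (hb.bounded ⟨0, hn⟩ ⟨0, hs⟩)
  simpa [h1] using h2

end IsSubspaceEnsemble

/-! ### Restricted isometry for families of blocks. -/

section RestrictedIsometry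
variable {Ω : Type*} [MeasurableSpace Ω] {P : Measure Ω} [IsProbabilityMeasure P] {s n : ℕ}
  {b : Fin n → Ω → Fin s → ℂ} {μ₀ : ℝ} {ι : Type*} [Fintype ι] [DecidableEq ι]

theorem quadForm_conj {m k : Type*} [Fintype m] [Fintype k] (W : Matrix m k ℂ)
    (A : Matrix m m ℂ) (v : k → ℂ) : quadForm (Wᴴ * A * W) v = quadForm A (W *ᵥ v) := by
  rw [quadForm, quadForm, ← mulVec_mulVec, ← mulVec_mulVec, dotProduct_mulVec,
    vecMul_conjTranspose, star_star]

theorem sqNorm_conjTranspose_mulVec_le {m k : Type*} [Fintype m] [Fintype k] {W : Matrix m k ℂ}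
    {p : ℝ} (hp : 0 ≤ p) (hW : ∀ v, sqNorm (W *ᵥ v) ≤ p * sqNorm v) (u : m → ℂ) :
    sqNorm (Wᴴ *ᵥ u) ≤ p * sqNorm u := by
  set v := Wᴴ *ᵥ u with hv
  have h1 : sqNorm v = (star u ⬝ᵥ (W *ᵥ v)).re := by
    rw [sqNorm_eq_re]
    nth_rewrite 1 [hv]
    rw [star_mulVec, conjTranspose_conjTranspose, ← dotProduct_mulVec]
  have h2 : sqNorm v ^ 2 ≤ sqNorm u * (p * sqNorm v) := by
    have h3 : |sqNorm v| ≤ ‖star u ⬝ᵥ (W *ᵥ v)‖ := by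
      rw [h1]; exact Complex.abs_re_le_norm _
    rw [← sq_abs]
    refine (pow_le_pow_left₀ (abs_nonneg _) h3 2).trans ((norm_star_dotProduct_sq_le _ _).trans ?_)
    exact mul_le_mul_of_nonneg_left (hW v) (sqNorm_nonneg _)
  rcases (sqNorm_nonneg v).eq_or_lt with h0 | h0
  · rw [← h0]
    exact mul_nonneg hp (sqNorm_nonneg _)
  · nlinarith

/-- Bernstein for the matrices `c Wⱼᴴ(bⱼbⱼᴴ - 1)Wⱼ`, with variance proxies `pβ WⱼᴴWⱼ`. Since `∑
WⱼᴴWⱼ ≤ 1`, the total variance is `pβ`, with no factor counting the blocks. -/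
theorem exists_bad_event_signed_restricted_isometry (hb : IsSubspaceEnsemble P b μ₀)
    (hβ : 1 ≤ s * μ₀) {W : Fin n → Matrix (Fin s) ι ℂ} {p : ℝ} (hp : 0 < p)
    (hW : ∀ j v, sqNorm (W j *ᵥ v) ≤ p * sqNorm v)
    (hW' : ∀ v, ∑ j, sqNorm (W j *ᵥ v) ≤ sqNorm v) {c : ℝ} (hc : |c| = 1) :
    ∃ T : Set Ω, MeasurableSet T ∧
      P.real T ≤ Fintype.card ι * Real.exp (-((1 / 10) ^ 2 / (8 * (p * (s * μ₀))))) ∧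
      ∀ ω, ω ∉ T → ∀ v, c * ∑ j, (‖star (b j ω) ⬝ᵥ (W j *ᵥ v)‖ ^ 2 - sqNorm (W j *ᵥ v)) ≤
        1 / 10 * sqNorm v := by
  have hc2 : c ^ 2 = 1 := by rw [← sq_abs, hc, one_pow]
  set β : ℝ := s * μ₀ with hβdef
  have hq : ∀ j x v, quadForm (c • ((W j)ᴴ * fluctuation x * W j)) v =
      c * (‖star x ⬝ᵥ (W j *ᵥ v)‖ ^ 2 - sqNorm (W j *ᵥ v)) := fun j x v => by
    rw [quadForm_smul, quadForm_conj, quadForm_fluctuation]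
  have hsq : ∀ j v, 0 ≤ sqNorm (W j *ᵥ v) := fun j v => sqNorm_nonneg _
  obtain ⟨T, hT, hPT, hTv⟩ := matrix_bernstein (P := P) (b := b) hb.measurable hb.indep
    (isCompact_boundedVectors s μ₀) hb.ae_mem
    (Z := fun j x => c • ((W j)ᴴ * fluctuation x * W j)) (R := p * β)
    (V := fun j => (p * β) • ((W j)ᴴ * W j)) (σ := p * β) (t := 1 / 10)
    (fun j => ((continuous_const.matrix_mul continuous_fluctuation).matrix_mul
      continuous_const).const_smul c)
    (fun j x => (isHermitian_conjTranspose_mul_mul (W j) (fluctuation_isHermitian x)).smul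
      (by simp [IsSelfAdjoint]))
    (fun j i k => by
      simp only [Matrix.smul_apply]
      rw [integral_smul, hb.integral_mul_fluctuation_mul, smul_zero])
    (fun j x hx v => by
      rw [quadForm_smul, quadForm_conj, abs_mul, hc, one_mul]
      refine (abs_quadForm_fluctuation_le hβ (sqNorm_le_of_mem_boundedVectors hx) _).trans ?_
      nlinarith [hW j v])
    (fun j => (posSemidef_conjTranspose_mul_self (W j)).smul (by positivity))
    (fun j v => by
      rw [quadForm_smul, quadForm_conjTranspose_mul]
      have h1 := hW j v
      have h2 := mul_nonneg hp.le (sqNorm_nonneg v)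
      calc p * β * sqNorm (W j *ᵥ v) ≤ p * β * (p * sqNorm v) := by gcongr
        _ ≤ p * β * (β * (p * sqNorm v)) := by
          exact mul_le_mul_of_nonneg_left (le_mul_of_one_le_left h2 hβ) (by positivity)
        _ = _ := by ring)
    (fun j v => by
      rw [quadForm_smul, quadForm_conjTranspose_mul]
      calc ∫ ω, sqNorm ((c • ((W j)ᴴ * fluctuation (b j ω) * W j)) *ᵥ v) ∂P
          ≤ ∫ ω, p * sqNorm (fluctuation (b j ω) *ᵥ (W j *ᵥ v)) ∂P := by
            refine integral_mono ?_
              ((hb.integrable_sqNorm_fluctuation_mulVec j _).const_mul _) fun ω => ?_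
            · exact hb.integrable_comp j
                (f := fun x => sqNorm ((c • ((W j)ᴴ * fluctuation x * W j)) *ᵥ v))
                (IsSubspaceEnsemble.continuous_sqNorm.comp
                  ((((continuous_const.matrix_mul continuous_fluctuation).matrix_mul
                    continuous_const).const_smul c).matrix_mulVec continuous_const))
            · have e : sqNorm ((c • ((W j)ᴴ * fluctuation (b j ω) * W j)) *ᵥ v) =
                  sqNorm ((W j)ᴴ *ᵥ (fluctuation (b j ω) *ᵥ (W j *ᵥ v))) := by
                rw [smul_mulVec, ← mulVec_mulVec, ← mulVec_mulVec]
                simp only [sqNorm, Pi.smul_apply, norm_smul, mul_pow, Real.norm_eq_abs, hc]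
                simp
              simp only [e]
              exact sqNorm_conjTranspose_mulVec_le hp.le (hW j) _
        _ = p * ∫ ω, sqNorm (fluctuation (b j ω) *ᵥ (W j *ᵥ v)) ∂P := integral_const_mul _ _
        _ ≤ p * (β * sqNorm (W j *ᵥ v)) := by
          gcongr
          exact hb.integral_sqNorm_fluctuation_mulVec_le j _
        _ = _ := by ring)
    (fun v => by
      simp only [quadForm_smul, quadForm_conjTranspose_mul]
      rw [← Finset.mul_sum]
      gcongr
      exact hW' v)
    (by positivity) (by norm_num) (by positivity)
    (by nlinarith [mul_pos hp (by linarith : (0 : ℝ) < β)])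
  refine ⟨T, hT, hPT, fun ω hω v => ?_⟩
  have := hTv ω hω v
  rw [quadForm_sum] at this
  simp only [hq] at this
  rwa [← Finset.mul_sum] at this

/-- Isotropic measurements of a family of blocks concentrate around the total energy. -/
theorem exists_bad_event_restricted_isometry (hb : IsSubspaceEnsemble P b μ₀)
    (hβ : 1 ≤ s * μ₀) {W : Fin n → Matrix (Fin s) ι ℂ} {p : ℝ} (hp : 0 < p)
    (hW : ∀ j v, sqNorm (W j *ᵥ v) ≤ p * sqNorm v)
    (hW' : ∀ v, ∑ j, sqNorm (W j *ᵥ v) ≤ sqNorm v) :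
    ∃ T : Set Ω, MeasurableSet T ∧
      P.real T ≤ 2 * (Fintype.card ι * Real.exp (-((1 / 10) ^ 2 / (8 * (p * (s * μ₀)))))) ∧
      ∀ ω, ω ∉ T → ∀ v, |∑ j, (‖star (b j ω) ⬝ᵥ (W j *ᵥ v)‖ ^ 2 - sqNorm (W j *ᵥ v))| ≤
        1 / 10 * sqNorm v := by
  obtain ⟨T₁, h₁, hP₁, hT₁⟩ :=
    exists_bad_event_signed_restricted_isometry hb hβ hp hW hW' (c := 1) (by norm_num)
  obtain ⟨T₂, h₂, hP₂, hT₂⟩ :=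
    exists_bad_event_signed_restricted_isometry hb hβ hp hW hW' (c := -1) (by norm_num)
  refine ⟨T₁ ∪ T₂, h₁.union h₂, ?_, fun ω hω v => ?_⟩
  · linarith [measureReal_union_le (μ := P) T₁ T₂]
  · rw [Set.mem_union, not_or] at hω
    exact abs_le.2 ⟨by linarith [hT₂ ω hω.2 v], by linarith [hT₁ ω hω.1 v]⟩

end RestrictedIsometry
end BlindSR

/-! ### Concentration of the spectral matrix: dilations and antidiagonal lifts. -/

namespace BlindSR
open Matrix
open scoped ComplexOrder

theorem norm_sum_ite_sq_le {κ : Type*} [Fintype κ] {p : κ → Prop} [DecidablePred p]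
    (hp : ∀ x y, p x → p y → x = y) (f : κ → ℂ) :
    ‖∑ x, if p x then f x else 0‖ ^ 2 ≤ ∑ x, if p x then ‖f x‖ ^ 2 else 0 := by
  by_cases h : ∃ x, p x
  · obtain ⟨x, hx⟩ := h
    have h0 : ∀ y, y ≠ x → ¬ p y := fun y hy hpy => hy (hp y x hpy hx)
    rw [Finset.sum_eq_single x (fun y _ hy => if_neg (h0 y hy)) (by simp),
      Finset.sum_eq_single x (fun y _ hy => if_neg (h0 y hy)) (by simp), if_pos hx, if_pos hx]
  · have h0 : ∀ y, ¬ p y := fun y hy => h ⟨y, hy⟩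
    simp [h0]

theorem sum_ite_one_le {κ : Type*} [Fintype κ] {p : κ → Prop} [DecidablePred p]
    (hp : ∀ x y, p x → p y → x = y) : ∑ x, (if p x then 1 else 0 : ℝ) ≤ 1 := by
  rw [Finset.sum_boole]
  have : (Finset.univ.filter p).card ≤ 1 := Finset.card_le_one.2 fun x hx y hy =>
    hp x y (Finset.mem_filter.1 hx).2 (Finset.mem_filter.1 hy).2
  exact_mod_cast this

theorem quadForm_diagonal {m : Type*} [Fintype m] [DecidableEq m] (d : m → ℝ) (u : m → ℂ) :
    quadForm (diagonal fun i => (d i : ℂ)) u = ∑ i, d i * ‖u i‖ ^ 2 := by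
  simp only [quadForm, dotProduct, mulVec_diagonal, Complex.re_sum]
  refine Finset.sum_congr rfl fun i _ => ?_
  rw [Pi.star_apply, mul_left_comm, Complex.star_def, Complex.conj_mul', ← Complex.ofReal_pow,
    ← Complex.ofReal_mul, Complex.ofReal_re]

theorem sqNorm_sum {m k : Type*} [Fintype m] [Fintype k] (u : m ⊕ k → ℂ) :
    sqNorm u = sqNorm (u ∘ Sum.inl) + sqNorm (u ∘ Sum.inr) := by
  simp [sqNorm, Fintype.sum_sum_type]

/-- The Hermitian dilation of a rectangular matrix. -/
def dilation {m k : Type*} (A : Matrix m k ℂ) : Matrix (m ⊕ k) (m ⊕ k) ℂ :=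
  fromBlocks 0 A Aᴴ 0

theorem dilation_isHermitian {m k : Type*} (A : Matrix m k ℂ) : (dilation A).IsHermitian := by
  rw [dilation, isHermitian_fromBlocks_iff]
  simp

theorem dilation_sum {m k ι : Type*} (S : Finset ι) (A : ι → Matrix m k ℂ) :
    ∑ i ∈ S, dilation (A i) = dilation (∑ i ∈ S, A i) := by
  ext (i | i) (j | j) <;> simp [dilation, Matrix.sum_apply]

theorem sqNorm_dilation_mulVec {m k : Type*} [Fintype m] [Fintype k] (A : Matrix m k ℂ)
    (u : m ⊕ k → ℂ) :
    sqNorm (dilation A *ᵥ u) = sqNorm (A *ᵥ (u ∘ Sum.inr)) + sqNorm (Aᴴ *ᵥ (u ∘ Sum.inl)) := by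
  rw [dilation, fromBlocks_mulVec, sqNorm_sum]
  simp

theorem quadForm_dilation {m k : Type*} [Fintype m] [Fintype k] (A : Matrix m k ℂ)
    (x : m → ℂ) (y : k → ℂ) :
    quadForm (dilation A) (Sum.elim x y) = 2 * (star x ⬝ᵥ A *ᵥ y).re := by
  have h : star y ⬝ᵥ Aᴴ *ᵥ x = conj (star x ⬝ᵥ A *ᵥ y) := by
    rw [dotProduct_mulVec, ← star_mulVec, ← Complex.star_def, star_dotProduct]
  rw [quadForm, dilation, fromBlocks_mulVec]
  have e : star (Sum.elim x y) = Sum.elim (star x) (star y) := by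
    ext (i | i) <;> rfl
  rw [e]
  simp only [Sum.elim_comp_inl, Sum.elim_comp_inr, zero_mulVec, zero_add, add_zero,
    sumElim_dotProduct_sumElim, h, Complex.add_re, Complex.conj_re]
  ring

theorem abs_quadForm_le_of_sqNorm_le {m : Type*} [Fintype m] {A : Matrix m m ℂ} {u : m → ℂ}
    {ρ : ℝ} (hρ : 0 ≤ ρ) (h : sqNorm (A *ᵥ u) ≤ ρ ^ 2 * sqNorm u) :
    |quadForm A u| ≤ ρ * sqNorm u := by
  have h1 : |quadForm A u| ≤ ‖star u ⬝ᵥ A *ᵥ u‖ := Complex.abs_re_le_norm _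
  refine abs_le_of_sq_le_sq (a := |quadForm A u|) ?_ (mul_nonneg hρ (sqNorm_nonneg u)) |> le_trans
    (le_abs_self _)
  calc |quadForm A u| ^ 2 ≤ ‖star u ⬝ᵥ A *ᵥ u‖ ^ 2 := pow_le_pow_left₀ (abs_nonneg _) h1 2
    _ ≤ sqNorm u * sqNorm (A *ᵥ u) := norm_star_dotProduct_sq_le _ _
    _ ≤ sqNorm u * (ρ ^ 2 * sqNorm u) := mul_le_mul_of_nonneg_left h (sqNorm_nonneg u)
    _ = _ := by ring

theorem sqNorm_smul {m : Type*} [Fintype m] (c : ℂ) (v : m → ℂ) :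
    sqNorm (c • v) = ‖c‖ ^ 2 * sqNorm v := by
  simp [sqNorm, mul_pow, Finset.mul_sum]

/-- Testing the dilation on the pair `(t⁻¹ A y, y)` isolates `‖A y‖²` with the right constant. -/
theorem isBoundedAbove_of_quadForm_dilation_le {m k : Type*} [Fintype m] [Fintype k]
    {A : Matrix m k ℂ} {t : ℝ} (ht : 0 < t) (h : ∀ u, quadForm (dilation A) u ≤ t * sqNorm u) :
    IsBoundedAbove A t := by
  intro x
  set y : k → ℂ := fun i => x i 0 with hy
  have e1 : ‖A * x‖ ^ 2 = sqNorm (A *ᵥ y) := by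
    rw [frobenius_norm_sq]
    simp [sqNorm, mul_apply, mulVec, dotProduct, hy]
  have e2 : ‖x‖ ^ 2 = sqNorm y := by
    rw [frobenius_norm_sq]
    simp [sqNorm, hy]
  have h1 := h (Sum.elim (((t⁻¹ : ℝ) : ℂ) • A *ᵥ y) y)
  rw [quadForm_dilation, sqNorm_sum, Sum.elim_comp_inl, Sum.elim_comp_inr, sqNorm_smul, star_smul,
    smul_dotProduct, star_dotProduct_self, ← e1, ← e2] at h1
  have h2 : ((star ((t⁻¹ : ℝ) : ℂ)) • ((‖A * x‖ ^ 2 : ℝ) : ℂ)).re = t⁻¹ * ‖A * x‖ ^ 2 := by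
    rw [Complex.star_def, Complex.conj_ofReal, smul_eq_mul, ← Complex.ofReal_mul,
      Complex.ofReal_re]
  rw [h2, Complex.norm_real, Real.norm_of_nonneg (inv_nonneg.2 ht.le)] at h1
  have h3 : t * (t⁻¹ ^ 2 * ‖A * x‖ ^ 2 + ‖x‖ ^ 2) = t⁻¹ * ‖A * x‖ ^ 2 + t * ‖x‖ ^ 2 := by
    field_simp
  rw [h3] at h1
  have h4 : t⁻¹ * ‖A * x‖ ^ 2 ≤ t * ‖x‖ ^ 2 := by linarith
  rw [inv_mul_le_iff₀ ht] at h4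
  refine (sq_le_sq₀ (norm_nonneg _) (by positivity)).1 ?_
  rw [mul_pow]
  linarith

section Antidiagonal
variable {s n n₁ n₂ : ℕ}

/-- The block matrix carrying the vector `v` on the `j`-th block antidiagonal. -/
def antidiagonalLift (n₁ n₂ : ℕ) (j : ℕ) (v : Fin s → ℂ) : Matrix (Fin n₁ × Fin s) (Fin n₂) ℂ :=
  Matrix.of fun p c => if (p.1 : ℕ) + c = j then v p.2 else 0

theorem sum_antidiagonalLift (hn : n₁ + n₂ = n + 1) (v : Fin n → Fin s → ℂ) :
    ∑ j : Fin n, antidiagonalLift n₁ n₂ j (v j) = hankel hn (Matrix.of fun l j => v j l) := by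
  ext ⟨a, l⟩ c
  rw [Matrix.sum_apply, Finset.sum_eq_single ⟨a + c, by omega⟩]
  · simp [antidiagonalLift, hankel]
  · intro j _ hj
    rw [antidiagonalLift, of_apply, if_neg]
    exact fun h => hj (Fin.ext h.symm)
  · simp

theorem continuous_antidiagonalLift (j : ℕ) :
    Continuous (antidiagonalLift n₁ n₂ j : (Fin s → ℂ) → _) := by
  refine continuous_matrix fun p c => ?_
  simp only [antidiagonalLift, of_apply]
  split_ifs <;> fun_prop

/-- The indicator of the rows and columns met by the `j`-th block antidiagonal. -/
def antidiagonalSupport (s n₁ n₂ j : ℕ) : (Fin n₁ × Fin s) ⊕ Fin n₂ → ℝ :=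
  Sum.elim (fun p => ∑ c : Fin n₂, if (p.1 : ℕ) + c = j then 1 else 0)
    fun c => ∑ a : Fin n₁, if (a : ℕ) + c = j then 1 else 0

theorem antidiagonalSupport_nonneg (j : ℕ) (i) : 0 ≤ antidiagonalSupport s n₁ n₂ j i := by
  rcases i with p | c <;> simp only [antidiagonalSupport, Sum.elim_inl, Sum.elim_inr] <;>
    exact Finset.sum_nonneg fun x _ => by split_ifs <;> norm_num

theorem antidiagonalSupport_le_one (j : ℕ) (i) : antidiagonalSupport s n₁ n₂ j i ≤ 1 := by
  rcases i with p | c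
  · exact sum_ite_one_le fun x y hx hy => Fin.ext (by omega)
  · exact sum_ite_one_le fun x y hx hy => Fin.ext (by omega)

/-- An antidiagonal meets each block row and each column at most once, so every block of the image
is a single multiple of `v` and no cross terms arise. -/
theorem sqNorm_antidiagonalLift_mulVec_le (j : ℕ) (v : Fin s → ℂ) (w : Fin n₂ → ℂ) :
    sqNorm (antidiagonalLift n₁ n₂ j v *ᵥ w) ≤
      sqNorm v * ∑ c, antidiagonalSupport s n₁ n₂ j (Sum.inr c) * ‖w c‖ ^ 2 := by
  have h : ∀ a l, ‖(antidiagonalLift n₁ n₂ j v *ᵥ w) (a, l)‖ ^ 2 ≤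
      ‖v l‖ ^ 2 * ∑ c : Fin n₂, if (a : ℕ) + c = j then ‖w c‖ ^ 2 else 0 := fun a l => by
    have e : (antidiagonalLift n₁ n₂ j v *ᵥ w) (a, l) =
        v l * ∑ c : Fin n₂, if (a : ℕ) + c = j then w c else 0 := by
      simp [antidiagonalLift, mulVec, dotProduct, Finset.mul_sum]
    rw [e, norm_mul, mul_pow]
    gcongr
    exact norm_sum_ite_sq_le (fun x y hx hy => Fin.ext (by omega)) _
  rw [sqNorm, Fintype.sum_prod_type]
  refine (Finset.sum_le_sum fun a _ => Finset.sum_le_sum fun l _ => h a l).trans (le_of_eq ?_)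
  simp only [← Finset.sum_mul]
  rw [← Finset.mul_sum, Finset.sum_comm, sqNorm]
  congr 1
  refine Finset.sum_congr rfl fun c _ => ?_
  simp only [antidiagonalSupport, Sum.elim_inr, Finset.sum_mul, ite_mul, one_mul, zero_mul]

theorem sqNorm_antidiagonalLift_conjTranspose_mulVec_le (j : ℕ) (v : Fin s → ℂ)
    (u : Fin n₁ × Fin s → ℂ) :
    sqNorm ((antidiagonalLift n₁ n₂ j v)ᴴ *ᵥ u) ≤
      sqNorm v * ∑ p, antidiagonalSupport s n₁ n₂ j (Sum.inl p) * ‖u p‖ ^ 2 := by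
  have h : ∀ c : Fin n₂, ‖((antidiagonalLift n₁ n₂ j v)ᴴ *ᵥ u) c‖ ^ 2 ≤
      ∑ a : Fin n₁, if (a : ℕ) + c = j then sqNorm v * sqNorm (fun l => u (a, l)) else 0 := by
    intro c
    have e : ((antidiagonalLift n₁ n₂ j v)ᴴ *ᵥ u) c =
        ∑ a : Fin n₁, if (a : ℕ) + c = j then ∑ l, conj (v l) * u (a, l) else 0 := by
      rw [mulVec, dotProduct, Fintype.sum_prod_type]
      refine Finset.sum_congr rfl fun a _ => ?_
      split_ifs with hac <;> simp [antidiagonalLift, hac]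
    rw [e]
    refine (norm_sum_ite_sq_le (fun x y hx hy => Fin.ext (by omega)) _).trans ?_
    refine Finset.sum_le_sum fun a _ => ?_
    split_ifs
    · exact norm_dotProduct_sq_le _ _
    · exact le_rfl
  refine (Finset.sum_le_sum fun c _ => h c).trans (le_of_eq ?_)
  rw [Finset.sum_comm, Fintype.sum_prod_type, Finset.mul_sum]
  refine Finset.sum_congr rfl fun a _ => ?_
  have e : ∀ l, antidiagonalSupport s n₁ n₂ j (Sum.inl (a, l)) =
      ∑ c : Fin n₂, if (a : ℕ) + c = j then 1 else 0 := fun _ => rfl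
  simp only [e]
  rw [← Finset.mul_sum, mul_left_comm, Finset.sum_mul]
  refine Finset.sum_congr rfl fun c _ => ?_
  split_ifs <;> simp [sqNorm]

theorem sqNorm_dilation_antidiagonalLift_mulVec_le (j : ℕ) (v : Fin s → ℂ)
    (u : (Fin n₁ × Fin s) ⊕ Fin n₂ → ℂ) :
    sqNorm (dilation (antidiagonalLift n₁ n₂ j v) *ᵥ u) ≤
      sqNorm v * ∑ i, antidiagonalSupport s n₁ n₂ j i * ‖u i‖ ^ 2 := by
  rw [sqNorm_dilation_mulVec, Fintype.sum_sum_type, mul_add, add_comm]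
  exact add_le_add (sqNorm_antidiagonalLift_conjTranspose_mulVec_le _ _ _)
    (sqNorm_antidiagonalLift_mulVec_le _ _ _)

theorem sum_antidiagonalSupport_mul_le (j : ℕ) (u : (Fin n₁ × Fin s) ⊕ Fin n₂ → ℂ) :
    ∑ i, antidiagonalSupport s n₁ n₂ j i * ‖u i‖ ^ 2 ≤ sqNorm u :=
  Finset.sum_le_sum fun i _ =>
    mul_le_of_le_one_left (sq_nonneg _) (antidiagonalSupport_le_one j i)

theorem sum_mul_ite_eq {n : ℕ} (f : Fin n → ℝ) (k : ℕ) (hk : k < n) :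
    ∑ j : Fin n, f j * (if k = j then 1 else 0) = f ⟨k, hk⟩ := by
  rw [Finset.sum_eq_single ⟨k, hk⟩]
  · simp
  · intro j _ hj
    rw [if_neg, mul_zero]
    exact fun h => hj (Fin.ext h.symm)
  · simp

variable {Ω : Type*} [MeasurableSpace Ω] {P : Measure Ω} [IsProbabilityMeasure P]
  {b : Fin n → Ω → Fin s → ℂ} {μ₀ : ℝ}

/-- Concentration of the lifted back-projection of subspace measurements around the lift. -/
theorem exists_bad_event_hankel (hb : IsSubspaceEnsemble P b μ₀) (hβ : 1 ≤ s * μ₀)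
    (hn : n₁ + n₂ = n + 1) (x : Fin n → Fin s → ℂ) {ρ Λ t : ℝ} (hρ : 0 ≤ ρ) (hΛ : 0 < Λ)
    (ht : 0 < t) (hx : ∀ j, sqNorm (x j) ≤ ρ ^ 2)
    (hrow : ∀ a : Fin n₁, ∑ c : Fin n₂, sqNorm (x ⟨a + c, by omega⟩) ≤ Λ)
    (hcol : ∀ c : Fin n₂, ∑ a : Fin n₁, sqNorm (x ⟨a + c, by omega⟩) ≤ Λ)
    (hρt : ρ * t ≤ 2 * Λ) :
    ∃ T : Set Ω, MeasurableSet T ∧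
      P.real T ≤ Fintype.card ((Fin n₁ × Fin s) ⊕ Fin n₂) *
        Real.exp (-(t ^ 2 / (8 * (s * μ₀ * Λ)))) ∧
      ∀ ω, ω ∉ T →
        IsBoundedAbove (hankel hn (Matrix.of fun l j => (fluctuation (b j ω) *ᵥ x j) l)) t := by
  set β : ℝ := s * μ₀ with hβdef
  have hβ0 : 0 < β := by linarith
  have hsupp : ∀ (j : Fin n) (u : (Fin n₁ × Fin s) ⊕ Fin n₂ → ℂ),
      0 ≤ ∑ i, antidiagonalSupport s n₁ n₂ j i * ‖u i‖ ^ 2 := fun j u =>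
    Finset.sum_nonneg fun i _ => mul_nonneg (antidiagonalSupport_nonneg _ _) (sq_nonneg _)
  have hquad : ∀ (j : Fin n) u, quadForm (diagonal fun i =>
      ((β * sqNorm (x j) * antidiagonalSupport s n₁ n₂ j i : ℝ) : ℂ)) u =
      β * sqNorm (x j) * ∑ i, antidiagonalSupport s n₁ n₂ j i * ‖u i‖ ^ 2 := fun j u => by
    rw [quadForm_diagonal, Finset.mul_sum]
    exact Finset.sum_congr rfl fun i _ => by ring
  have hcont : ∀ j : Fin n, Continuous fun z : Fin s → ℂ =>
      dilation (antidiagonalLift n₁ n₂ j (fluctuation z *ᵥ x j)) := fun j => by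
    have h := (continuous_antidiagonalLift (n₁ := n₁) (n₂ := n₂) (j : ℕ)).comp
      ((continuous_fluctuation (s := s)).matrix_mulVec (continuous_const (y := x j)))
    exact Continuous.matrix_fromBlocks continuous_const h h.matrix_conjTranspose continuous_const
  -- The second moment of each dilated lift is dominated by a diagonal matrix supported on the rows
  -- and columns its antidiagonal meets. Summed over `j`, the diagonal entries become `β` times the
  -- row and column energies, hence at most `βΛ`.
  obtain ⟨T, hT, hPT, hTv⟩ := matrix_bernstein (P := P) (b := b) hb.measurable hb.indep
    (isCompact_boundedVectors s μ₀) hb.ae_mem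
    (Z := fun j z => dilation (antidiagonalLift n₁ n₂ j (fluctuation z *ᵥ x j)))
    (R := β * ρ)
    (V := fun j => diagonal fun i =>
      ((β * sqNorm (x j) * antidiagonalSupport s n₁ n₂ j i : ℝ) : ℂ))
    (σ := β * Λ) (t := t) hcont
    (fun j z => dilation_isHermitian _)
    (fun j i k => by
      have h0 : ∀ (p : Fin n₁ × Fin s) (c : Fin n₂),
          ∫ ω, antidiagonalLift n₁ n₂ j (fluctuation (b j ω) *ᵥ x j) p c ∂P = 0 := fun p c => by
        simp only [antidiagonalLift, of_apply]
        split_ifs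
        · exact hb.integral_mulVec_fluctuation j _ _
        · simp
      rcases i with p | c <;> rcases k with p' | c'
      · simp [dilation]
      · simpa [dilation] using h0 p c'
      · have := h0 p' c
        simp only [dilation, fromBlocks_apply₂₁, conjTranspose_apply, RCLike.star_def]
        rw [integral_conj, this, map_zero]
      · simp [dilation])
    (fun j z hz v => by
      refine abs_quadForm_le_of_sqNorm_le (by positivity) ?_
      have h1 := sqNorm_fluctuation_mulVec_le hβ (sqNorm_le_of_mem_boundedVectors hz) (x j)
      calc sqNorm (dilation (antidiagonalLift n₁ n₂ j (fluctuation z *ᵥ x j)) *ᵥ v)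
          ≤ sqNorm (fluctuation z *ᵥ x j) *
            ∑ i, antidiagonalSupport s n₁ n₂ j i * ‖v i‖ ^ 2 :=
            sqNorm_dilation_antidiagonalLift_mulVec_le _ _ _
        _ ≤ (β ^ 2 * ρ ^ 2) * sqNorm v := by
          refine mul_le_mul (h1.trans ?_) (sum_antidiagonalSupport_mul_le _ _) (hsupp j v)
            (by positivity)
          exact mul_le_mul_of_nonneg_left (hx j) (by positivity)
        _ = _ := by ring)
    (fun j => PosSemidef.diagonal fun i => by
      have := mul_nonneg (mul_nonneg hβ0.le (sqNorm_nonneg (x j)))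
        (antidiagonalSupport_nonneg (s := s) (n₁ := n₁) (n₂ := n₂) j i)
      simpa only [Pi.zero_apply, Complex.zero_le_real] using this)
    (fun j v => by
      rw [hquad]
      refine mul_le_mul ?_ (sum_antidiagonalSupport_mul_le _ _) (hsupp j v) (by positivity)
      calc β * sqNorm (x j) ≤ β * ρ ^ 2 := mul_le_mul_of_nonneg_left (hx j) hβ0.le
        _ ≤ β * (β * ρ ^ 2) := by
          gcongr
          exact le_mul_of_one_le_left (sq_nonneg ρ) hβ
        _ = _ := by ring)
    (fun j v => by
      rw [hquad]
      calc ∫ ω, sqNorm (dilation (antidiagonalLift n₁ n₂ j (fluctuation (b j ω) *ᵥ x j)) *ᵥ v) ∂P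
          ≤ ∫ ω, sqNorm (fluctuation (b j ω) *ᵥ x j) *
              ∑ i, antidiagonalSupport s n₁ n₂ j i * ‖v i‖ ^ 2 ∂P := by
            refine integral_mono ?_
              ((hb.integrable_sqNorm_fluctuation_mulVec j _).mul_const _) fun ω =>
                sqNorm_dilation_antidiagonalLift_mulVec_le _ _ _
            exact hb.integrable_comp j (f := fun z => sqNorm (dilation
              (antidiagonalLift n₁ n₂ j (fluctuation z *ᵥ x j)) *ᵥ v))
              (IsSubspaceEnsemble.continuous_sqNorm.comp
                ((hcont j).matrix_mulVec continuous_const))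
        _ = (∫ ω, sqNorm (fluctuation (b j ω) *ᵥ x j) ∂P) *
              ∑ i, antidiagonalSupport s n₁ n₂ j i * ‖v i‖ ^ 2 := integral_mul_const _ _
        _ ≤ _ := mul_le_mul_of_nonneg_right
          (hb.integral_sqNorm_fluctuation_mulVec_le j _) (hsupp j v))
    (fun v => by
      have hi : ∀ i, ∑ j : Fin n, sqNorm (x j) * antidiagonalSupport s n₁ n₂ j i ≤ Λ := by
        rintro (p | c)
        · simp only [antidiagonalSupport, Sum.elim_inl, Finset.mul_sum]
          rw [Finset.sum_comm]
          refine le_trans (le_of_eq (Finset.sum_congr rfl fun c _ => ?_)) (hrow p.1)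
          exact sum_mul_ite_eq (fun j => sqNorm (x j)) _ _
        · simp only [antidiagonalSupport, Sum.elim_inr, Finset.mul_sum]
          rw [Finset.sum_comm]
          refine le_trans (le_of_eq (Finset.sum_congr rfl fun a _ => ?_)) (hcol c)
          exact sum_mul_ite_eq (fun j => sqNorm (x j)) _ _
      simp only [hquad, Finset.mul_sum]
      rw [Finset.sum_comm, sqNorm, Finset.mul_sum]
      refine Finset.sum_le_sum fun i _ => ?_
      have e : ∑ j : Fin n, β * sqNorm (x j) * (antidiagonalSupport s n₁ n₂ j i * ‖v i‖ ^ 2) =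
          β * (∑ j : Fin n, sqNorm (x j) * antidiagonalSupport s n₁ n₂ j i) * ‖v i‖ ^ 2 := by
        rw [Finset.mul_sum, Finset.sum_mul]
        exact Finset.sum_congr rfl fun j _ => by ring
      rw [e]
      gcongr
      exact hi i)
    (by positivity) ht.le (by positivity) (by nlinarith)
  refine ⟨T, hT, hPT, fun ω hω => isBoundedAbove_of_quadForm_dilation_le ht fun u => ?_⟩
  have := hTv ω hω u
  rwa [dilation_sum, sum_antidiagonalLift hn] at this

/-- The weight `√w_j` in the measurements cancels the `1/√w_j` in `𝒢`, so the spectral matrix is the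
unweighted lift of the columns `bⱼbⱼᴴxⱼ`, and its error is linear in the centred fluctuations. -/
theorem opG_opAAdj_measurements_sub (hn : n₁ + n₂ = n + 1) (h₁ : 0 < n₁) (h₂ : 0 < n₂)
    (b : Fin n → Fin s → ℂ) (X : Matrix (Fin s) (Fin n) ℂ) :
    opG hn (opAAdj b (measurements n₁ n₂ b X)) - hankel hn X =
      hankel hn (Matrix.of fun l j => (fluctuation (b j) *ᵥ fun l => X l j) l) := by
  ext ⟨a, l⟩ c
  have h0 := ofReal_sqrt_weight_ne_zero hn h₁ h₂ ⟨a + c, by omega⟩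
  have e : ∀ j : Fin n, measurements n₁ n₂ b X j = (Real.sqrt (weight n₁ n₂ j) : ℂ) *
      (star (b j) ⬝ᵥ fun l => X l j) := fun j => by
    simp [measurements, opA, scale, dotProduct, Finset.mul_sum, mul_left_comm]
  simp only [Matrix.sub_apply, opG_apply, hankel, of_apply, fluctuation_mulVec, Pi.sub_apply,
    Pi.smul_apply, smul_eq_mul, opAAdj, e, mul_assoc]
  rw [inv_mul_cancel_left₀ h0]

end Antidiagonal
end BlindSR

/-! ### Consequences of incoherence. -/

namespace BlindSR
open Matrix

section IncoherentLift
variable {s n n₁ n₂ r : ℕ}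

theorem sum_antidiagonal_snd_le (j : ℕ) {f : Fin n₂ → ℝ} (hf : ∀ c, 0 ≤ f c) :
    ∑ q : Fin n₁ × Fin n₂ with (q.1 : ℕ) + q.2 = j, f q.2 ≤ ∑ c, f c := by
  rw [← Finset.sum_image (g := Prod.snd) (f := f)]
  · exact Finset.sum_le_univ_sum_of_nonneg hf
  · intro x hx y hy h
    have h1 := (Finset.mem_filter.1 (Finset.mem_coe.1 hx)).2
    have h2 := (Finset.mem_filter.1 (Finset.mem_coe.1 hy)).2
    have h3 : (x.2 : ℕ) = y.2 := congrArg _ h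
    exact Prod.ext (Fin.ext (by omega)) h

theorem sum_antidiagonal_fst_le (j : ℕ) {f : Fin n₁ → ℝ} (hf : ∀ a, 0 ≤ f a) :
    ∑ q : Fin n₁ × Fin n₂ with (q.1 : ℕ) + q.2 = j, f q.1 ≤ ∑ a, f a := by
  rw [← Finset.sum_image (g := Prod.fst) (f := f)]
  · exact Finset.sum_le_univ_sum_of_nonneg hf
  · intro x hx y hy h
    have h1 := (Finset.mem_filter.1 (Finset.mem_coe.1 hx)).2
    have h2 := (Finset.mem_filter.1 (Finset.mem_coe.1 hy)).2
    have h3 : (x.1 : ℕ) = y.1 := congrArg _ h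
    exact Prod.ext h (Fin.ext (by omega))

/-- Cauchy–Schwarz over the `w_j` entries of the antidiagonal produces exactly the factor cancelled
by the normalisation `1/w_j`. -/
theorem sqNorm_opGAdj_le (M : Matrix (Fin n₁ × Fin s) (Fin n₂) ℂ) (j : Fin n) :
    sqNorm (fun l => opGAdj M l j) ≤
      ∑ q : Fin n₁ × Fin n₂ with (q.1 : ℕ) + q.2 = j, sqNorm fun l => M (q.1, l) q.2 := by
  simp only [sqNorm]
  rw [Finset.sum_comm]
  refine Finset.sum_le_sum fun l _ => ?_
  rw [opGAdj_apply, norm_mul, mul_pow, norm_inv, Complex.norm_real,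
    Real.norm_of_nonneg (Real.sqrt_nonneg _), inv_pow, Real.sq_sqrt (Nat.cast_nonneg _)]
  have h1 : ‖∑ q : Fin n₁ × Fin n₂ with (q.1 : ℕ) + q.2 = j, M (q.1, l) q.2‖ ^ 2 ≤
      weight n₁ n₂ j * ∑ q : Fin n₁ × Fin n₂ with (q.1 : ℕ) + q.2 = j, ‖M (q.1, l) q.2‖ ^ 2 :=
    (pow_le_pow_left₀ (norm_nonneg _) (norm_sum_le _ _) 2).trans sq_sum_le_card_mul_sum_sq
  refine (mul_le_mul_of_nonneg_left h1 (by positivity)).trans ?_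
  rw [← mul_assoc]
  exact mul_le_of_le_one_left (by positivity) inv_mul_le_one

theorem sqNorm_block_mul_le (U : Matrix (Fin n₁ × Fin s) (Fin r) ℂ) (N : Matrix (Fin r) (Fin n₂) ℂ)
    (a : Fin n₁) (c : Fin n₂) : (sqNorm fun l => (U * N) (a, l) c) ≤
      (∑ l, ∑ k, ‖U (a, l) k‖ ^ 2) * ∑ k, ‖N k c‖ ^ 2 := by
  rw [sqNorm, Finset.sum_mul]
  refine Finset.sum_le_sum fun l _ => ?_
  have h := norm_star_dotProduct_sq_le (fun k => star (U (a, l) k)) fun k => N k c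
  simpa [dotProduct, sqNorm, mul_apply] using h

theorem sqNorm_add_le {m : Type*} [Fintype m] (u v : m → ℂ) :
    sqNorm (u + v) ≤ 2 * sqNorm u + 2 * sqNorm v := by
  simp only [sqNorm, Finset.mul_sum, ← Finset.sum_add_distrib]
  refine Finset.sum_le_sum fun i _ => ?_
  have h := pow_le_pow_left₀ (norm_nonneg _) (norm_add_le (u i) (v i)) 2
  rw [Pi.add_apply]
  nlinarith [sq_nonneg (‖u i‖ - ‖v i‖)]

theorem sub_normalPart_eq (U : Matrix (Fin n₁ × Fin s) (Fin r) ℂ) (V : Matrix (Fin n₂) (Fin r) ℂ)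
    (M : Matrix (Fin n₁ × Fin s) (Fin n₂) ℂ) :
    M - normalPart U V M = U * (Uᴴ * M) + (1 - U * Uᴴ) * M * V * Vᴴ := by
  rw [normalPart, Matrix.mul_sub, Matrix.mul_one, Matrix.sub_mul 1 (U * Uᴴ) M, Matrix.one_mul,
    ← Matrix.mul_assoc U, Matrix.mul_assoc _ V Vᴴ]
  abel

theorem frobenius_norm_sq_eq_sum_columns {m k : Type*} [Fintype m] [Fintype k]
    (A : Matrix m k ℂ) : ‖A‖ ^ 2 = ∑ c, ∑ i, ‖A i c‖ ^ 2 := by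
  rw [frobenius_norm_sq, Finset.sum_comm]

/-- Every column of `𝒢*` of a tangent matrix carries little energy. -/
theorem Incoherent.sqNorm_opGAdj_tangent_le {μ₁ : ℝ} {U : Matrix (Fin n₁ × Fin s) (Fin r) ℂ}
    {V : Matrix (Fin n₂) (Fin r) ℂ} (h : Incoherent n μ₁ U V) (hU : Uᴴ * U = 1) (hV : Vᴴ * V = 1)
    (hμ : 0 ≤ μ₁) (M : Matrix (Fin n₁ × Fin s) (Fin n₂) ℂ) (j : Fin n) :
    sqNorm (fun l => opGAdj (M - normalPart U V M) l j) ≤ 4 * (μ₁ * r / n) * ‖M‖ ^ 2 := by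
  set q := μ₁ * r / n with hq
  have hq0 : 0 ≤ q := by positivity
  set N := Uᴴ * M with hN
  set C := (1 - U * Uᴴ) * M * V with hC
  have hNM : ‖N‖ ^ 2 ≤ ‖M‖ ^ 2 :=
    pow_le_pow_left₀ (norm_nonneg _) (norm_conjTranspose_mul_le_of_orthonormal hU M) 2
  have hCM : ‖C‖ ^ 2 ≤ ‖M‖ ^ 2 := pow_le_pow_left₀ (norm_nonneg _)
    ((norm_mul_le_of_orthonormal hV _).trans (norm_one_sub_mul_le_of_orthonormal hU M)) 2
  -- A tangent matrix is `U N + C Vᴴ`. In each block incoherence bounds the `U` or `V` factor,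
  -- leaving one column of `N` and one block row of `C`; along an antidiagonal these are all
  -- distinct, so they sum to at most `‖N‖²` and `‖C‖²`.
  have hT : ∀ (a : Fin n₁) (c : Fin n₂), (sqNorm fun l => (M - normalPart U V M) (a, l) c) ≤
      2 * q * ∑ k, ‖N k c‖ ^ 2 + 2 * q * ∑ l, ∑ k, ‖C (a, l) k‖ ^ 2 := fun a c => by
    rw [sub_normalPart_eq]
    have h1 : (sqNorm fun l => (U * N) (a, l) c) ≤ q * ∑ k, ‖N k c‖ ^ 2 :=
      (sqNorm_block_mul_le U N a c).trans
        (mul_le_mul_of_nonneg_right (h.1 a) (by positivity))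
    have h2 : (sqNorm fun l => (C * Vᴴ) (a, l) c) ≤ (∑ l, ∑ k, ‖C (a, l) k‖ ^ 2) * q := by
      refine (sqNorm_block_mul_le C Vᴴ a c).trans
        (mul_le_mul_of_nonneg_left ?_ (by positivity))
      simpa using h.2 c
    have h3 := sqNorm_add_le (fun l => (U * N) (a, l) c) fun l => (C * Vᴴ) (a, l) c
    have e : (fun l => (U * N + C * Vᴴ) (a, l) c) =
        (fun l => (U * N) (a, l) c) + fun l => (C * Vᴴ) (a, l) c := rfl
    rw [e]
    linarith
  refine (sqNorm_opGAdj_le _ j).trans ((Finset.sum_le_sum fun p _ => hT p.1 p.2).trans ?_)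
  rw [Finset.sum_add_distrib, ← Finset.mul_sum, ← Finset.mul_sum]
  have h1 := sum_antidiagonal_snd_le (n₁ := n₁) (j : ℕ) (f := fun c => ∑ k, ‖N k c‖ ^ 2)
    fun c => by positivity
  have h2 := sum_antidiagonal_fst_le (n₂ := n₂) (j : ℕ)
    (f := fun a => ∑ l, ∑ k, ‖C (a, l) k‖ ^ 2) fun a => by positivity
  rw [← frobenius_norm_sq_eq_sum_columns] at h1
  have e2 : ∑ a, ∑ l, ∑ k, ‖C (a, l) k‖ ^ 2 = ‖C‖ ^ 2 := by
    rw [frobenius_norm_sq, Fintype.sum_prod_type]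
  rw [e2] at h2
  nlinarith [mul_le_mul_of_nonneg_left (h1.trans hNM) hq0,
    mul_le_mul_of_nonneg_left (h2.trans hCM) hq0]

/-- The map taking a vectorized matrix to the `j`-th column of `𝒢*` of its tangent part. -/
noncomputable def tangentColumn (n : ℕ) (U : Matrix (Fin n₁ × Fin s) (Fin r) ℂ)
    (V : Matrix (Fin n₂) (Fin r) ℂ) (j : Fin n) :
    Matrix (Fin s) ((Fin n₁ × Fin s) × Fin n₂) ℂ :=
  LinearMap.toMatrix' (n := (Fin n₁ × Fin s) × Fin n₂)
    { toFun := fun v l => (opGAdj (Matrix.of (Function.curry v) -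
        normalPart U V (Matrix.of (Function.curry v))) : Matrix (Fin s) (Fin n) ℂ) l j
      map_add' := fun v w => by
        have e : Matrix.of (Function.curry (v + w)) = Matrix.of (Function.curry v) +
          Matrix.of (Function.curry w) := rfl
        funext l
        rw [e, Pi.add_apply, ← Matrix.add_apply, ← opGAdj_add]
        congr 1
        rw [normalPart, Matrix.mul_add (1 - U * Uᴴ), Matrix.add_mul _ _ (1 - V * Vᴴ), normalPart,
          normalPart, add_sub_add_comm]
      map_smul' := fun c v => by
        have e : Matrix.of (Function.curry (c • v)) = c • Matrix.of (Function.curry v) := rfl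
        funext l
        rw [e, RingHom.id_apply, Pi.smul_apply, ← Matrix.smul_apply, ← opGAdj_smul]
        congr 1
        rw [normalPart, Matrix.mul_smul (1 - U * Uᴴ), Matrix.smul_mul _ _ (1 - V * Vᴴ), normalPart,
          smul_sub] }

theorem tangentColumn_mulVec (U : Matrix (Fin n₁ × Fin s) (Fin r) ℂ)
    (V : Matrix (Fin n₂) (Fin r) ℂ) (j : Fin n) (M : Matrix (Fin n₁ × Fin s) (Fin n₂) ℂ) :
    (tangentColumn n U V j *ᵥ fun p => M p.1 p.2) =
      fun l => (opGAdj (M - normalPart U V M) : Matrix (Fin s) (Fin n) ℂ) l j := by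
  rw [tangentColumn, LinearMap.toMatrix'_mulVec]
  rfl

theorem sqNorm_vectorize {m k : Type*} [Fintype m] [Fintype k] (M : Matrix m k ℂ) :
    (sqNorm fun p : m × k => M p.1 p.2) = ‖M‖ ^ 2 := by
  rw [frobenius_norm_sq, sqNorm, Fintype.sum_prod_type]

/-- With high probability the sensing operator is nearly isometric on the tangent space. -/
theorem exists_bad_event_tangentIsometry {Ω : Type*} [MeasurableSpace Ω] {P : Measure Ω}
    [IsProbabilityMeasure P] {b : Fin n → Ω → Fin s → ℂ} {μ₀ : ℝ}
    (hb : IsSubspaceEnsemble P b μ₀) (hβ : 1 ≤ s * μ₀) (hn : n₁ + n₂ = n + 1) (h₁ : 0 < n₁)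
    (h₂ : 0 < n₂) {μ₁ : ℝ} {U : Matrix (Fin n₁ × Fin s) (Fin r) ℂ}
    {V : Matrix (Fin n₂) (Fin r) ℂ} (h : Incoherent n μ₁ U V) (hU : Uᴴ * U = 1) (hV : Vᴴ * V = 1)
    (hμ : 0 < μ₁) (hr : 0 < r) (hn0 : 0 < n) :
    ∃ T : Set Ω, MeasurableSet T ∧
      P.real T ≤ 2 * (Fintype.card ((Fin n₁ × Fin s) × Fin n₂) *
        Real.exp (-((1 / 10) ^ 2 / (8 * (4 * (μ₁ * r / n) * (s * μ₀)))))) ∧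
      ∀ ω, ω ∉ T → (∀ j, b j ω ∈ boundedVectors s μ₀) →
        IsTangentIsometry U V (sensing hn fun j => b j ω) (Real.sqrt (s * μ₀)) := by
  have hvec : ∀ v : (Fin n₁ × Fin s) × Fin n₂ → ℂ,
      ∃ M : Matrix (Fin n₁ × Fin s) (Fin n₂) ℂ, v = fun p => M p.1 p.2 := fun v =>
    ⟨Matrix.of (Function.curry v), rfl⟩
  obtain ⟨T, hT, hPT, hTv⟩ := exists_bad_event_restricted_isometry hb hβ
    (W := tangentColumn n U V) (p := 4 * (μ₁ * r / n)) (by positivity)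
    (fun j v => by
      obtain ⟨M, rfl⟩ := hvec v
      rw [tangentColumn_mulVec, sqNorm_vectorize]
      exact h.sqNorm_opGAdj_tangent_le hU hV hμ.le M j)
    (fun v => by
      obtain ⟨M, rfl⟩ := hvec v
      simp only [tangentColumn_mulVec]
      rw [sqNorm_vectorize, ← frobenius_norm_sq_eq_sum_sqNorm]
      exact pow_le_pow_left₀ (norm_nonneg _) ((norm_opGAdj_le hn h₁ h₂ _).trans
        (norm_sub_normalPart_le_of_orthonormal hU hV M)) 2)
  refine ⟨T, hT, hPT, fun ω hω hK => isTangentIsometry_sensing hn h₁ h₂ hβ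
    (fun j => sqNorm_le_of_mem_boundedVectors (hK j)) hU hV fun A => ?_⟩
  have := hTv ω hω fun p => A p.1 p.2
  simp only [tangentColumn_mulVec, sqNorm_vectorize] at this
  exact this

theorem norm_mul_diagonal_le {m : Type*} [Fintype m] (A : Matrix m (Fin r) ℂ) {σ : Fin r → ℝ}
    {σ₁ : ℝ} (h0 : ∀ i, 0 ≤ σ i) (h : ∀ i, σ i ≤ σ₁) :
    ‖A * diagonal (fun i => (σ i : ℂ))‖ ^ 2 ≤ σ₁ ^ 2 * ‖A‖ ^ 2 := by
  rw [frobenius_norm_sq, frobenius_norm_sq]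
  simp only [Finset.mul_sum]
  refine Finset.sum_le_sum fun i _ => Finset.sum_le_sum fun k _ => ?_
  rw [mul_diagonal, norm_mul, mul_pow, Complex.norm_real, Real.norm_of_nonneg (h0 k), mul_comm]
  gcongr
  · exact h0 k
  · exact h k

variable {μ₁ σ₁ : ℝ} {U : Matrix (Fin n₁ × Fin s) (Fin r) ℂ} {σ : Fin r → ℝ}
  {V : Matrix (Fin n₂) (Fin r) ℂ} {M : Matrix (Fin n₁ × Fin s) (Fin n₂) ℂ}

theorem Incoherent.sum_block_row_le (h : Incoherent n μ₁ U V) (hM : IsSVD M U σ V)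
    (hσ : ∀ i, σ i ≤ σ₁) (a : Fin n₁) :
    ∑ c, (sqNorm fun l => M (a, l) c) ≤ σ₁ ^ 2 * (μ₁ * r / n) := by
  set Ua : Matrix (Fin s) (Fin r) ℂ := Matrix.of fun l k => U (a, l) k with hUa
  have e : (Matrix.of fun l c => M (a, l) c : Matrix (Fin s) (Fin n₂) ℂ) =
      Ua * diagonal (fun i => (σ i : ℂ)) * Vᴴ := by
    rw [hM.eq]
    ext l c
    simp only [of_apply, mul_apply, hUa]
  have e2 : ∑ c, (sqNorm fun l => M (a, l) c) =
      ‖(Matrix.of fun l c => M (a, l) c : Matrix (Fin s) (Fin n₂) ℂ)‖ ^ 2 := by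
    rw [frobenius_norm_sq_eq_sum_columns]; rfl
  rw [e2, e, norm_mul_conjTranspose_of_orthonormal hM.right_orthonormal]
  refine (norm_mul_diagonal_le _ hM.nonneg hσ).trans ?_
  rw [frobenius_norm_sq]
  exact mul_le_mul_of_nonneg_left (h.1 a) (sq_nonneg _)

theorem norm_diagonal_mul_row_sq_le (hM : IsSVD M U σ V) (hσ : ∀ i, σ i ≤ σ₁) (c : Fin n₂) :
    ∑ k, ‖(diagonal (fun i => (σ i : ℂ)) * Vᴴ) k c‖ ^ 2 ≤ σ₁ ^ 2 * ∑ k, ‖V c k‖ ^ 2 := by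
  rw [Finset.mul_sum]
  refine Finset.sum_le_sum fun k _ => ?_
  rw [diagonal_mul, norm_mul, mul_pow, Complex.norm_real, Real.norm_of_nonneg (hM.nonneg k),
    conjTranspose_apply, norm_star]
  have := hM.nonneg k
  gcongr
  exact hσ k

theorem Incoherent.sum_block_column_le (h : Incoherent n μ₁ U V) (hM : IsSVD M U σ V)
    (hσ : ∀ i, σ i ≤ σ₁) (c : Fin n₂) :
    ∑ a, (sqNorm fun l => M (a, l) c) ≤ σ₁ ^ 2 * (μ₁ * r / n) := by
  set y : Matrix (Fin r) (Fin 1) ℂ :=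
    Matrix.of fun k _ => (diagonal (fun i => (σ i : ℂ)) * Vᴴ) k c with hy
  have e2 : ∑ a, (sqNorm fun l => M (a, l) c) = ‖U * y‖ ^ 2 := by
    rw [frobenius_norm_sq, Fintype.sum_prod_type]
    refine Finset.sum_congr rfl fun a _ => Finset.sum_congr rfl fun l _ => ?_
    rw [hM.eq, Matrix.mul_assoc]
    simp [hy, mul_apply]
  rw [e2, norm_mul_of_orthonormal hM.left_orthonormal, frobenius_norm_sq]
  simp only [hy, of_apply, Finset.univ_unique, Finset.sum_singleton]
  exact (norm_diagonal_mul_row_sq_le hM hσ c).trans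
    (mul_le_mul_of_nonneg_left (h.2 c) (sq_nonneg _))

theorem Incoherent.sqNorm_block_le (h : Incoherent n μ₁ U V) (hM : IsSVD M U σ V)
    (hσ : ∀ i, σ i ≤ σ₁) (hμ : 0 ≤ μ₁) (a : Fin n₁) (c : Fin n₂) :
    (sqNorm fun l => M (a, l) c) ≤ (σ₁ * (μ₁ * r / n)) ^ 2 := by
  have e : M = U * (diagonal (fun i => (σ i : ℂ)) * Vᴴ) := by rw [← Matrix.mul_assoc, ← hM.eq]
  have h1 := sqNorm_block_mul_le U (diagonal (fun i => (σ i : ℂ)) * Vᴴ) a c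
  rw [← e] at h1
  refine h1.trans ?_
  calc _ ≤ (μ₁ * r / n) * (σ₁ ^ 2 * (μ₁ * r / n)) := by
        refine mul_le_mul (h.1 a) ?_ (by positivity) (by positivity)
        exact (norm_diagonal_mul_row_sq_le hM hσ c).trans
          (mul_le_mul_of_nonneg_left (h.2 c) (sq_nonneg _))
    _ = _ := by ring

/-- The squared entries of `U` add up to `r`, while incoherence allows at most `n₁ μ₁ r / n ≤ μ₁ r`.
-/
theorem Incoherent.one_le (h : Incoherent n μ₁ U V) (hU : Uᴴ * U = 1) (hn : n₁ + n₂ = n + 1)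
    (h₁ : 0 < n₁) (h₂ : 0 < n₂) (hr : 0 < r) : 1 ≤ μ₁ := by
  have hn0 : (0 : ℝ) < n := by exact_mod_cast (by omega : 0 < n)
  have hr0 : (0 : ℝ) < r := by exact_mod_cast hr
  have e : (r : ℝ) = ∑ a, ∑ l, ∑ k, ‖U (a, l) k‖ ^ 2 := by
    rw [← Real.sq_sqrt (Nat.cast_nonneg r), ← norm_of_orthonormal hU, frobenius_norm_sq,
      Fintype.sum_prod_type]
  have h3 : (r : ℝ) ≤ n₁ * (μ₁ * r / n) := by
    rw [e]
    refine (Finset.sum_le_sum fun a _ => h.1 a).trans ?_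
    simp [← e]
  have h4 : (n₁ : ℝ) ≤ n := by exact_mod_cast (by omega : n₁ ≤ n)
  have h5 : 0 ≤ μ₁ * r / n := le_trans (by positivity) (h.1 ⟨0, h₁⟩)
  have h6 : (r : ℝ) ≤ n * (μ₁ * r / n) := h3.trans (mul_le_mul_of_nonneg_right h4 h5)
  rw [mul_div_cancel₀ _ hn0.ne'] at h6
  exact le_of_mul_le_mul_right (by linarith) hr0

/-- A vanishing singular value would leave the diagonal factor, and hence `A`, with rank below `r`.
-/
theorem IsSVD.pos_of_rank_eq {m k : Type*} [Fintype m] [Fintype k] {A : Matrix m k ℂ}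
    {U : Matrix m (Fin r) ℂ} {σ : Fin r → ℝ} {V : Matrix k (Fin r) ℂ} (h : IsSVD A U σ V)
    (hA : A.rank = r) (i : Fin r) : 0 < σ i := by
  refine (h.nonneg i).lt_of_ne fun h0 => ?_
  have h1 : r ≤ (diagonal fun i => (σ i : ℂ)).rank := by
    conv_lhs => rw [← hA, h.eq]
    exact (rank_mul_le_left _ _).trans (rank_mul_le_right _ _)
  rw [rank_diagonal] at h1
  have h2 : Fintype.card {i // (σ i : ℂ) ≠ 0} < Fintype.card (Fin r) :=
    Fintype.card_subtype_lt (x := i) (by simp [← h0])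
  rw [Fintype.card_fin] at h2
  omega

end IncoherentLift
end BlindSR

/-! ### Assembly: deterministic recovery, the good event and the iteration count. -/

namespace BlindSR
open Matrix

section Recovery
variable {s n n₁ n₂ r : ℕ}

theorem nonempty_of_orthonormal {m : Type*} [Fintype m] {U : Matrix m (Fin r) ℂ} (hr : 0 < r)
    (hU : Uᴴ * U = 1) : Nonempty m := by
  by_contra h
  rw [not_nonempty_iff] at h
  have := congrFun (congrFun hU ⟨0, hr⟩) ⟨0, hr⟩
  simp [mul_apply] at this

theorem IsSVD.one_sub_mul_eq_zero {m k : Type*} [Fintype m] [Fintype k] [DecidableEq m]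
    {A : Matrix m k ℂ} {U : Matrix m (Fin r) ℂ} {σ : Fin r → ℝ} {V : Matrix k (Fin r) ℂ}
    (h : IsSVD A U σ V) : (1 - U * Uᴴ) * A = 0 := by
  rw [Matrix.sub_mul, Matrix.one_mul, sub_eq_zero]
  conv_rhs => rw [h.eq]
  rw [Matrix.mul_assoc U Uᴴ, Matrix.mul_assoc U, ← Matrix.mul_assoc Uᴴ U, h.left_orthonormal,
    Matrix.one_mul, ← Matrix.mul_assoc]
  exact h.eq

theorem IsSVD.mul_one_sub_eq_zero {m k : Type*} [Fintype m] [Fintype k] [DecidableEq k]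
    {A : Matrix m k ℂ} {U : Matrix m (Fin r) ℂ} {σ : Fin r → ℝ} {V : Matrix k (Fin r) ℂ}
    (h : IsSVD A U σ V) : A * (1 - V * Vᴴ) = 0 := by
  rw [Matrix.mul_sub, Matrix.mul_one, sub_eq_zero]
  conv_rhs => rw [h.eq]
  rw [Matrix.mul_assoc _ Vᴴ, ← Matrix.mul_assoc Vᴴ, h.right_orthonormal, Matrix.one_mul]
  exact h.eq

/-- Linear convergence of the gradient iterates, given that the sensing operator is nearly
isometric on the tangent space and that the spectral matrix is close to the lift. -/
theorem norm_vgdEstimate_sub_sq_le (hn : n₁ + n₂ = n + 1) (h₁ : 0 < n₁) (h₂ : 0 < n₂) (hr : 0 < r)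
    {X : Matrix (Fin s) (Fin n) ℂ} {U : Matrix (Fin n₁ × Fin s) (Fin r) ℂ} {σ : Fin r → ℝ}
    {V : Matrix (Fin n₂) (Fin r) ℂ} (hM : IsSVD (hankel hn X) U σ V) {b : Fin n → Fin s → ℂ}
    {β σ₁ σᵣ η : ℝ} (hβ : 1 ≤ β) (G : IsTangentIsometry U V (sensing hn b) (Real.sqrt β))
    (hσᵣ : 0 < σᵣ) (hle : ∀ i, σ i ≤ σ₁) (hge : ∀ i, σᵣ ≤ σ i) (hη : 0 < η)
    (hησ : η * σ₁ ≤ 1 / 25)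
    (hinit : IsBoundedAbove (opG hn (opAAdj b (measurements n₁ n₂ b X)) - hankel hn X)
      (σᵣ / (4000 * Real.sqrt (r * β))))
    {U₀ : Matrix (Fin n₁ × Fin s) (Fin r) ℂ} {σ₀ : Fin r → ℝ} {V₀ : Matrix (Fin n₂) (Fin r) ℂ}
    (h₀ : IsTopSVD (opG hn (opAAdj b (measurements n₁ n₂ b X))) U₀ σ₀ V₀) (k : ℕ) :
    ‖vgdEstimate hn b (measurements n₁ n₂ b X) η U₀ σ₀ V₀ k - X‖ ^ 2 ≤
      (1 - η * σᵣ / 28) ^ k * σᵣ ^ 2 := by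
  have hσ : σᵣ ≤ σ₁ := (hge ⟨0, hr⟩).trans (hle ⟨0, hr⟩)
  have hr1 : (1 : ℝ) ≤ r := by exact_mod_cast hr
  have hrβ : 1 ≤ Real.sqrt (r * β) := Real.one_le_sqrt.2 (by nlinarith)
  have hν : σᵣ / (4000 * Real.sqrt (r * β)) ≤ 0.09 * σᵣ := by
    rw [div_le_iff₀ (by positivity)]
    nlinarith
  obtain ⟨hL, hR, hL', hR', hclose⟩ := spectral_initialization hM h₀ (by positivity) hinit hσᵣ hle
    hge hσ hν
  have ha : Real.sqrt σᵣ ^ 2 = σᵣ := Real.sq_sqrt hσᵣ.le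
  have hs : Real.sqrt σ₁ ^ 2 = σ₁ := Real.sq_sqrt (hσᵣ.le.trans hσ)
  set Z := vgdIterates hn b (measurements n₁ n₂ b X) η U₀ σ₀ V₀ with hZ
  have hstep : ∀ k, Z (k + 1) =
      ((Z k).1 - η • (sensing hn b ((Z k).1 * (Z k).2ᴴ - hankel hn X) * (Z k).2),
        (Z k).2 - η • ((sensing hn b ((Z k).1 * (Z k).2ᴴ - hankel hn X))ᴴ * (Z k).1)) := by
    intro k
    rw [← residual_eq_sensing hn h₁ h₂, ← Complex.coe_smul, ← Complex.coe_smul]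
    rfl
  -- The parameters are `a = √σᵣ`, `s = √σ₁` and `h = √β`. The `4000` in the spectral error is
  -- chosen so that `√β · 4√r · ν` equals `σᵣ/1000`, the required initial closeness.
  have h := gradientDescent_converges G (Real.sqrt_pos.2 hσᵣ) (Real.sqrt_le_sqrt hσ)
    hM.one_sub_mul_eq_zero hM.mul_one_sub_eq_zero hη (by rwa [hs]) hstep hL hR hL' hR' (by
      rw [ha]
      refine (mul_le_mul_of_nonneg_left hclose (Real.sqrt_nonneg _)).trans (le_of_eq ?_)
      have h0 : Real.sqrt r * Real.sqrt β = Real.sqrt (r * β) :=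
        (Real.sqrt_mul (Nat.cast_nonneg r) β).symm
      rw [← h0] at hrβ ⊢
      have h3 : Real.sqrt r * Real.sqrt β ≠ 0 := by linarith
      have h4 := left_ne_zero_of_mul h3
      have h5 := right_ne_zero_of_mul h3
      field_simp
      norm_num) k
  rw [ha] at h
  refine le_trans (pow_le_pow_left₀ (norm_nonneg _) ?_ 2) h
  exact norm_scaleInv_opGAdj_sub_le hn h₁ h₂ _ X

theorem exp_neg_le_rpow_neg_three {N z : ℝ} (hN : 0 < N) (h : 3 * Real.log N ≤ z) :
    Real.exp (-z) ≤ (N ^ 3)⁻¹ := by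
  rw [Real.exp_neg]
  refine inv_anti₀ (by positivity) ?_
  rw [← Real.exp_log (pow_pos hN 3), Real.log_pow]
  exact Real.exp_le_exp.2 (by exact_mod_cast h)

/-- With high probability the sensing operator is nearly isometric on the tangent space and the
spectral matrix is close to the lift. -/
theorem exists_good_event {Ω : Type*} [MeasurableSpace Ω] {P : Measure Ω}
    [IsProbabilityMeasure P] {b : Fin n → Ω → Fin s → ℂ} {μ₀ : ℝ}
    (hb : IsSubspaceEnsemble P b μ₀) (hs : 0 < s) (hn : n₁ + n₂ = n + 1) (h₁ : 0 < n₁)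
    (h₂ : 0 < n₂) (hr : 0 < r) {X : Matrix (Fin s) (Fin n) ℂ} {μ₁ : ℝ}
    {U : Matrix (Fin n₁ × Fin s) (Fin r) ℂ} {σ : Fin r → ℝ} {V : Matrix (Fin n₂) (Fin r) ℂ}
    (hM : IsSVD (hankel hn X) U σ V) (h : Incoherent n μ₁ U V) {σ₁ σᵣ : ℝ} (hσᵣ : 0 < σᵣ)
    (hle : ∀ i, σ i ≤ σ₁) (hσ : σᵣ ≤ σ₁) (hβ : 1 ≤ s * μ₀)
    (hsample : 400000000 * (s * μ₀) ^ 2 * μ₁ * r ^ 2 * (σ₁ / σᵣ) ^ 2 * Real.log (s * n) ≤ n) :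
    ∃ E : Set Ω, MeasurableSet E ∧ 1 - 4 * ((s : ℝ) * n)⁻¹ ≤ P.real E ∧ ∀ ω ∈ E,
      IsTangentIsometry U V (sensing hn fun j => b j ω) (Real.sqrt (s * μ₀)) ∧
      IsBoundedAbove (opG hn (opAAdj (fun j => b j ω)
        (measurements n₁ n₂ (fun j => b j ω) X)) - hankel hn X)
        (σᵣ / (4000 * Real.sqrt (r * (s * μ₀)))) := by
  have hn0 : 0 < n := by omega
  have hnR : (1 : ℝ) ≤ n := by exact_mod_cast hn0
  have hsR : (1 : ℝ) ≤ s := by exact_mod_cast hs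
  have hrR : (1 : ℝ) ≤ r := by exact_mod_cast hr
  have hμ : 1 ≤ μ₁ := h.one_le hM.left_orthonormal hn h₁ h₂ hr
  have hσ1 : 0 < σ₁ := hσᵣ.trans_le hσ
  set β : ℝ := s * μ₀ with hβdef
  set N : ℝ := (s : ℝ) * n with hN
  have hN1 : 1 ≤ N := by nlinarith
  have hlog : 0 ≤ Real.log N := Real.log_nonneg hN1
  have hκ : 1 ≤ σ₁ / σᵣ := (one_le_div hσᵣ).2 hσ
  obtain ⟨T₁, hT₁, hP₁, hG₁⟩ := exists_bad_event_tangentIsometry hb hβ hn h₁ h₂ h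
    hM.left_orthonormal hM.right_orthonormal (by linarith) hr hn0
  obtain ⟨T₂, hT₂, hP₂, hG₂⟩ := exists_bad_event_hankel hb hβ hn (fun j l => X l j)
    (ρ := σ₁ * (μ₁ * r / n)) (Λ := σ₁ ^ 2 * (μ₁ * r / n))
    (t := σᵣ / (4000 * Real.sqrt (r * β))) (by positivity) (by positivity) (by positivity)
    (fun j => by
      -- Every column of `X` occurs as some block of the lift; this one moves down the first block
      -- column and then along the last block row.
      have e : j = ⟨min (j : ℕ) (n₁ - 1) + (j - min (j : ℕ) (n₁ - 1)), by omega⟩ :=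
        Fin.ext (by simp)
      rw [e]
      exact h.sqNorm_block_le hM hle (by linarith) ⟨min (j : ℕ) (n₁ - 1), by omega⟩
        ⟨(j : ℕ) - min (j : ℕ) (n₁ - 1), by omega⟩)
    (fun a => h.sum_block_row_le hM hle a) (fun c => h.sum_block_column_le hM hle c)
    (by
      have h3 : σᵣ / (4000 * Real.sqrt (r * β)) ≤ σ₁ := by
        rw [div_le_iff₀ (by positivity)]
        have : 1 ≤ Real.sqrt (r * β) := Real.one_le_sqrt.2 (by nlinarith)
        nlinarith
      calc σ₁ * (μ₁ * r / n) * (σᵣ / (4000 * Real.sqrt (r * β)))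
          ≤ σ₁ * (μ₁ * r / n) * σ₁ := by gcongr
        _ ≤ 2 * (σ₁ ^ 2 * (μ₁ * r / n)) := by
          have : 0 ≤ σ₁ ^ 2 * (μ₁ * r / n) := by positivity
          linarith)
  have hK : MeasurableSet {ω | ∀ j, b j ω ∈ boundedVectors s μ₀} := by
    have e : {ω | ∀ j, b j ω ∈ boundedVectors s μ₀} =
        ⋂ j, b j ⁻¹' boundedVectors s μ₀ := by ext; simp
    rw [e]
    exact MeasurableSet.iInter fun j =>
      hb.measurable j (isCompact_boundedVectors s μ₀).isClosed.measurableSet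
  have hK0 : P.real {ω | ∀ j, b j ω ∈ boundedVectors s μ₀}ᶜ = 0 := by
    have h0 : P {ω | ∀ j, b j ω ∈ boundedVectors s μ₀}ᶜ = 0 :=
      ae_iff.1 (ae_all_iff.2 hb.ae_mem)
    rw [measureReal_def, h0, ENNReal.toReal_zero]
  have hsd : N ^ 2 * (N ^ 3)⁻¹ = N⁻¹ := by field_simp
  have hn₁ : (n₁ : ℝ) ≤ n := by exact_mod_cast (by omega : n₁ ≤ n)
  have hn₂ : (n₂ : ℝ) ≤ n := by exact_mod_cast (by omega : n₂ ≤ n)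
  -- The dimension is at most `N²` and the exponential at most `N⁻³`, leaving `N⁻¹`.
  have htail₁ : P.real T₁ ≤ 2 * N⁻¹ := by
    refine hP₁.trans ?_
    rw [← hsd]
    refine mul_le_mul_of_nonneg_left (mul_le_mul ?_ (exp_neg_le_rpow_neg_three (by positivity) ?_)
      (Real.exp_pos _).le (by positivity)) (by norm_num)
    · simp only [Fintype.card_prod, Fintype.card_fin, Nat.cast_mul]
      calc (n₁ : ℝ) * s * n₂ ≤ n * s * n := by gcongr
        _ ≤ n * s * n * s := le_mul_of_one_le_right (by positivity) hsR
        _ = N ^ 2 := by rw [hN]; ring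
    · have e : ((1 : ℝ) / 10) ^ 2 / (8 * (4 * (μ₁ * r / n) * β)) = n / (3200 * (μ₁ * r * β)) := by
        field_simp
        norm_num
      rw [e, le_div_iff₀ (by positivity)]
      refine le_trans ?_ hsample
      calc 3 * Real.log N * (3200 * (μ₁ * r * β))
          = 9600 * (β * μ₁ * r) * Real.log N := by ring
        _ ≤ 400000000 * (β ^ 2 * μ₁ * r ^ 2 * (σ₁ / σᵣ) ^ 2) * Real.log N := by
          have h3 : β * μ₁ * r ≤ β ^ 2 * μ₁ * r ^ 2 * (σ₁ / σᵣ) ^ 2 := by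
            calc β * μ₁ * r ≤ β ^ 2 * μ₁ * r ^ 2 := by
                  gcongr
                  · exact le_self_pow₀ hβ (by norm_num)
                  · exact le_self_pow₀ hrR (by norm_num)
              _ ≤ _ := le_mul_of_one_le_right (by positivity) (one_le_pow₀ hκ)
          have h4 : 0 ≤ β * μ₁ * r := by positivity
          refine mul_le_mul_of_nonneg_right ?_ hlog
          linarith
        _ = _ := by ring
  have htail₂ : P.real T₂ ≤ 2 * N⁻¹ := by
    refine hP₂.trans ?_
    rw [← hsd, ← mul_assoc 2 (N ^ 2)]
    refine mul_le_mul ?_ (exp_neg_le_rpow_neg_three (by positivity) ?_)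
      (Real.exp_pos _).le (by positivity)
    · simp only [Fintype.card_sum, Fintype.card_prod, Fintype.card_fin, Nat.cast_mul, Nat.cast_add]
      have h3 : (n₁ : ℝ) * s ≤ N := by rw [hN, mul_comm]; gcongr
      have h4 : (n₂ : ℝ) ≤ N := hn₂.trans (le_mul_of_one_le_left (by positivity) hsR)
      nlinarith
    -- This event fixes the sampling constant: `8 · 4000² = 128000000`, and three times it is below
    -- `400000000`. The small target radius `t` is also the source of `β² r²` and of the square of
    -- the condition number.
    · have hsq : Real.sqrt (r * β) ^ 2 = r * β := Real.sq_sqrt (by positivity)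
      have e : (σᵣ / (4000 * Real.sqrt (r * β))) ^ 2 / (8 * (β * (σ₁ ^ 2 * (μ₁ * r / n)))) =
          n / (128000000 * (β ^ 2 * μ₁ * r ^ 2 * (σ₁ / σᵣ) ^ 2)) := by
        rw [div_pow, mul_pow, hsq]
        field_simp
        norm_num
      rw [e, le_div_iff₀ (by positivity)]
      refine le_trans ?_ hsample
      have h4 : 0 ≤ β ^ 2 * μ₁ * r ^ 2 * (σ₁ / σᵣ) ^ 2 * Real.log N := by positivity
      linarith
  refine ⟨(T₁ ∪ T₂ ∪ {ω | ∀ j, b j ω ∈ boundedVectors s μ₀}ᶜ)ᶜ,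
    ((hT₁.union hT₂).union hK.compl).compl, ?_, fun ω hω => ?_⟩
  · rw [probReal_compl_eq_one_sub ((hT₁.union hT₂).union hK.compl)]
    have h3 := measureReal_union_le (μ := P) (T₁ ∪ T₂) {ω | ∀ j, b j ω ∈ boundedVectors s μ₀}ᶜ
    have h4 := measureReal_union_le (μ := P) T₁ T₂
    linarith
  · rw [Set.compl_union, Set.compl_union, compl_compl] at hω
    obtain ⟨⟨hω₁, hω₂⟩, hωK⟩ := hω
    refine ⟨hG₁ ω hω₁ hωK, ?_⟩
    rw [opG_opAAdj_measurements_sub hn h₁ h₂]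
    exact hG₂ ω hω₂

/-- By `1 - x ≤ exp(-x)`, it suffices that `η σᵣ k / 28` reach `2 log(1/ε)`. The doubling comes from
squared errors, whence `56 = 2 · 28`. -/
theorem le_of_linear_rate {e σ₁ σᵣ η θ ε : ℝ} {k : ℕ} (hσᵣ : 0 < σᵣ) (hσ : σᵣ ≤ σ₁)
    (hη : η * σ₁ ≤ 1 / 25) (he : e ^ 2 ≤ (1 - η * σᵣ / 28) ^ k * σᵣ ^ 2)
    (hθ : 0 < θ) (hθη : θ / σ₁ ≤ η) (hε : 0 < ε)
    (hk : 56 / θ * (σ₁ / σᵣ) * Real.log (1 / ε) ≤ k) : e ≤ ε * σᵣ := by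
  have hσ1 : 0 < σ₁ := hσᵣ.trans_le hσ
  have hη0 : 0 < η := (div_pos hθ hσ1).trans_le hθη
  have h0 : 0 ≤ 1 - η * σᵣ / 28 := by nlinarith
  have h1 : (1 - η * σᵣ / 28) ^ k ≤ ε ^ 2 := by
    calc (1 - η * σᵣ / 28) ^ k ≤ Real.exp (-(η * σᵣ / 28)) ^ k :=
          pow_le_pow_left₀ h0 (Real.one_sub_le_exp_neg _) k
      _ = Real.exp (-(η * σᵣ / 28 * k)) := by
          rw [← Real.exp_nat_mul]; congr 1; ring
      _ ≤ Real.exp (2 * Real.log ε) := by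
          refine Real.exp_le_exp.2 ?_
          have h2 : θ / σ₁ * σᵣ / 28 * (56 / θ * (σ₁ / σᵣ) * Real.log (1 / ε)) ≤
              η * σᵣ / 28 * k := by
            refine (mul_le_mul_of_nonneg_left hk (by positivity)).trans ?_
            gcongr
          have h3 : θ / σ₁ * σᵣ / 28 * (56 / θ * (σ₁ / σᵣ) * Real.log (1 / ε)) =
              2 * Real.log (1 / ε) := by
            field_simp
            ring
          rw [h3, one_div, Real.log_inv] at h2
          linarith
      _ = ε ^ 2 := by
          rw [mul_comm, Real.exp_mul, Real.exp_log hε]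
          exact_mod_cast Real.rpow_natCast ε 2
  refine le_of_sq_le_sq ?_ (by positivity)
  refine he.trans ?_
  rw [mul_pow]
  gcongr

end Recovery
end BlindSR

theorem theorem1 :
    ∃ c₁ c₂ C₁ C₂ : ℝ, 0 < c₁ ∧ 0 < c₂ ∧ 0 < C₁ ∧ 0 < C₂ ∧
      ∀ (s r n n₁ n₂ : ℕ) (hn : n₁ + n₂ = n + 1) (hr : 0 < r)
        -- the ground truth, its lift of rank `r`, and the SVD of the lift
        (X : Matrix (Fin s) (Fin n) ℂ)
        (U : Matrix (Fin n₁ × Fin s) (Fin r) ℂ) (σ : Fin r → ℝ) (V : Matrix (Fin n₂) (Fin r) ℂ)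
        (μ₁ : ℝ),
        (BlindSR.hankel hn X).rank = r →
        BlindSR.IsSVD (BlindSR.hankel hn X) U σ V →
        BlindSR.Incoherent n μ₁ U V →
        -- the random subspace vectors
        ∀ (Ω : Type*) [MeasurableSpace Ω] (P : Measure Ω) [IsProbabilityMeasure P]
          (b : Fin n → Ω → Fin s → ℂ) (μ₀ : ℝ),
        BlindSR.IsSubspaceEnsemble P b μ₀ →
        -- extreme singular values and condition number of the lift, and the parameters
        ∀ (σ₁ σᵣ κ δ₀ η : ℝ),
        σ₁ = σ ⟨0, hr⟩ → σᵣ = σ ⟨r - 1, Nat.sub_lt hr Nat.one_pos⟩ → κ = σ₁ / σᵣ →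
        0 < δ₀ → δ₀ ≤ 2 / 25 →
        0 < η → η ≤ 1 / (25 * σ₁) →
        C₁ * (δ₀ ^ 2)⁻¹ * μ₀ ^ 2 * μ₁ * (s : ℝ) ^ 2 * (r : ℝ) ^ 2 * κ ^ 3 *
          (Real.log ((s : ℝ) * n)) ^ 2 ≤ (n : ℝ) →
        ∃ E : Set Ω, MeasurableSet E ∧
          1 - c₁ * ((s : ℝ) * n) ^ (-c₂) ≤ P.real E ∧
          ∀ ω ∈ E, ∀ y : Fin n → ℂ, y = BlindSR.measurements n₁ n₂ (fun j => b j ω) X →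
            -- whichever top-`r` SVD the spectral initialization uses
            ∀ (U₀ : Matrix (Fin n₁ × Fin s) (Fin r) ℂ) (σ₀ : Fin r → ℝ)
              (V₀ : Matrix (Fin n₂) (Fin r) ℂ),
              BlindSR.IsTopSVD (BlindSR.opG hn (BlindSR.opAAdj (fun j => b j ω) y)) U₀ σ₀ V₀ →
              (∀ k : ℕ, ‖BlindSR.vgdEstimate hn (fun j => b j ω) y η U₀ σ₀ V₀ k - X‖ ^ 2 ≤
                (1 - η * σᵣ / 28) ^ k * σᵣ ^ 2) ∧
              -- iteration complexity `O(κ log(1/ε))` for step sizes of order `1 / σ₁`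
              (∀ θ : ℝ, 0 < θ → θ / σ₁ ≤ η →
                ∀ ε : ℝ, 0 < ε → ε < 1 →
                  ∀ k : ℕ, C₂ / θ * κ * Real.log (1 / ε) ≤ k →
                    ‖BlindSR.vgdEstimate hn (fun j => b j ω) y η U₀ σ₀ V₀ k - X‖ ≤ ε * σᵣ) := by
  refine ⟨4, 1, 400000000, 56, by norm_num, by norm_num, by norm_num, by norm_num, ?_⟩
  intro s r n n₁ n₂ hn hr X U σ V μ₁ hrank hM hinc Ω _ P _ b μ₀ hb σ₁ σᵣ κ δ₀ η hσ₁ hσᵣ hκ hδ hδ'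
    hη hη' hsample
  -- With `r ≥ 1`, orthonormal columns cannot have an empty row index, which forces `n₁`, `n₂`, `s`
  -- and hence `n` to be positive.
  obtain ⟨⟨⟨a₀, ha₀⟩, ⟨l₀, hl₀⟩⟩⟩ := BlindSR.nonempty_of_orthonormal hr hM.left_orthonormal
  obtain ⟨⟨c₀, hc₀⟩⟩ := BlindSR.nonempty_of_orthonormal hr hM.right_orthonormal
  have h₁ : 0 < n₁ := by omega
  have h₂ : 0 < n₂ := by omega
  have hs : 0 < s := by omega
  have hn0 : 0 < n := by omega
  have hpos : 0 < σᵣ := hσᵣ ▸ hM.pos_of_rank_eq hrank _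
  have hle : ∀ i, σ i ≤ σ₁ := fun i => hσ₁ ▸ hM.antitone (Fin.mk_le_of_le_val (Nat.zero_le _))
  have hge : ∀ i, σᵣ ≤ σ i := fun i => hσᵣ ▸ hM.antitone (Fin.le_def.2 (by simp; omega))
  have hσ : σᵣ ≤ σ₁ := (hge ⟨0, hr⟩).trans (hle _)
  have hσ0 : 0 < σ₁ := hpos.trans_le hσ
  have hμ₀ : 1 ≤ μ₀ := hb.one_le_of_pos hs hn0
  have hμ₁ : 1 ≤ μ₁ := hinc.one_le hM.left_orthonormal hn h₁ h₂ hr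
  have hsR : (1 : ℝ) ≤ s := by exact_mod_cast hs
  have hβ : 1 ≤ s * μ₀ := by nlinarith
  have hησ : η * σ₁ ≤ 1 / 25 := by
    rw [le_div_iff₀ (by positivity)] at hη'
    linarith
  rw [Real.rpow_neg_one]
  -- For `s n ≤ 2` the claimed probability is negative and the empty event will do. Otherwise `s n ≥
  -- 3 > e`, so the logarithm is at least `1`.
  rcases le_or_gt (s * n) 2 with hsmall | hlarge
  · refine ⟨∅, MeasurableSet.empty, ?_, fun ω hω => hω.elim⟩
    have h3 : (0 : ℝ) < (s : ℝ) * n := by exact_mod_cast Nat.mul_pos hs hn0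
    have h4 : (s : ℝ) * n ≤ 2 := by exact_mod_cast hsmall
    have h5 : (2 : ℝ)⁻¹ ≤ ((s : ℝ) * n)⁻¹ := inv_anti₀ h3 h4
    have h6 : (0 : ℝ) ≤ P.real ∅ := measureReal_nonneg
    linarith
  · have hκ1 : 1 ≤ κ := by rw [hκ]; exact (one_le_div hpos).2 hσ
    have hlog : 1 ≤ Real.log ((s : ℝ) * n) := by
      have h3 : (3 : ℝ) ≤ (s : ℝ) * n := by exact_mod_cast hlarge
      rw [Real.le_log_iff_exp_le (by linarith)]
      linarith [Real.exp_one_lt_d9]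
    have hδ1 : 1 ≤ (δ₀ ^ 2)⁻¹ := (one_le_inv₀ (by positivity)).2 (by nlinarith)
    obtain ⟨E, hE, hPE, hgood⟩ := BlindSR.exists_good_event hb hs hn h₁ h₂ hr hM hinc hpos hle hσ
      hβ (by
        refine le_trans ?_ hsample
        rw [← hκ]
        have h0 : 0 ≤ (s * μ₀) ^ 2 * μ₁ * (r : ℝ) ^ 2 := by positivity
        -- The good event needs only `κ²` and one logarithm; as `δ₀⁻²`, `κ` and the logarithm are
        -- all at least `1`, the assumed sample size is larger.
        calc 400000000 * (s * μ₀) ^ 2 * μ₁ * (r : ℝ) ^ 2 * κ ^ 2 * Real.log (s * n)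
            = 400000000 * ((s * μ₀) ^ 2 * μ₁ * (r : ℝ) ^ 2) *
                (1 * (κ ^ 2 * Real.log (s * n))) := by ring
          _ ≤ 400000000 * ((s * μ₀) ^ 2 * μ₁ * (r : ℝ) ^ 2) *
                ((δ₀ ^ 2)⁻¹ * (κ ^ 3 * Real.log (s * n) ^ 2)) := by
            have h3 : κ ^ 2 ≤ κ ^ 3 := pow_le_pow_right₀ hκ1 (by norm_num)
            have h4 : Real.log (s * n) ≤ Real.log (s * n) ^ 2 := le_self_pow₀ hlog (by norm_num)
            gcongr
          _ = _ := by ring)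
    refine ⟨E, hE, hPE, fun ω hω y hy U₀ σ₀ V₀ hU₀ => ?_⟩
    subst hy
    obtain ⟨hG, hinit⟩ := hgood ω hω
    have hrate := BlindSR.norm_vgdEstimate_sub_sq_le hn h₁ h₂ hr hM hβ hG hpos hle hge hη hησ hinit
      hU₀
    refine ⟨hrate, fun θ hθ hθη ε hε _ k hk => ?_⟩
    rw [hκ] at hk
    exact BlindSR.le_of_linear_rate hpos hσ hησ (hrate k) hθ hθη hε hk
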